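/- Let $\varepsilon=1$ and $\mathbb K=\mathbb C=\{x+iy\}$, or $\varepsilon=-1$ and $\mathbb K=\mathbb L=\{x+\tau y:\ x,y\in\mathbb R\}$, $\tau^2=1$ (the paracomplex numbers, with $\overline{x+\tau y}=x-\tau y$ and the topology of $\mathbb R^2$). Let $\Omega\subset\mathbb K$ be open and simply connected. A smooth function $\lambda:\Omega\to\mathbb R$ is called a solution of the Liouville equation if $\Delta\lambda=-\varepsilon e^{-4\lambda}$ on $\Omega$, where $\Delta$ is the Laplace--Beltrami operator of the metric $e^{2\lambda}(dx^2+\varepsilon\,dy^2)$. A function with values in $\mathbb L$ is paraholomorphic if it is smooth and $f_x=\tau f_y$; then $f'=\tfrac12(f_x+\tau f_y)$. A $\mathbb K$-valued function $g$ is (para)meromorphic on $\Omega$ with only simple poles if every $z_0\in\Omega$ is either a regular point ($g$ is holomorphic, respectively paraholomorphic, near $z_0$) or a simple pole: near $z_0$, $g(z)=h(z)/(z-z_0)$ wherever $z-z_0$ is invertible, with $h$ (para)holomorphic near $z_0$ and $h(z_0)\ne0$. Call such a $g$ admissible if $g\bar g\neq\varepsilon$ and $g'\overline{g'}>0$ at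 all regular points, and say that $g$ represents $\lambda$ if $$e^{\lambda}=\frac{|1-\varepsilon g\bar g|}{2\sqrt{g'\,\overline{g'}}}\qquad\text{at all regular points of } g \text{ in } \Omega. \tag{1}$$ 1. If $g$ is admissible, then it represents a solution of the Liouville equation on $\Omega$; that is, the function $\lambda$ defined by (1) at the regular points extends across the poles to a solution, and every continuous $\lambda:\Omega\to\mathbb R$ that satisfies (1) is a solution. 2. Conversely, every solution $\lambda$ of the Liouville equation on $\Omega$ is represented by some admissible $g$. 3. Let $\lambda$ be a solution represented by the admissible function $g$. For all $a,b\in\mathbb K$ with $a\bar a-\varepsilon b\bar b\in\{1,-1\}$ the function $$T_{ab}(g)=\frac{a\,g+\varepsilon b}{\bar b\,g+\bar a}$$ (understood as a (para)meromorphic function) is admissible and represents $\lambda$, and every admissible $g_2$ that represents $\lambda$ is of this form. Moreover, $g_2=T_{ab}(g)$ for some $a,b$ with $a\bar a-\varepsilon b\bar b=1$ if, at some point of $\Omega$ that is regular for both $g$ and $g_2$: for $\varepsilon=1$, $(1-|g|^2)(1-|g_2|^2)>0$; for $\varepsilon=-1$, the real parts of $g'$ and $g_2'$ have the same sign. -/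

import Mathlib

open Filter Topology
open scoped ContDiff

noncomputable section

/-! ### The Liouville equation -/

/-- The Laplace-Beltrami operator, in the linear coordinates given by the frame `e` of the plane
`E`, of the (pseudo-)Riemannian metric with coefficient matrix `G`:
`Δ f = |det G|^(-1/2) ∑ i, ∂_i (|det G|^(1/2) ∑ j, G^{ij} ∂_j f)`. -/
def laplaceBeltrami {E : Type*} [AddCommGroup E] [Module ℝ E] (e : Fin 2 → E)
    (G : E → Matrix (Fin 2) (Fin 2) ℝ) (f : E → ℝ) (z : E) : ℝ :=
  (√|(G z).det|)⁻¹ *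
    ∑ i, lineDeriv ℝ
      (fun w => √|(G w).det| * ∑ j, (G w)⁻¹ i j * lineDeriv ℝ f w (e j)) z (e i)

/-- The coefficient matrix of the metric `e^{2 lam} (dx² + ε dy²)`. -/
def conformalMetric {E : Type*} (ε : ℝ) (lam : E → ℝ) (z : E) : Matrix (Fin 2) (Fin 2) ℝ :=
  Real.exp (2 * lam z) • !![1, 0; 0, ε]

/-- `lam` is a smooth solution on `Ω` of the Liouville equation `Δ lam = - ε e^{-4 lam}`, where
`Δ` is the Laplace-Beltrami operator of `e^{2 lam} (dx² + ε dy²)`; `e` is the frame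
`(∂/∂x, ∂/∂y)`. -/
def IsLiouvilleSolution {E : Type*} [NormedAddCommGroup E] [NormedSpace ℝ E] (ε : ℝ)
    (e : Fin 2 → E) (Ω : Set E) (lam : E → ℝ) : Prop :=
  ContDiffOn ℝ ∞ lam Ω ∧
    ∀ z ∈ Ω, laplaceBeltrami e (conformalMetric ε lam) lam z = -ε * Real.exp (-4 * lam z)

/-! ### The complex case, `ε = 1` -/

/-- The coordinate frame `(∂/∂x, ∂/∂y)` of `ℂ`, where `z = x + i y`. -/
def complexFrame : Fin 2 → ℂ := ![1, Complex.I]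

/-- `g` is meromorphic on `Ω`, its only singularities are simple poles, and `g ḡ ≠ 1` and
`g' ḡ' > 0` at its regular points. The values of `g` at the poles are irrelevant. -/
def IsComplexDatum (Ω : Set ℂ) (g : ℂ → ℂ) : Prop :=
  MeromorphicOn g Ω ∧
  (∀ z ∈ Ω, AnalyticAt ℂ g z ∨ meromorphicOrderAt g z = -1) ∧
  ∀ z ∈ Ω, AnalyticAt ℂ g z → Complex.normSq (g z) ≠ 1 ∧ 0 < Complex.normSq (deriv g z)

/-- `e^lam = |1 - g ḡ| / (2 √(g' ḡ'))` at all regular points of `g` in `Ω`. -/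
def ComplexRepresents (Ω : Set ℂ) (g : ℂ → ℂ) (lam : ℂ → ℝ) : Prop :=
  ∀ z ∈ Ω, AnalyticAt ℂ g z →
    Real.exp (lam z) =
      |1 - Complex.normSq (g z)| / (2 * √(Complex.normSq (deriv g z)))

/-- `g₂ = (a g + b) / (b̄ g + ā)` as meromorphic functions on `Ω`. -/
def IsComplexTransform (Ω : Set ℂ) (a b : ℂ) (g g₂ : ℂ → ℂ) : Prop :=
  ∀ z ∈ Ω, AnalyticAt ℂ g z → AnalyticAt ℂ g₂ z →
    star b * g z + star a ≠ 0 ∧ g₂ z = (a * g z + b) / (star b * g z + star a)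

/-! ### The paracomplex case, `ε = -1` -/

/-- The algebra of paracomplex (Lorentz) numbers `x + τ y`, `τ² = 1`. The conjugation is `star`,
and `QuadraticAlgebra.norm z` is the real number `z z̄ = x² - y²`. -/
abbrev Paracomplex : Type := QuadraticAlgebra ℝ 1 0

namespace Paracomplex

/-- The paracomplex unit. -/
def tau : Paracomplex := QuadraticAlgebra.omega

/-- The coordinates `z = x + τ y ↦ (x, y)`. -/
def toPlane : Paracomplex →ₗ[ℝ] ℝ × ℝ :=
  LinearMap.prod (QuadraticAlgebra.reₗ 1 0) (QuadraticAlgebra.imₗ 1 0)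

theorem toPlane_injective : Function.Injective toPlane := fun _ _ h =>
  QuadraticAlgebra.ext (congrArg Prod.fst h) (congrArg Prod.snd h)

/-- An auxiliary norm, which induces the topology and the smooth structure of the plane. -/
instance instNormedAddCommGroup : NormedAddCommGroup Paracomplex :=
  NormedAddCommGroup.induced Paracomplex (ℝ × ℝ) toPlane toPlane_injective

instance instNormedSpace : NormedSpace ℝ Paracomplex :=
  NormedSpace.induced ℝ Paracomplex (ℝ × ℝ) toPlane

/-- The coordinate frame `(∂/∂x, ∂/∂y)` of the paracomplex plane, where `z = x + τ y`. -/
def frame : Fin 2 → Paracomplex := ![1, tau]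

/-- `∂f/∂z = (f_x + τ f_y) / 2`. -/
def dz (f : Paracomplex → Paracomplex) (z : Paracomplex) : Paracomplex :=
  (1 / 2 : ℝ) • (lineDeriv ℝ f z 1 + tau * lineDeriv ℝ f z tau)

/-- `∂f/∂z̄ = (f_x - τ f_y) / 2`. -/
def dzbar (f : Paracomplex → Paracomplex) (z : Paracomplex) : Paracomplex :=
  (1 / 2 : ℝ) • (lineDeriv ℝ f z 1 - tau * lineDeriv ℝ f z tau)

/-- `f` is a (smooth) paraholomorphic function near `z`: the para-Cauchy-Riemann equations
`∂f/∂z̄ = 0` hold on a neighbourhood of `z`; the derivative of `f` is then `f' = ∂f/∂z`. -/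
def HolomorphicAt (f : Paracomplex → Paracomplex) (z : Paracomplex) : Prop :=
  ∀ᶠ w in 𝓝 z, ContDiffAt ℝ ∞ f w ∧ dzbar f w = 0

/-- `g` has a simple pole at `z₀`: near `z₀` it is `h(z) / (z - z₀)`, wherever `z - z₀` is
invertible, for a paraholomorphic function `h` with `h(z₀) ≠ 0`. -/
def HasSimplePoleAt (g : Paracomplex → Paracomplex) (z₀ : Paracomplex) : Prop :=
  ∃ h : Paracomplex → Paracomplex, HolomorphicAt h z₀ ∧ h z₀ ≠ 0 ∧
    ∀ᶠ z in 𝓝 z₀, IsUnit (z - z₀) → g z * (z - z₀) = h z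

/-- `g` is parameromorphic on `Ω`, its only singularities are simple poles, and `g ḡ ≠ -1` and
`g' ḡ' > 0` at its regular points. The values of `g` at the poles are irrelevant. -/
def IsDatum (Ω : Set Paracomplex) (g : Paracomplex → Paracomplex) : Prop :=
  (∀ z ∈ Ω, HolomorphicAt g z ∨ HasSimplePoleAt g z) ∧
  ∀ z ∈ Ω, HolomorphicAt g z →
    QuadraticAlgebra.norm (g z) ≠ -1 ∧ 0 < QuadraticAlgebra.norm (dz g z)

/-- `e^lam = |1 + g ḡ| / (2 √(g' ḡ'))` at all regular points of `g` in `Ω`. -/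
def Represents (Ω : Set Paracomplex) (g : Paracomplex → Paracomplex)
    (lam : Paracomplex → ℝ) : Prop :=
  ∀ z ∈ Ω, HolomorphicAt g z →
    Real.exp (lam z) =
      |1 + QuadraticAlgebra.norm (g z)| / (2 * √(QuadraticAlgebra.norm (dz g z)))

/-- `g₂ = (a g - b) / (b̄ g + ā)` as parameromorphic functions on `Ω`. -/
def IsTransform (Ω : Set Paracomplex) (a b : Paracomplex) (g g₂ : Paracomplex → Paracomplex) :
    Prop :=
  ∀ z ∈ Ω, HolomorphicAt g z → HolomorphicAt g₂ z →
    IsUnit (star b * g z + star a) ∧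
      g₂ z = (a * g z - b) * Ring.inverse (star b * g z + star a)

end Paracomplex

end

noncomputable section

/-! ### Gluing local functions on a simply connected space -/

/-! Put `ψ = e^lam`, choose `s` with `s² = -ε`, and let `D = (∂_x + s ∂_y) / 2`, `D' = (∂_x - s ∂_y)
/ 2`. The Liouville equation becomes the bilinear equation `ψ DD'ψ - Dψ D'ψ = -ε / 4`. For `ε = 1`
one takes `s = -i`, so that `D = ∂_z`. For `ε = -1` one takes `s = 1` and all functions are real: `x
+ y` and `x - y` identify the paracomplex numbers with the ring `ℝ × ℝ`, and `D`, `D'` differentiate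
along the two null directions. This is why the algebra is done once, over an `RCLike` field.

Applying `D` to the bilinear equation shows that `q = DDψ / ψ` is annihilated by `D'`
(`holoOn_potential`). So `ψ` solves the linear equation `DDy = q y`, and a pair of solutions `y₁,
y₂` with `D'yᵢ = 0` and Wronskian `1` separates it: `ψ = y₁ w₁ + y₂ w₂` with `D wᵢ = 0`
(`exists_separated`). Conversely, for any separated `ψ` the left side of the bilinear equation is
the product of the Wronskians of the two pairs (`separated_bilinear`). Solutions therefore
correspond to such pairs ("spinors") with prescribed Wronskians.

The function `g` is `y₂ / y₁` in the complex case, where the `wᵢ` can be normalized to `ȳ₁ / 2` and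
`-ȳ₂ / 2`; in the paracomplex case it has null coordinates `y₂ / y₁` and `w₂ / w₁`. The derivative
of `y₂ / y₁` is the Wronskian over `y₁²`, so formula (1) turns into `e^lam = |‖y₁‖² - ‖y₂‖²| / 2`,
respectively `|y₁ w₁ + y₂ w₂| / 2`. The right side is smooth and positive also at the poles, which
are zeros of `y₁` or `w₁`. In the other direction an admissible `g` is lifted by `y₁ = 1 / √g'`, `y₂
= g y₁`, up to constants and with `1 / g` in place of `g` at poles.

Simple connectedness is used twice, through `exists_glue_of_simplyConnected`: to continue local
solutions of the linear equation (`exists_isFundamental`), and to choose the sign of the square root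
(`exists_glue_of_sq_eq`).

For uniqueness, `separated_ode` recovers `q` from `ψ` alone, so two lifts of the same `lam` are
bases of the same solution space and differ by a constant matrix (`exists_matrix_of_separated_eq`).
Its action on the `wᵢ` forces the form `T_ab`, and its determinant and signs decide between `1` and
`-1`.

The paracomplex poles need extra care: a pole may concern one null coordinate only, with a residue
that is a zero divisor, and zeros of `y₁ w₁ + y₂ w₂` on the polar lines must be excluded although
admissibility speaks of regular points only (`exists_zero_of_separated`). -/

/-- A family of local functions which differ on overlaps by locally constant elements of a group
acting freely on their values can be glued on a simply connected space. -/
theorem exists_glue_of_simplyConnected {X H A : Type*} [TopologicalSpace X]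
    [SimplyConnectedSpace X] [LocallyPathConnectedSpace X] [Group H] [MulAction H A]
    (U : X → Set X) (hU : ∀ i, IsOpen (U i)) (hmem : ∀ i, i ∈ U i) (Φ : X → X → A)
    (free : ∀ i, ∀ x ∈ U i, ∀ h : H, h • Φ i x = Φ i x → h = 1)
    (compat : ∀ i j, ∀ x ∈ U i ∩ U j, ∃ h : H, ∀ᶠ y in 𝓝 x, Φ i y = h • Φ j y) :
    ∃ Ψ : X → A, ∀ i, ∀ x ∈ U i, ∃ h : H, ∀ᶠ y in 𝓝 x, Ψ y = h • Φ i y := by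
  classical
  have uniq : ∀ i, ∀ x ∈ U i, ∀ h k : H, h • Φ i x = k • Φ i x → h = k := by
    intro i x hx h k hk
    have := free i x hx (k⁻¹ * h) (by rw [mul_smul, hk, inv_smul_smul])
    rw [inv_mul_eq_one] at this
    exact this.symm
  have pt : ∀ i j x, ∃ h : H, x ∈ U i ∩ U j → Φ i x = h • Φ j x := by
    intro i j x
    by_cases hx : x ∈ U i ∩ U j
    · obtain ⟨h, hh⟩ := compat i j x hx
      exact ⟨h, fun _ => hh.self_of_nhds⟩
    · exact ⟨1, fun h => absurd h hx⟩
  choose c hc using pt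
  have cloc : ∀ i j, ∀ x ∈ U i ∩ U j, ∀ᶠ y in 𝓝 x, c i j y = c i j x := by
    intro i j x hx
    obtain ⟨h, hh⟩ := compat i j x hx
    have hx' : c i j x = h := uniq j x hx.2 _ _ ((hc i j x hx).symm.trans hh.self_of_nhds)
    filter_upwards [hh, ((hU i).inter (hU j)).mem_nhds hx] with y hy hyU
    rw [hx']
    exact uniq j y hyU.2 _ _ ((hc i j y hyU).symm.trans hy)
  -- The transition functions are locally constant, so with the discrete topology on `H` they define
  -- a fibre bundle with discrete fibre, that is, a covering of `X`.
  let _ : TopologicalSpace H := ⊥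
  have : DiscreteTopology H := ⟨rfl⟩
  let Z : FiberBundleCore X X H :=
    { baseSet := U
      isOpen_baseSet := hU
      indexAt := id
      mem_baseSet_at := hmem
      coordChange := fun i j x v => v * c i j x
      coordChange_self := by
        intro i x hx v
        have : c i i x = 1 := free i x hx _ (hc i i x ⟨hx, hx⟩).symm
        rw [this, mul_one]
      continuousOn_coordChange := by
        intro i j p hp
        refine ContinuousAt.continuousWithinAt ?_
        have h1 : ∀ᶠ q in 𝓝 p, q.2 * c i j p.1 = q.2 * c i j q.1 := by
          filter_upwards [continuous_fst.continuousAt.eventually (cloc i j p.1 hp.1)] with q hq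
          rw [hq]
        refine ContinuousAt.congr ?_ h1
        exact ((continuous_of_discreteTopology (f := fun v : H => v * c i j p.1)).comp
          continuous_snd).continuousAt
      coordChange_comp := by
        intro i j k x hx v
        rw [mul_assoc]
        congr 1
        refine uniq k x hx.2 _ _ ?_
        rw [mul_smul, ← hc j k x ⟨hx.1.2, hx.2⟩, ← hc i j x hx.1, ← hc i k x ⟨hx.1.1, hx.2⟩] }
  have cov : IsCoveringMap Z.proj := FiberBundle.isCoveringMap (F := H) (E := Z.Fiber)
  obtain ⟨a₀⟩ : Nonempty X := inferInstance
  -- Lifting the identity of the simply connected `X` gives a global section. Its coordinate `s i`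
  -- over `U i` is the constant by which `Φ i` has to be corrected.
  obtain ⟨F, ⟨-, hF⟩, -⟩ := cov.existsUnique_continuousMap_lifts (ContinuousMap.id X) a₀
    (⟨a₀, (1 : H)⟩ : Z.TotalSpace) rfl
  have hproj : ∀ x, (F x).proj = x := fun x => congrFun hF x
  let s : X → X → H := fun i x => (Z.localTriv i (F x)).2
  have hs : ∀ i j, ∀ x ∈ U i ∩ U j, s j x = s i x * c i j x := by
    intro i j x hx
    have h1 : ∀ k, s k x = (show H from (F x).snd) * c ((F x).proj) k ((F x).proj) := by
      intro k
      change (Z.localTriv k (F x)).2 = _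
      rw [FiberBundleCore.localTriv_apply]
      rfl
    rw [h1 i, h1 j, hproj x, mul_assoc]
    congr 1
    refine uniq j x hx.2 _ _ ?_
    rw [mul_smul, ← hc i j x hx, ← hc x i x ⟨hmem x, hx.1⟩, ← hc x j x ⟨hmem x, hx.2⟩]
  have hsloc : ∀ i, ∀ x ∈ U i, ∀ᶠ y in 𝓝 x, s i y = s i x := by
    intro i x hx
    have h1 : ContinuousAt (s i) x := by
      have h2 : ContinuousAt (Z.localTriv i) (F x) := by
        apply (Z.localTriv i).continuousAt
        rw [(Z.localTriv i).mem_source]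
        change (F x).proj ∈ U i
        rw [hproj x]
        exact hx
      exact continuous_snd.continuousAt.comp (h2.comp F.continuous.continuousAt)
    have h3 : {s i x} ∈ 𝓝 (s i x) := (isOpen_discrete _).mem_nhds rfl
    exact h1 h3
  -- From `s j = s i * c i j` and `Φ i = c i j • Φ j`, the value `s i x • Φ i x` does not depend on
  -- `i`; the chart indexed by `x` itself is a canonical choice.
  refine ⟨fun x => s x x • Φ x x, fun i x hx => ⟨s i x, ?_⟩⟩
  filter_upwards [hsloc i x hx, (hU i).mem_nhds hx] with y hy hyU
  rw [← hy, hs i y y ⟨hyU, hmem y⟩]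
  conv_rhs => rw [hc i y y ⟨hyU, hmem y⟩]
  rw [mul_smul]

/-- Gluing on a simply connected open subset of a normed space. -/
theorem IsSimplyConnected.exists_glue {E H A : Type*} [NormedAddCommGroup E] [NormedSpace ℝ E]
    [Group H] [MulAction H A] {Ω : Set E} (hΩ : IsOpen Ω) (hsc : IsSimplyConnected Ω)
    (U : E → Set E) (hU : ∀ i ∈ Ω, IsOpen (U i)) (hmem : ∀ i ∈ Ω, i ∈ U i) (Φ : E → E → A)
    (free : ∀ i ∈ Ω, ∀ x ∈ U i, ∀ h : H, h • Φ i x = Φ i x → h = 1)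
    (compat : ∀ i ∈ Ω, ∀ j ∈ Ω, ∀ x ∈ Ω, x ∈ U i → x ∈ U j →
      ∃ h : H, ∀ᶠ y in 𝓝 x, Φ i y = h • Φ j y) :
    ∃ Ψ : E → A, ∀ i ∈ Ω, ∃ h : H, ∀ᶠ y in 𝓝 i, Ψ y = h • Φ i y := by
  classical
  have := hsc.simplyConnectedSpace
  have := hΩ.locallyPathConnectedSpace
  obtain ⟨Ψ, hΨ⟩ := exists_glue_of_simplyConnected (X := Ω) (H := H) (A := A)
    (fun i => (Subtype.val : Ω → E) ⁻¹' U i) (fun i => (hU i i.2).preimage continuous_subtype_val)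
    (fun i => hmem i i.2) (fun i x => Φ i x) (fun i x hx => free i i.2 x hx) (by
      intro i j x hx
      obtain ⟨h, hh⟩ := compat i i.2 j j.2 x x.2 hx.1 hx.2
      exact ⟨h, continuous_subtype_val.continuousAt.eventually hh⟩)
  obtain ⟨a₀⟩ : Nonempty Ω := inferInstance
  -- The value outside `Ω` is irrelevant; `Φ a₀ a₀` only supplies some element of `A`.
  refine ⟨fun x => if hx : x ∈ Ω then Ψ ⟨x, hx⟩ else Φ a₀ a₀, fun i hi => ?_⟩
  obtain ⟨h, hh⟩ := hΨ ⟨i, hi⟩ ⟨i, hi⟩ (hmem i hi)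
  refine ⟨h, ?_⟩
  rw [nhds_subtype_eq_comap, eventually_comap] at hh
  filter_upwards [hh, hΩ.mem_nhds hi] with y hy hyΩ
  rw [dif_pos hyΩ]
  exact hy ⟨y, hyΩ⟩ rfl

/-! ### Wirtinger operators -/

section Wirtinger

variable {E 𝕜 : Type*} [NormedAddCommGroup E] [NormedSpace ℝ E] [RCLike 𝕜]
  {e : Fin 2 → E} {s t : 𝕜} {Ω : Set E} {f g : E → 𝕜} {z : E}

/-- The operator `(∂_x + s ∂_y) / 2` in the frame `e`. -/
def wirt (e : Fin 2 → E) (s : 𝕜) (f : E → 𝕜) (z : E) : 𝕜 :=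
  2⁻¹ * (fderiv ℝ f z (e 0) + s * fderiv ℝ f z (e 1))

theorem contDiffOn_wirt (hΩ : IsOpen Ω) (hf : ContDiffOn ℝ ∞ f Ω) :
    ContDiffOn ℝ ∞ (wirt e s f) Ω := by
  have h := hf.fderiv_of_isOpen hΩ (m := ∞) (by simp)
  have h' : ∀ i, ContDiffOn ℝ ∞ (fun z => fderiv ℝ f z (e i)) Ω :=
    fun i => h.clm_apply contDiffOn_const
  unfold wirt
  exact contDiffOn_const.mul ((h' 0).add (contDiffOn_const.mul (h' 1)))

theorem ContDiffOn.differentiableAt_of_isOpen (hΩ : IsOpen Ω) (hf : ContDiffOn ℝ ∞ f Ω)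
    (hz : z ∈ Ω) : DifferentiableAt ℝ f z :=
  (hf.contDiffAt (hΩ.mem_nhds hz)).differentiableAt (by simp)

theorem wirt_congr (h : f =ᶠ[𝓝 z] g) : wirt e s f z = wirt e s g z := by
  unfold wirt
  rw [h.fderiv_eq]

theorem wirt_eqOn (hΩ : IsOpen Ω) (h : Set.EqOn f g Ω) : Set.EqOn (wirt e s f) (wirt e s g) Ω :=
  fun _ hz => wirt_congr (Filter.eventuallyEq_of_mem (hΩ.mem_nhds hz) h)

@[simp] theorem wirt_const (c : 𝕜) : wirt e s (fun _ => c) z = 0 := by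
  simp [wirt]

theorem wirt_add (hf : DifferentiableAt ℝ f z) (hg : DifferentiableAt ℝ g z) :
    wirt e s (fun w => f w + g w) z = wirt e s f z + wirt e s g z := by
  simp only [wirt, fderiv_fun_add hf hg, _root_.add_apply]
  ring

theorem wirt_sub (hf : DifferentiableAt ℝ f z) (hg : DifferentiableAt ℝ g z) :
    wirt e s (fun w => f w - g w) z = wirt e s f z - wirt e s g z := by
  simp only [wirt, fderiv_fun_sub hf hg, _root_.sub_apply]
  ring

theorem wirt_neg : wirt e s (fun w => -f w) z = -wirt e s f z := by
  simp only [wirt, fderiv_fun_neg, _root_.neg_apply]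
  ring

theorem wirt_mul (hf : DifferentiableAt ℝ f z) (hg : DifferentiableAt ℝ g z) :
    wirt e s (fun w => f w * g w) z = f z * wirt e s g z + wirt e s f z * g z := by
  simp only [wirt, fderiv_fun_mul hf hg, _root_.add_apply,
    _root_.smul_apply, smul_eq_mul]
  ring

theorem wirt_const_mul (c : 𝕜) (hf : DifferentiableAt ℝ f z) :
    wirt e s (fun w => c * f w) z = c * wirt e s f z := by
  rw [wirt_mul (differentiableAt_const c) hf, wirt_const, zero_mul, add_zero]

/-- The chain rule for the composition with a function of one real or complex variable. -/
theorem wirt_comp {φ : 𝕜 → 𝕜} {φ' : 𝕜} (hφ : HasDerivAt φ φ' (f z))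
    (hf : DifferentiableAt ℝ f z) :
    wirt e s (fun w => φ (f w)) z = φ' * wirt e s f z := by
  have h1 : HasFDerivAt φ ((ContinuousLinearMap.toSpanSingleton 𝕜 φ').restrictScalars ℝ) (f z) :=
    hφ.hasFDerivAt.restrictScalars ℝ
  have h2 := (h1.comp z hf.hasFDerivAt).fderiv
  change fderiv ℝ (fun w => φ (f w)) z = _ at h2
  simp only [wirt, h2, ContinuousLinearMap.comp_apply, ContinuousLinearMap.coe_restrictScalars',
    ContinuousLinearMap.toSpanSingleton_apply, smul_eq_mul]
  ring

theorem wirt_inv (hf : DifferentiableAt ℝ f z) (h0 : f z ≠ 0) :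
    wirt e s (fun w => (f w)⁻¹) z = -wirt e s f z / f z ^ 2 := by
  rw [wirt_comp (hasDerivAt_inv h0) hf]
  ring

theorem wirt_div (hf : DifferentiableAt ℝ f z) (hg : DifferentiableAt ℝ g z) (h0 : g z ≠ 0) :
    wirt e s (fun w => f w / g w) z =
      (wirt e s f z * g z - f z * wirt e s g z) / g z ^ 2 := by
  simp only [div_eq_mul_inv]
  rw [wirt_mul hf (hg.fun_inv h0), wirt_inv hg h0]
  field_simp
  ring

theorem two_le_infty : (2 : ℕ∞ω) ≤ ∞ :=
  WithTop.coe_le_coe.2 (le_top : (2 : ℕ∞) ≤ ⊤)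

/-- Both operators have constant coefficients, so this is the symmetry of the second derivative. -/
theorem wirt_comm (hf : ContDiffAt ℝ ∞ f z) :
    wirt e s (wirt e t f) z = wirt e t (wirt e s f) z := by
  have hsymm : IsSymmSndFDerivAt ℝ f z := hf.isSymmSndFDerivAt
    (by rw [minSmoothness_of_isRCLikeNormedField]; exact two_le_infty)
  have hd : DifferentiableAt ℝ (fderiv ℝ f) z :=
    (hf.fderiv_right (m := 1) (by exact one_add_one_eq_two (R := ℕ∞ω) ▸ two_le_infty)).differentiableAt (by simp)
  have key : ∀ (r : 𝕜) (v : E), fderiv ℝ (wirt e r f) z v =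
      2⁻¹ * (fderiv ℝ (fderiv ℝ f) z v (e 0) + r * fderiv ℝ (fderiv ℝ f) z v (e 1)) := by
    intro r v
    have h1 : ∀ i, HasFDerivAt (fun w => fderiv ℝ f w (e i))
        ((fderiv ℝ (fderiv ℝ f) z).flip (e i)) z := by
      intro i
      exact ((ContinuousLinearMap.apply ℝ 𝕜 (e i)).hasFDerivAt.comp z hd.hasFDerivAt)
    have h2 := (((h1 0).add ((h1 1).const_mul r)).const_mul (2⁻¹ : 𝕜)).fderiv
    change fderiv ℝ (wirt e r f) z = _ at h2
    rw [h2]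
    simp [mul_add]
  unfold wirt at key ⊢
  rw [key, key, key, key, hsymm (e 1) (e 0)]
  ring

/-- A function annihilated by both operators is constant. -/
theorem exists_const_of_wirt_eq_zero (he : Submodule.span ℝ (Set.range e) = ⊤) (hs : s ≠ 0)
    (hΩ : IsOpen Ω) (hc : IsPreconnected Ω) (hf : ContDiffOn ℝ ∞ f Ω)
    (h1 : ∀ z ∈ Ω, wirt e s f z = 0) (h2 : ∀ z ∈ Ω, wirt e (-s) f z = 0) :
    ∃ c, ∀ z ∈ Ω, f z = c := by
  refine hΩ.exists_is_const_of_fderiv_eq_zero (𝕜 := ℝ) hc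
    (fun z hz => (hf.differentiableAt_of_isOpen hΩ hz).differentiableWithinAt) (fun z hz => ?_)
  have h3 := h1 z hz
  have h4 := h2 z hz
  unfold wirt at h3 h4
  have h20 : (2 : 𝕜) ≠ 0 := two_ne_zero
  have h3' : fderiv ℝ f z (e 0) + s * fderiv ℝ f z (e 1) = 0 := by simpa using h3
  have h4' : fderiv ℝ f z (e 0) + -s * fderiv ℝ f z (e 1) = 0 := by simpa using h4
  have h5 : fderiv ℝ f z (e 1) = 0 := by
    have h6 : 2 * (s * fderiv ℝ f z (e 1)) = 0 := by linear_combination h3' - h4'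
    simpa [h20, hs] using h6
  have h6 : fderiv ℝ f z (e 0) = 0 := by simpa [h5] using h3'
  have h7 : (fderiv ℝ f z : E →ₗ[ℝ] 𝕜) = 0 := by
    refine LinearMap.ext_on he ?_
    rintro _ ⟨i, rfl⟩
    fin_cases i
    · simpa using h6
    · simpa using h5
  ext v
  simpa using LinearMap.congr_fun h7 v

/-! ### Functions annihilated by one of the operators -/

/-- `f` is smooth on `Ω` and depends there on one characteristic variable only:
`(∂_x - s ∂_y) f = 0`. -/
structure HoloOn (e : Fin 2 → E) (s : 𝕜) (Ω : Set E) (f : E → 𝕜) : Prop where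
  smooth : ContDiffOn ℝ ∞ f Ω
  wirt_neg : ∀ z ∈ Ω, wirt e (-s) f z = 0

theorem HoloOn.mono {Ω' : Set E} (hf : HoloOn e s Ω f) (h : Ω' ⊆ Ω) : HoloOn e s Ω' f :=
  ⟨hf.smooth.mono h, fun z hz => hf.wirt_neg z (h hz)⟩

theorem HoloOn.differentiableAt (hΩ : IsOpen Ω) (hf : HoloOn e s Ω f) (hz : z ∈ Ω) :
    DifferentiableAt ℝ f z :=
  hf.smooth.differentiableAt_of_isOpen hΩ hz

theorem HoloOn.congr (hΩ : IsOpen Ω) (hf : HoloOn e s Ω f) (h : Set.EqOn g f Ω) :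
    HoloOn e s Ω g :=
  ⟨hf.smooth.congr h, fun z hz => by rw [wirt_eqOn hΩ h hz, hf.wirt_neg z hz]⟩

theorem holoOn_const (c : 𝕜) : HoloOn e s Ω fun _ => c :=
  ⟨contDiffOn_const, fun _ _ => wirt_const c⟩

theorem HoloOn.mul (hΩ : IsOpen Ω) (hf : HoloOn e s Ω f) (hg : HoloOn e s Ω g) :
    HoloOn e s Ω fun z => f z * g z :=
  ⟨hf.smooth.mul hg.smooth, fun z hz => by
    rw [wirt_mul (hf.differentiableAt hΩ hz) (hg.differentiableAt hΩ hz), hf.wirt_neg z hz,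
      hg.wirt_neg z hz]; simp⟩

theorem HoloOn.const_mul (hΩ : IsOpen Ω) (c : 𝕜) (hf : HoloOn e s Ω f) :
    HoloOn e s Ω fun z => c * f z :=
  (holoOn_const c).mul hΩ hf

theorem HoloOn.add (hΩ : IsOpen Ω) (hf : HoloOn e s Ω f) (hg : HoloOn e s Ω g) :
    HoloOn e s Ω fun z => f z + g z :=
  ⟨hf.smooth.add hg.smooth, fun z hz => by
    rw [wirt_add (hf.differentiableAt hΩ hz) (hg.differentiableAt hΩ hz), hf.wirt_neg z hz,
      hg.wirt_neg z hz]; simp⟩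

theorem HoloOn.inv (hΩ : IsOpen Ω) (hf : HoloOn e s Ω f) (h0 : ∀ z ∈ Ω, f z ≠ 0) :
    HoloOn e s Ω fun z => (f z)⁻¹ :=
  ⟨hf.smooth.inv h0, fun z hz => by
    rw [wirt_inv (hf.differentiableAt hΩ hz) (h0 z hz), hf.wirt_neg z hz]; simp⟩

theorem HoloOn.div (hΩ : IsOpen Ω) (hf : HoloOn e s Ω f) (hg : HoloOn e s Ω g)
    (h0 : ∀ z ∈ Ω, g z ≠ 0) : HoloOn e s Ω fun z => f z / g z := by
  simpa only [div_eq_mul_inv] using hf.mul hΩ (hg.inv hΩ h0)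

theorem HoloOn.wirt (hΩ : IsOpen Ω) (hf : HoloOn e s Ω f) : HoloOn e s Ω (wirt e s f) :=
  ⟨contDiffOn_wirt hΩ hf.smooth, fun z hz => by
    rw [wirt_comm (hf.smooth.contDiffAt (hΩ.mem_nhds hz)),
      wirt_eqOn (g := fun _ => 0) hΩ hf.wirt_neg hz, wirt_const]⟩

/-- The Wronskian of two functions. -/
def wronsk (e : Fin 2 → E) (s : 𝕜) (f g : E → 𝕜) (z : E) : 𝕜 :=
  f z * wirt e s g z - g z * wirt e s f z

theorem HoloOn.wronsk (hΩ : IsOpen Ω) (hf : HoloOn e s Ω f) (hg : HoloOn e s Ω g) :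
    HoloOn e s Ω (wronsk e s f g) := by
  have h := (hf.mul hΩ (hg.wirt hΩ)).add hΩ ((hg.mul hΩ (hf.wirt hΩ)).const_mul hΩ (-1))
  refine h.congr hΩ fun z _ => ?_
  simp only [_root_.wronsk]
  ring

/-- The terms are kept apart because two cases are needed: for `t = s` the products of first
derivatives cancel, and for `t = -s` most terms vanish on functions of one characteristic variable.
-/
theorem wirt_wronsk (hΩ : IsOpen Ω) (hf : ContDiffOn ℝ ∞ f Ω) (hg : ContDiffOn ℝ ∞ g Ω)
    (hz : z ∈ Ω) :
    wirt e t (wronsk e s f g) z = wirt e t f z * wirt e s g z + f z * wirt e t (wirt e s g) z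
      - wirt e t g z * wirt e s f z - g z * wirt e t (wirt e s f) z := by
  have hf0 := hf.differentiableAt_of_isOpen hΩ hz
  have hg0 := hg.differentiableAt_of_isOpen hΩ hz
  have hf1 := (contDiffOn_wirt (e := e) (s := s) hΩ hf).differentiableAt_of_isOpen hΩ hz
  have hg1 := (contDiffOn_wirt (e := e) (s := s) hΩ hg).differentiableAt_of_isOpen hΩ hz
  unfold wronsk
  rw [wirt_sub (hf0.fun_mul hg1) (hg0.fun_mul hf1), wirt_mul hf0 hg1, wirt_mul hg0 hf1]
  ring

/-- Two solutions of `y'' = q y` have a constant Wronskian. -/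
theorem exists_const_wronsk (he : Submodule.span ℝ (Set.range e) = ⊤) (hs : s ≠ 0)
    (hΩ : IsOpen Ω) (hc : IsPreconnected Ω) (hf : HoloOn e s Ω f) (hg : HoloOn e s Ω g)
    {q : E → 𝕜} (hqf : ∀ z ∈ Ω, wirt e s (wirt e s f) z = q z * f z)
    (hqg : ∀ z ∈ Ω, wirt e s (wirt e s g) z = q z * g z) :
    ∃ c, ∀ z ∈ Ω, wronsk e s f g z = c := by
  have hw := hf.wronsk hΩ hg
  refine exists_const_of_wirt_eq_zero he hs hΩ hc hw.smooth (fun z hz => ?_) hw.wirt_neg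
  rw [wirt_wronsk hΩ hf.smooth hg.smooth hz, hqf z hz, hqg z hz]
  ring

/-- A solution of `y'' = q y` is a combination with constant coefficients of two independent
ones. -/
theorem exists_combination (he : Submodule.span ℝ (Set.range e) = ⊤) (hs : s ≠ 0)
    (hΩ : IsOpen Ω) (hc : IsPreconnected Ω) {y₁ y₂ q : E → 𝕜} (h1 : HoloOn e s Ω y₁)
    (h2 : HoloOn e s Ω y₂) (hf : HoloOn e s Ω f) {c : 𝕜} (hc0 : c ≠ 0)
    (hw : ∀ z ∈ Ω, wronsk e s y₁ y₂ z = c)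
    (hq1 : ∀ z ∈ Ω, wirt e s (wirt e s y₁) z = q z * y₁ z)
    (hq2 : ∀ z ∈ Ω, wirt e s (wirt e s y₂) z = q z * y₂ z)
    (hqf : ∀ z ∈ Ω, wirt e s (wirt e s f) z = q z * f z) :
    ∃ α β : 𝕜, ∀ z ∈ Ω, f z = α * y₁ z + β * y₂ z := by
  obtain ⟨a, ha⟩ := exists_const_wronsk he hs hΩ hc hf h2 hqf hq2
  obtain ⟨b, hb⟩ := exists_const_wronsk he hs hΩ hc hf h1 hqf hq1
  -- Cramer's rule: if `f = α y₁ + β y₂`, then `W(f, y₂) = α c` and `W(f, y₁) = -β c`.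
  refine ⟨a / c, -b / c, fun z hz => ?_⟩
  have ha' := ha z hz
  have hb' := hb z hz
  have hw' := hw z hz
  unfold wronsk at ha' hb' hw'
  field_simp
  rw [← ha', ← hb', ← hw']
  ring

end Wirtinger

section Liouville

variable {E 𝕜 : Type*} [NormedAddCommGroup E] [NormedSpace ℝ E] [RCLike 𝕜]
  {e : Fin 2 → E} {s t : 𝕜} {Ω : Set E} {z : E}

/-! ### The Liouville equation in terms of `ψ = e^lam` -/

/-- In dimension two the weight `√|det G| = e^{2 lam}` cancels the factor `e^{-2 lam}` of the
inverse matrix, so only the outer factor survives. The matrix `diag(1, ε)` is its own inverse since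
`ε² = 1`. -/
theorem laplaceBeltrami_conformalMetric {ε : ℝ} (hε : ε ^ 2 = 1) (lam : E → ℝ) (z : E) :
    laplaceBeltrami e (conformalMetric ε lam) lam z = Real.exp (-(2 * lam z)) *
      (lineDeriv ℝ (fun w => lineDeriv ℝ lam w (e 0)) z (e 0) +
        ε * lineDeriv ℝ (fun w => lineDeriv ℝ lam w (e 1)) z (e 1)) := by
  have hdet : ∀ w, √|(conformalMetric ε lam w).det| = Real.exp (2 * lam w) := by
    intro w
    have h1 : (conformalMetric ε lam w).det = Real.exp (2 * lam w) ^ 2 * ε := by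
      simp [conformalMetric, Matrix.det_fin_two]
      ring
    have h2 : |ε| = 1 := by
      rw [← sq_abs] at hε
      exact (pow_eq_one_iff_of_nonneg (abs_nonneg ε) two_ne_zero).1 hε
    rw [h1, abs_mul, h2, mul_one, abs_of_nonneg (sq_nonneg _), Real.sqrt_sq (Real.exp_pos _).le]
  have hinv : ∀ w, (conformalMetric ε lam w)⁻¹ =
      Real.exp (-(2 * lam w)) • !![1, 0; 0, ε] := by
    intro w
    apply Matrix.inv_eq_right_inv
    have h3 : Real.exp (2 * lam w) * Real.exp (-(2 * lam w)) = 1 := by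
      rw [← Real.exp_add]; simp
    ext i j
    fin_cases i <;> fin_cases j <;> simp [conformalMetric, Matrix.mul_apply, h3]
    linear_combination h3 * ε ^ 2 + hε
  have hfun : ∀ i, (fun w => √|(conformalMetric ε lam w).det| *
      ∑ j, (conformalMetric ε lam w)⁻¹ i j * lineDeriv ℝ lam w (e j)) =
      fun w => (!![1, 0; 0, ε] i i) * lineDeriv ℝ lam w (e i) := by
    intro i
    ext w
    have h3 : Real.exp (2 * lam w) * Real.exp (-(2 * lam w)) = 1 := by
      rw [← Real.exp_add]; simp
    rw [hdet, hinv]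
    fin_cases i
    · simp only [Fin.sum_univ_two]
      simp
      rw [← mul_assoc, h3, one_mul]
    · simp only [Fin.sum_univ_two]
      simp
      rw [← mul_assoc, ← mul_assoc, h3, one_mul]
  have hcm : ∀ (c : ℝ) (f : E → ℝ) (v : E),
      lineDeriv ℝ (fun w => c * f w) z v = c * lineDeriv ℝ f z v := by
    intro c f v
    simp only [lineDeriv]
    exact deriv_const_mul_field c
  unfold laplaceBeltrami
  rw [Fin.sum_univ_two]
  simp only [hfun]
  simp only [hdet, hcm]
  rw [Real.exp_neg]
  simp

theorem wirt_ofReal {A : E → ℝ} (hA : DifferentiableAt ℝ A z) :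
    wirt e s (fun w => (A w : 𝕜)) z =
      2⁻¹ * ((fderiv ℝ A z (e 0) : 𝕜) + s * (fderiv ℝ A z (e 1) : 𝕜)) := by
  have h1 : HasFDerivAt (fun w => (A w : 𝕜)) ((RCLike.ofRealCLM (K := 𝕜)).comp (fderiv ℝ A z)) z :=
    (RCLike.ofRealCLM (K := 𝕜)).hasFDerivAt.comp z hA.hasFDerivAt
  simp [wirt, h1.fderiv]

theorem contDiffOn_ofReal {A : E → ℝ} (hA : ContDiffOn ℝ ∞ A Ω) :
    ContDiffOn ℝ ∞ (fun w => (A w : 𝕜)) Ω :=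
  (RCLike.ofRealCLM (K := 𝕜)).contDiff.comp_contDiffOn hA

/-- The Liouville equation for `lam` is a bilinear equation for `ψ = e^lam`. -/
theorem laplaceBeltrami_eq_iff {ε : ℝ} (hε : ε ^ 2 = 1) (hs : s ^ 2 = -(ε : 𝕜)) (hΩ : IsOpen Ω)
    {lam : E → ℝ} (hlam : ContDiffOn ℝ ∞ lam Ω) (hz : z ∈ Ω) {ψ : E → 𝕜}
    (hψ : ∀ w ∈ Ω, ψ w = (Real.exp (lam w) : ℝ)) :
    laplaceBeltrami e (conformalMetric ε lam) lam z = -ε * Real.exp (-4 * lam z) ↔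
      ψ z * wirt e s (wirt e (-s) ψ) z - wirt e s ψ z * wirt e (-s) ψ z = -(ε : 𝕜) / 4 := by
  have hd : ∀ w ∈ Ω, DifferentiableAt ℝ lam w := fun w hw =>
    (hlam.contDiffAt (hΩ.mem_nhds hw)).differentiableAt (by simp)
  have hA : ∀ v, ContDiffOn ℝ ∞ (fun w => fderiv ℝ lam w v) Ω := fun v =>
    (hlam.fderiv_of_isOpen hΩ (m := ∞) (by simp)).clm_apply contDiffOn_const
  have hAd : ∀ v, DifferentiableAt ℝ (fun w => fderiv ℝ lam w v) z := fun v =>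
    ((hA v).contDiffAt (hΩ.mem_nhds hz)).differentiableAt (by simp)
  have hsymm : IsSymmSndFDerivAt ℝ lam z := (hlam.contDiffAt (hΩ.mem_nhds hz)).isSymmSndFDerivAt
    (by rw [minSmoothness_of_isRCLikeNormedField]; exact two_le_infty)
  have hd2 : DifferentiableAt ℝ (fderiv ℝ lam) z :=
    ((hlam.fderiv_of_isOpen hΩ (m := ∞) (by simp)).contDiffAt (hΩ.mem_nhds hz)).differentiableAt
      (by simp)
  have hsnd : ∀ v w, fderiv ℝ (fun x => fderiv ℝ lam x v) z w =
      fderiv ℝ (fderiv ℝ lam) z w v := by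
    intro v w
    have h1 : HasFDerivAt (fun x => fderiv ℝ lam x v) ((fderiv ℝ (fderiv ℝ lam) z).flip v) z :=
      ((ContinuousLinearMap.apply ℝ ℝ v).hasFDerivAt.comp z hd2.hasFDerivAt)
    rw [h1.fderiv]
    rfl
  have hline : ∀ v, lineDeriv ℝ (fun w => lineDeriv ℝ lam w v) z v =
      fderiv ℝ (fderiv ℝ lam) z v v := by
    intro v
    have h1 : (fun w => lineDeriv ℝ lam w v) =ᶠ[𝓝 z] fun w => fderiv ℝ lam w v := by
      filter_upwards [hΩ.mem_nhds hz] with w hw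
      exact (hd w hw).lineDeriv_eq_fderiv
    rw [h1.lineDeriv_eq, (hAd v).lineDeriv_eq_fderiv, hsnd]
  rw [laplaceBeltrami_conformalMetric hε, hline, hline]
  set a := fderiv ℝ (fderiv ℝ lam) z (e 0) (e 0) with ha
  set b := fderiv ℝ (fderiv ℝ lam) z (e 1) (e 1) with hb
  set L : E → 𝕜 := fun w => (lam w : 𝕜) with hL
  have hLs : ContDiffOn ℝ ∞ L Ω := contDiffOn_ofReal hlam
  have hψs : ContDiffOn ℝ ∞ ψ Ω := (contDiffOn_ofReal hlam.exp).congr hψ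
  have hψ1 : ∀ r : 𝕜, ∀ w ∈ Ω, wirt e r ψ w = ψ w * wirt e r L w := by
    intro r w hw
    rw [wirt_eqOn hΩ hψ hw, wirt_ofReal (hd w hw).exp, wirt_ofReal (hd w hw), hψ w hw,
      (hd w hw).hasFDerivAt.exp.fderiv]
    simp
    ring
  -- The product of the two operators is `(∂_x² - s² ∂_y²) / 4`, and `s² = -ε`; the mixed terms
  -- cancel by symmetry.
  have hLL : wirt e s (wirt e (-s) L) z = ((a + ε * b : ℝ) : 𝕜) / 4 := by
    have h1 : Set.EqOn (wirt e (-s) L) (fun w => 2⁻¹ * ((fderiv ℝ lam w (e 0) : 𝕜) +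
        (-s) * (fderiv ℝ lam w (e 1) : 𝕜))) Ω := fun w hw => wirt_ofReal (hd w hw)
    have hB : ∀ v, DifferentiableAt ℝ (fun w => (fderiv ℝ lam w v : 𝕜)) z := fun v =>
      (contDiffOn_ofReal (hA v)).differentiableAt_of_isOpen hΩ hz
    rw [wirt_eqOn hΩ h1 hz, wirt_const_mul _ ((hB _).fun_add ((hB _).const_mul _)),
      wirt_add (hB _) ((hB _).const_mul _), wirt_const_mul _ (hB _), wirt_ofReal (hAd _),
      wirt_ofReal (hAd _), hsnd, hsnd, hsnd, hsnd, hsymm (e 1) (e 0), ← ha, ← hb]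
    push_cast
    linear_combination (-(b : 𝕜) / 4) * hs
  have hψ2 : wirt e s (wirt e (-s) ψ) z = ψ z * wirt e s (wirt e (-s) L) z +
      wirt e s ψ z * wirt e (-s) L z := by
    rw [wirt_eqOn hΩ (hψ1 (-s)) hz, wirt_mul (hψs.differentiableAt_of_isOpen hΩ hz)
      ((contDiffOn_wirt hΩ hLs).differentiableAt_of_isOpen hΩ hz)]
  -- The bilinear expression is `ψ²` times the mixed second derivative of `log ψ = lam`.
  have hkey : ψ z * wirt e s (wirt e (-s) ψ) z - wirt e s ψ z * wirt e (-s) ψ z =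
      ((Real.exp (lam z) ^ 2 * ((a + ε * b) / 4) : ℝ) : 𝕜) := by
    rw [hψ2, hψ1 (-s) z hz, hLL, hψ z hz]
    push_cast
    ring
  have hκ : -(ε : 𝕜) / 4 = ((-ε / 4 : ℝ) : 𝕜) := by push_cast; ring
  rw [hkey, hκ, RCLike.ofReal_inj]
  have hx : Real.exp (-(2 * lam z)) = (Real.exp (lam z) ^ 2)⁻¹ := by
    rw [Real.exp_neg, ← Real.exp_nat_mul]; norm_num
  have hy : Real.exp (-4 * lam z) = ((Real.exp (lam z) ^ 2) ^ 2)⁻¹ := by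
    rw [neg_mul, Real.exp_neg, ← pow_mul, ← Real.exp_nat_mul]; norm_num
  rw [hx, hy]
  have hp : Real.exp (lam z) ^ 2 ≠ 0 := by positivity
  field_simp

/-! ### Separation of variables -/

variable {y₁ y₂ w₁ w₂ ψ : E → 𝕜}

/-- The factors `w₁`, `w₂` behave as constants for the operator with parameter `s`. -/
theorem wirt_separated (hΩ : IsOpen Ω) (hy1 : HoloOn e s Ω y₁) (hy2 : HoloOn e s Ω y₂)
    (hw1 : HoloOn e (-s) Ω w₁) (hw2 : HoloOn e (-s) Ω w₂)
    (hψ : ∀ z ∈ Ω, ψ z = y₁ z * w₁ z + y₂ z * w₂ z) (hz : z ∈ Ω) :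
    wirt e s ψ z = wirt e s y₁ z * w₁ z + wirt e s y₂ z * w₂ z := by
  have a1 := hy1.differentiableAt hΩ hz
  have a2 := hy2.differentiableAt hΩ hz
  have b1 := hw1.differentiableAt hΩ hz
  have b2 := hw2.differentiableAt hΩ hz
  have c1 := hw1.wirt_neg z hz
  have c2 := hw2.wirt_neg z hz
  rw [neg_neg] at c1 c2
  rw [wirt_eqOn hΩ hψ hz, wirt_add (a1.fun_mul b1) (a2.fun_mul b2), wirt_mul a1 b1, wirt_mul a2 b2,
    c1, c2]
  ring

theorem HoloOn.neg_neg (h : HoloOn e s Ω ψ) : HoloOn e (- -s) Ω ψ := by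
  rwa [_root_.neg_neg]

/-- The left side is the determinant of the matrix with rows `(ψ, D'ψ)` and `(Dψ, DD'ψ)`. Separation
factors it into the matrix of `D`-jets of `y₁, y₂` times the matrix of `D'`-jets of `w₁, w₂`, and
determinants multiply. -/
theorem separated_bilinear (hΩ : IsOpen Ω) (hy1 : HoloOn e s Ω y₁) (hy2 : HoloOn e s Ω y₂)
    (hw1 : HoloOn e (-s) Ω w₁) (hw2 : HoloOn e (-s) Ω w₂)
    (hψ : ∀ z ∈ Ω, ψ z = y₁ z * w₁ z + y₂ z * w₂ z) (hz : z ∈ Ω) :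
    ψ z * wirt e s (wirt e (-s) ψ) z - wirt e s ψ z * wirt e (-s) ψ z =
      wronsk e s y₁ y₂ z * wronsk e (-s) w₁ w₂ z := by
  have h1 : ∀ z ∈ Ω, wirt e (-s) ψ z = y₁ z * wirt e (-s) w₁ z + y₂ z * wirt e (-s) w₂ z := by
    intro z hz
    rw [wirt_separated hΩ hw1 hw2 hy1.neg_neg hy2.neg_neg (fun z hz => by rw [hψ z hz]; ring) hz]
    ring
  rw [wirt_separated hΩ hy1 hy2 (hw1.wirt hΩ) (hw2.wirt hΩ) h1 hz, h1 z hz,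
    wirt_separated hΩ hy1 hy2 hw1 hw2 hψ hz, hψ z hz]
  unfold wronsk
  ring

/-- Differentiating the constant Wronskian gives `y₁ y₂'' = y₂ y₁''`. Hence `y₁'' ψ = y₁ (y₁'' w₁ +
y₂'' w₂) = y₁ ψ''`, and likewise for `y₂`. The potential thus depends on `ψ` alone, not on the way
it is separated. -/
theorem separated_ode (hΩ : IsOpen Ω)
    (hy1 : HoloOn e s Ω y₁) (hy2 : HoloOn e s Ω y₂)
    (hw1 : HoloOn e (-s) Ω w₁) (hw2 : HoloOn e (-s) Ω w₂)
    (hψ : ∀ z ∈ Ω, ψ z = y₁ z * w₁ z + y₂ z * w₂ z) {c : 𝕜}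
    (hc : ∀ z ∈ Ω, wronsk e s y₁ y₂ z = c) (hψ0 : ∀ z ∈ Ω, ψ z ≠ 0) (hz : z ∈ Ω) :
    wirt e s (wirt e s y₁) z = wirt e s (wirt e s ψ) z / ψ z * y₁ z ∧
      wirt e s (wirt e s y₂) z = wirt e s (wirt e s ψ) z / ψ z * y₂ z := by
  have h1 : ∀ z ∈ Ω, wirt e s ψ z = wirt e s y₁ z * w₁ z + wirt e s y₂ z * w₂ z :=
    fun z hz => wirt_separated hΩ hy1 hy2 hw1 hw2 hψ hz
  have h2 := wirt_separated hΩ (hy1.wirt hΩ) (hy2.wirt hΩ) hw1 hw2 h1 hz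
  have h3 : wirt e s (wronsk e s y₁ y₂) z = 0 := by
    rw [wirt_eqOn hΩ (g := fun _ => c) hc hz, wirt_const]
  rw [wirt_wronsk hΩ hy1.smooth hy2.smooth hz] at h3
  have h0 := hψ0 z hz
  rw [h2]
  constructor
  · rw [div_mul_eq_mul_div, eq_div_iff h0, hψ z hz]
    linear_combination -w₂ z * h3
  · rw [div_mul_eq_mul_div, eq_div_iff h0, hψ z hz]
    linear_combination w₁ z * h3

/-- The potential `ψ_zz / ψ` of a solution depends on one characteristic variable only. -/
theorem holoOn_potential (hΩ : IsOpen Ω) (hψ : ContDiffOn ℝ ∞ ψ Ω) (hψ0 : ∀ z ∈ Ω, ψ z ≠ 0)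
    {κ : 𝕜} (hκ : ∀ z ∈ Ω,
      ψ z * wirt e s (wirt e (-s) ψ) z - wirt e s ψ z * wirt e (-s) ψ z = κ) :
    HoloOn e s Ω fun z => wirt e s (wirt e s ψ) z / ψ z := by
  have d : ∀ {f : E → 𝕜} {z : E}, ContDiffOn ℝ ∞ f Ω → z ∈ Ω → DifferentiableAt ℝ f z :=
    fun hf hz => hf.differentiableAt_of_isOpen hΩ hz
  have c1 : ∀ r : 𝕜, ContDiffOn ℝ ∞ (wirt e r ψ) Ω := fun r => contDiffOn_wirt hΩ hψ
  have c2 : ∀ r t : 𝕜, ContDiffOn ℝ ∞ (wirt e t (wirt e r ψ)) Ω :=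
    fun r t => contDiffOn_wirt hΩ (c1 r)
  refine ⟨by simp only [div_eq_mul_inv]; exact (c2 s s).mul (hψ.inv hψ0), fun z hz => ?_⟩
  rw [wirt_div (d (c2 s s) hz) (d hψ hz) (hψ0 z hz)]
  -- Differentiating the bilinear equation with `D`, two products cancel and `ψ DDD'ψ = DDψ D'ψ`
  -- remains; this is the numerator of `D'(DDψ / ψ)`.
  have h1 : wirt e s (fun z => ψ z * wirt e s (wirt e (-s) ψ) z -
      wirt e s ψ z * wirt e (-s) ψ z) z = 0 := by
    rw [wirt_eqOn hΩ (g := fun _ => κ) hκ hz, wirt_const]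
  rw [wirt_sub ((d hψ hz).fun_mul (d (c2 (-s) s) hz)) ((d (c1 s) hz).fun_mul (d (c1 (-s)) hz)),
    wirt_mul (d hψ hz) (d (c2 (-s) s) hz), wirt_mul (d (c1 s) hz) (d (c1 (-s)) hz)] at h1
  have h2 : wirt e (-s) (wirt e s (wirt e s ψ)) z = wirt e s (wirt e s (wirt e (-s) ψ)) z := by
    rw [wirt_comm ((c1 s).contDiffAt (hΩ.mem_nhds hz))]
    refine wirt_eqOn hΩ (fun w hw => ?_) hz
    exact wirt_comm (hψ.contDiffAt (hΩ.mem_nhds hw))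
  rw [h2, div_eq_zero_iff]
  left
  linear_combination h1

/-- A solution is separated by any pair of solutions of the associated linear equation. -/
theorem exists_separated (hΩ : IsOpen Ω) (hψ : ContDiffOn ℝ ∞ ψ Ω)
    {q : E → 𝕜} (hq : ∀ z ∈ Ω, wirt e s (wirt e s ψ) z = q z * ψ z)
    (hy1 : HoloOn e s Ω y₁) (hy2 : HoloOn e s Ω y₂)
    (hq1 : ∀ z ∈ Ω, wirt e s (wirt e s y₁) z = q z * y₁ z)
    (hq2 : ∀ z ∈ Ω, wirt e s (wirt e s y₂) z = q z * y₂ z)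
    (hw : ∀ z ∈ Ω, wronsk e s y₁ y₂ z = 1) :
    HoloOn e (-s) Ω (wronsk e s ψ y₂) ∧ HoloOn e (-s) Ω (fun z => -wronsk e s ψ y₁ z) ∧
      ∀ z ∈ Ω, ψ z = y₁ z * wronsk e s ψ y₂ z + y₂ z * -wronsk e s ψ y₁ z := by
  -- Here `ψ` and `y` solve the same equation in the direction `D`, so their Wronskian is
  -- annihilated by `D`. It need not be constant, because `ψ` also depends on the other variable.
  have aux : ∀ y : E → 𝕜, HoloOn e s Ω y → (∀ z ∈ Ω, wirt e s (wirt e s y) z = q z * y z) →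
      HoloOn e (-s) Ω (wronsk e s ψ y) := by
    intro y hy hqy
    refine ⟨(hψ.mul (hy.wirt hΩ).smooth).sub (hy.smooth.mul (contDiffOn_wirt hΩ hψ)),
      fun z hz => ?_⟩
    rw [_root_.neg_neg, wirt_wronsk hΩ hψ hy.smooth hz, hq z hz, hqy z hz]
    ring
  refine ⟨aux y₂ hy2 hq2, ?_, fun z hz => ?_⟩
  · simpa only [neg_one_mul] using (aux y₁ hy1 hq1).const_mul hΩ (-1)
  · have h1 := hw z hz
    unfold wronsk at h1 ⊢
    linear_combination (-ψ z) * h1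

end Liouville

section Global

variable {E 𝕜 : Type*} [NormedAddCommGroup E] [NormedSpace ℝ E] [RCLike 𝕜]
  {e : Fin 2 → E} {s t : 𝕜} {Ω : Set E} {z : E}

/-! ### Global solutions of the linear equation `y'' = q y` -/

/-- `y₁`, `y₂` are two solutions of `y'' = q y` on `Ω` with Wronskian `1`. -/
structure IsFundamental (e : Fin 2 → E) (s : 𝕜) (q : E → 𝕜) (Ω : Set E) (y₁ y₂ : E → 𝕜) :
    Prop where
  holo₁ : HoloOn e s Ω y₁
  holo₂ : HoloOn e s Ω y₂
  ode₁ : ∀ z ∈ Ω, wirt e s (wirt e s y₁) z = q z * y₁ z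
  ode₂ : ∀ z ∈ Ω, wirt e s (wirt e s y₂) z = q z * y₂ z
  wronsk_eq : ∀ z ∈ Ω, wronsk e s y₁ y₂ z = 1

theorem IsFundamental.mono {q y₁ y₂ : E → 𝕜} {Ω' : Set E} (h : IsFundamental e s q Ω y₁ y₂)
    (hs : Ω' ⊆ Ω) : IsFundamental e s q Ω' y₁ y₂ :=
  ⟨h.holo₁.mono hs, h.holo₂.mono hs, fun z hz => h.ode₁ z (hs hz), fun z hz => h.ode₂ z (hs hz),
    fun z hz => h.wronsk_eq z (hs hz)⟩

theorem wirt_combination {f g : E → 𝕜} (hf : DifferentiableAt ℝ f z)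
    (hg : DifferentiableAt ℝ g z) (α β : 𝕜) :
    wirt e s (fun w => α * f w + β * g w) z = α * wirt e s f z + β * wirt e s g z := by
  rw [wirt_add (hf.const_mul α) (hg.const_mul β), wirt_const_mul α hf, wirt_const_mul β hg]

theorem wronsk_combination {f g : E → 𝕜} (hf : DifferentiableAt ℝ f z)
    (hg : DifferentiableAt ℝ g z) (α β γ δ : 𝕜) :
    wronsk e s (fun w => α * f w + β * g w) (fun w => γ * f w + δ * g w) z =
      (α * δ - β * γ) * wronsk e s f g z := by
  simp only [wronsk, wirt_combination hf hg]
  ring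

theorem HoloOn.combination {f g : E → 𝕜} (hΩ : IsOpen Ω) (hf : HoloOn e s Ω f)
    (hg : HoloOn e s Ω g) (α β : 𝕜) : HoloOn e s Ω fun w => α * f w + β * g w :=
  (hf.const_mul hΩ α).add hΩ (hg.const_mul hΩ β)

theorem wirt_wirt_combination {f g : E → 𝕜} (hΩ : IsOpen Ω) (hf : HoloOn e s Ω f)
    (hg : HoloOn e s Ω g) (α β : 𝕜) (hz : z ∈ Ω) :
    wirt e s (wirt e s fun w => α * f w + β * g w) z =
      α * wirt e s (wirt e s f) z + β * wirt e s (wirt e s g) z := by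
  rw [wirt_eqOn hΩ (fun w hw => wirt_combination (hf.differentiableAt hΩ hw)
    (hg.differentiableAt hΩ hw) α β) hz, wirt_combination ((hf.wirt hΩ).differentiableAt hΩ hz)
    ((hg.wirt hΩ).differentiableAt hΩ hz)]

theorem IsFundamental.combination {q y₁ y₂ : E → 𝕜} (hΩ : IsOpen Ω)
    (h : IsFundamental e s q Ω y₁ y₂) {α β γ δ : 𝕜} (hdet : α * δ - β * γ = 1) :
    IsFundamental e s q Ω (fun w => α * y₁ w + β * y₂ w) (fun w => γ * y₁ w + δ * y₂ w) := by
  refine ⟨h.holo₁.combination hΩ h.holo₂ α β, h.holo₁.combination hΩ h.holo₂ γ δ,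
    fun z hz => ?_, fun z hz => ?_, fun z hz => ?_⟩
  · rw [wirt_wirt_combination hΩ h.holo₁ h.holo₂ _ _ hz, h.ode₁ z hz, h.ode₂ z hz]
    ring
  · rw [wirt_wirt_combination hΩ h.holo₁ h.holo₂ _ _ hz, h.ode₁ z hz, h.ode₂ z hz]
    ring
  · rw [wronsk_combination (h.holo₁.differentiableAt hΩ hz) (h.holo₂.differentiableAt hΩ hz),
      h.wronsk_eq z hz, hdet, mul_one]

theorem IsFundamental.exists_combination (he : Submodule.span ℝ (Set.range e) = ⊤) (hs : s ≠ 0)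
    {q y₁ y₂ f : E → 𝕜} (hΩ : IsOpen Ω) (hc : IsPreconnected Ω)
    (h : IsFundamental e s q Ω y₁ y₂) (hf : HoloOn e s Ω f)
    (hqf : ∀ z ∈ Ω, wirt e s (wirt e s f) z = q z * f z) :
    ∃ α β : 𝕜, ∀ z ∈ Ω, f z = α * y₁ z + β * y₂ z :=
  _root_.exists_combination he hs hΩ hc h.holo₁ h.holo₂ hf one_ne_zero h.wronsk_eq h.ode₁ h.ode₂ hqf

/-! ### Fundamental pairs on a simply connected domain. -/

theorem HoloOn.of_nhds {f : E → 𝕜}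
    (h : ∀ z ∈ Ω, ∃ U, IsOpen U ∧ z ∈ U ∧ HoloOn e s U f) : HoloOn e s Ω f := by
  refine ⟨fun z hz => ?_, fun z hz => ?_⟩
  · obtain ⟨U, hU, hzU, hf⟩ := h z hz
    exact (hf.smooth.contDiffAt (hU.mem_nhds hzU)).contDiffWithinAt
  · obtain ⟨U, hU, hzU, hf⟩ := h z hz
    exact hf.wirt_neg z hzU

/-- The matrix of `1`-jets of two functions. -/
def jetMatrix (e : Fin 2 → E) (s : 𝕜) (y₁ y₂ : E → 𝕜) (z : E) : Matrix (Fin 2) (Fin 2) 𝕜 :=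
  !![y₁ z, wirt e s y₁ z; y₂ z, wirt e s y₂ z]

theorem det_jetMatrix (y₁ y₂ : E → 𝕜) (z : E) :
    (jetMatrix e s y₁ y₂ z).det = wronsk e s y₁ y₂ z := by
  rw [jetMatrix, Matrix.det_fin_two_of, wronsk]
  ring

/-- Local fundamental pairs differ by constant invertible matrices. Gluing is applied to the
matrices of `1`-jets, not to the pairs of values, because their determinant is the Wronskian `1`,
and on invertible matrices the general linear group acts freely. -/
theorem exists_isFundamental (he : Submodule.span ℝ (Set.range e) = ⊤) (hs : s ≠ 0)
    (hΩ : IsOpen Ω) (hsc : IsSimplyConnected Ω) {q : E → 𝕜}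
    (hloc : ∀ z ∈ Ω, ∃ U, IsOpen U ∧ z ∈ U ∧ ∃ y₁ y₂, IsFundamental e s q U y₁ y₂) :
    ∃ y₁ y₂, IsFundamental e s q Ω y₁ y₂ := by
  classical
  have hloc' : ∀ z : E, ∃ U : Set E, ∃ y₁ y₂ : E → 𝕜, z ∈ Ω →
      IsOpen U ∧ z ∈ U ∧ IsFundamental e s q U y₁ y₂ := by
    intro z
    by_cases hz : z ∈ Ω
    · obtain ⟨U, h1, h2, y₁, y₂, h3⟩ := hloc z hz
      exact ⟨U, y₁, y₂, fun _ => ⟨h1, h2, h3⟩⟩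
    · exact ⟨∅, 0, 0, fun h => absurd h hz⟩
  choose U Y₁ Y₂ hU using hloc'
  obtain ⟨Ψ, hΨ⟩ := hsc.exists_glue (H := (Matrix (Fin 2) (Fin 2) 𝕜)ˣ)
    (A := Matrix (Fin 2) (Fin 2) 𝕜) hΩ U (fun i hi => (hU i hi).1) (fun i hi => (hU i hi).2.1)
    (fun i => jetMatrix e s (Y₁ i) (Y₂ i))
    (by
      intro i hi x hx h hh
      have hdet : IsUnit (jetMatrix e s (Y₁ i) (Y₂ i) x).det := by
        rw [det_jetMatrix, (hU i hi).2.2.wronsk_eq x hx]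
        exact isUnit_one
      rw [Units.smul_def, smul_eq_mul] at hh
      ext1
      have := congrArg (· * (jetMatrix e s (Y₁ i) (Y₂ i) x)⁻¹) hh
      simpa [Matrix.mul_assoc, Matrix.mul_nonsing_inv _ hdet] using this)
    (by
      intro i hi j hj x hx hxi hxj
      obtain ⟨r, hr, hball⟩ := Metric.isOpen_iff.1 ((hU i hi).1.inter (hU j hj).1) x ⟨hxi, hxj⟩
      have hB := Metric.isOpen_ball (x := x) (ε := r)
      have hi' := (hU i hi).2.2.mono (fun z hz => (hball hz).1)
      have hj' := (hU j hj).2.2.mono (fun z hz => (hball hz).2)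
      obtain ⟨α, β, h1⟩ := hj'.exists_combination he hs hB Metric.isPreconnected_ball hi'.holo₁
        hi'.ode₁
      obtain ⟨γ, δ, h2⟩ := hj'.exists_combination he hs hB Metric.isPreconnected_ball hi'.holo₂
        hi'.ode₂
      have hM : ∀ z ∈ Metric.ball x r, jetMatrix e s (Y₁ i) (Y₂ i) z =
          !![α, β; γ, δ] * jetMatrix e s (Y₁ j) (Y₂ j) z := by
        intro z hz
        have d1 := wirt_eqOn (e := e) (s := s) hB h1 hz
        have d2 := wirt_eqOn (e := e) (s := s) hB h2 hz
        rw [wirt_combination (hj'.holo₁.differentiableAt hB hz)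
          (hj'.holo₂.differentiableAt hB hz)] at d1 d2
        simp [jetMatrix, h1 z hz, h2 z hz, d1, d2]
      have hx0 : x ∈ Metric.ball x r := Metric.mem_ball_self hr
      have hdet : IsUnit (!![α, β; γ, δ] : Matrix (Fin 2) (Fin 2) 𝕜).det := by
        have := congrArg Matrix.det (hM x hx0)
        rw [Matrix.det_mul, det_jetMatrix, det_jetMatrix, hi'.wronsk_eq x hx0,
          hj'.wronsk_eq x hx0, mul_one] at this
        rw [← this]
        exact isUnit_one
      refine ⟨Matrix.nonsingInvUnit _ hdet, ?_⟩
      filter_upwards [Metric.ball_mem_nhds x hr] with z hz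
      rw [Units.smul_def, smul_eq_mul]
      exact hM z hz)
  -- The first column of the glued jet matrix holds the values of the two functions.
  let y₁ : E → 𝕜 := fun z => Ψ z 0 0
  let y₂ : E → 𝕜 := fun z => Ψ z 1 0
  have hloc2 : ∀ i ∈ Ω, ∃ V, IsOpen V ∧ i ∈ V ∧ ∃ α β γ δ : 𝕜, α * δ - β * γ ≠ 0 ∧
      IsFundamental e s q V (Y₁ i) (Y₂ i) ∧
      (∀ z ∈ V, y₁ z = α * Y₁ i z + β * Y₂ i z) ∧
      ∀ z ∈ V, y₂ z = γ * Y₁ i z + δ * Y₂ i z := by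
    intro i hi
    obtain ⟨h, hh⟩ := hΨ i hi
    obtain ⟨V, hV, hVo, hiV⟩ := eventually_nhds_iff.1 hh
    refine ⟨V ∩ U i, hVo.inter (hU i hi).1, ⟨hiV, (hU i hi).2.1⟩, (h : Matrix (Fin 2) (Fin 2) 𝕜) 0 0,
      (h : Matrix (Fin 2) (Fin 2) 𝕜) 0 1, (h : Matrix (Fin 2) (Fin 2) 𝕜) 1 0, (h : Matrix (Fin 2) (Fin 2) 𝕜) 1 1, ?_,
      (hU i hi).2.2.mono Set.inter_subset_right, fun z hz => ?_, fun z hz => ?_⟩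
    · rw [← Matrix.det_fin_two]
      exact ((Matrix.isUnit_iff_isUnit_det _).1 h.isUnit).ne_zero
    · simp only [y₁]
      rw [hV z hz.1, Units.smul_def, smul_eq_mul, Matrix.mul_apply, Fin.sum_univ_two]
      simp [jetMatrix]
    · simp only [y₂]
      rw [hV z hz.1, Units.smul_def, smul_eq_mul, Matrix.mul_apply, Fin.sum_univ_two]
      simp [jetMatrix]
  have h1 : HoloOn e s Ω y₁ := by
    refine HoloOn.of_nhds fun z hz => ?_
    obtain ⟨V, hV, hzV, α, β, γ, δ, -, hF, ha, -⟩ := hloc2 z hz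
    exact ⟨V, hV, hzV, (hF.holo₁.combination hV hF.holo₂ α β).congr hV ha⟩
  have h2 : HoloOn e s Ω y₂ := by
    refine HoloOn.of_nhds fun z hz => ?_
    obtain ⟨V, hV, hzV, α, β, γ, δ, -, hF, -, hb⟩ := hloc2 z hz
    exact ⟨V, hV, hzV, (hF.holo₁.combination hV hF.holo₂ γ δ).congr hV hb⟩
  have o1 : ∀ z ∈ Ω, wirt e s (wirt e s y₁) z = q z * y₁ z := by
    intro z hz
    obtain ⟨V, hV, hzV, α, β, γ, δ, -, hF, ha, -⟩ := hloc2 z hz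
    rw [wirt_eqOn hV (wirt_eqOn hV ha) hzV, wirt_wirt_combination hV hF.holo₁ hF.holo₂ _ _ hzV,
      hF.ode₁ z hzV, hF.ode₂ z hzV, ha z hzV]
    ring
  have o2 : ∀ z ∈ Ω, wirt e s (wirt e s y₂) z = q z * y₂ z := by
    intro z hz
    obtain ⟨V, hV, hzV, α, β, γ, δ, -, hF, -, hb⟩ := hloc2 z hz
    rw [wirt_eqOn hV (wirt_eqOn hV hb) hzV, wirt_wirt_combination hV hF.holo₁ hF.holo₂ _ _ hzV,
      hF.ode₁ z hzV, hF.ode₂ z hzV, hb z hzV]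
    ring
  obtain ⟨c, hc⟩ := exists_const_wronsk he hs hΩ hsc.isPathConnected.isConnected.isPreconnected
    h1 h2 o1 o2
  have hc0 : c ≠ 0 := by
    obtain ⟨z, hz⟩ := hsc.nonempty
    obtain ⟨V, hV, hzV, α, β, γ, δ, hdet, hF, ha, hb⟩ := hloc2 z hz
    rw [← hc z hz]
    have h3 : wronsk e s y₁ y₂ z = (α * δ - β * γ) * wronsk e s (Y₁ z) (Y₂ z) z := by
      rw [← wronsk_combination (hF.holo₁.differentiableAt hV hzV)
        (hF.holo₂.differentiableAt hV hzV)]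
      unfold wronsk
      rw [wirt_eqOn hV ha hzV, wirt_eqOn hV hb hzV, ha z hzV, hb z hzV]
    rw [h3, hF.wronsk_eq z hzV, mul_one]
    exact hdet
  -- Gluing used matrices of arbitrary nonzero determinant, so the Wronskian is only a nonzero
  -- constant `c`; rescaling one solution makes it `1`.
  refine ⟨fun z => c⁻¹ * y₁ z, y₂, h1.const_mul hΩ _, h2, fun z hz => ?_, o2, fun z hz => ?_⟩
  · rw [wirt_eqOn hΩ (fun w hw => wirt_const_mul c⁻¹ (h1.differentiableAt hΩ hw)) hz,
      wirt_const_mul _ ((h1.wirt hΩ).differentiableAt hΩ hz), o1 z hz]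
    ring
  · have h3 := hc z hz
    unfold wronsk at h3 ⊢
    rw [wirt_const_mul c⁻¹ (h1.differentiableAt hΩ hz)]
    field_simp
    linear_combination h3

/-! ### Gluing functions defined up to sign -/

/-- On a small ball `g₁` has no zeros, so `f₁ / g₁` is a continuous function with values `±1`, hence
constant. The mixed product then forces the same sign for the second component, even where that
component vanishes. -/
theorem eventually_eq_sign_mul {f₁ f₂ g₁ g₂ : E → 𝕜} {x : E} (hf : ∀ᶠ y in 𝓝 x, ContinuousAt f₁ y)
    (hg : ∀ᶠ y in 𝓝 x, ContinuousAt g₁ y) (h0 : g₁ x ≠ 0)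
    (h11 : ∀ᶠ y in 𝓝 x, f₁ y * f₁ y = g₁ y * g₁ y)
    (h12 : ∀ᶠ y in 𝓝 x, f₁ y * f₂ y = g₁ y * g₂ y) :
    ∃ c : ℤˣ, ∀ᶠ y in 𝓝 x, f₁ y = c • g₁ y ∧ f₂ y = c • g₂ y := by
  have hne : ∀ᶠ y in 𝓝 x, g₁ y ≠ 0 := hg.self_of_nhds.eventually_ne h0
  obtain ⟨r, hr, hB⟩ := Metric.eventually_nhds_iff_ball.1
    (hf.and (hg.and (hne.and (h11.and h12))))
  have hsq : Set.EqOn (f₁ ^ 2) (g₁ ^ 2) (Metric.ball x r) := by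
    intro y hy
    simpa [sq] using (hB y hy).2.2.2.1
  have hfin : ∀ c : ℤˣ, (∀ y ∈ Metric.ball x r, f₁ y = c • g₁ y) →
      ∃ c : ℤˣ, ∀ᶠ y in 𝓝 x, f₁ y = c • g₁ y ∧ f₂ y = c • g₂ y := by
    intro c hc
    refine ⟨c, ?_⟩
    filter_upwards [Metric.ball_mem_nhds x hr] with y hy
    refine ⟨hc y hy, ?_⟩
    obtain ⟨-, -, n0, -, q12⟩ := hB y hy
    have h3 := hc y hy
    rcases Int.units_eq_one_or c with rfl | rfl
    · rw [one_smul] at h3 ⊢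
      rw [h3] at q12
      exact mul_left_cancel₀ n0 q12
    · simp only [Units.neg_smul, one_smul] at h3 ⊢
      rw [h3] at q12
      exact mul_left_cancel₀ n0 (by linear_combination -q12)
  rcases Metric.isPreconnected_ball.eq_or_eq_neg_of_sq_eq
    (fun y hy => (hB y hy).1.continuousWithinAt) (fun y hy => (hB y hy).2.1.continuousWithinAt)
    hsq (fun hy => (hB _ hy).2.2.1) with h | h
  · exact hfin 1 (fun y hy => by rw [one_smul]; exact h hy)
  · exact hfin (-1) (fun y hy => by rw [Units.neg_smul, one_smul]; exact h hy)

/-- Pairs of local functions which agree up to sign can be glued. -/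
theorem exists_glue_of_sq_eq (hΩ : IsOpen Ω) (hsc : IsSimplyConnected Ω)
    (U : E → Set E) (hU : ∀ i ∈ Ω, IsOpen (U i)) (hmem : ∀ i ∈ Ω, i ∈ U i) (Y₁ Y₂ : E → E → 𝕜)
    (hc₁ : ∀ i ∈ Ω, ContinuousOn (Y₁ i) (U i)) (hc₂ : ∀ i ∈ Ω, ContinuousOn (Y₂ i) (U i))
    (h0 : ∀ i ∈ Ω, ∀ z ∈ U i, Y₁ i z ≠ 0 ∨ Y₂ i z ≠ 0)
    (h11 : ∀ i ∈ Ω, ∀ j ∈ Ω, ∀ z ∈ Ω, z ∈ U i → z ∈ U j → Y₁ i z * Y₁ i z = Y₁ j z * Y₁ j z)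
    (h12 : ∀ i ∈ Ω, ∀ j ∈ Ω, ∀ z ∈ Ω, z ∈ U i → z ∈ U j → Y₁ i z * Y₂ i z = Y₁ j z * Y₂ j z)
    (h22 : ∀ i ∈ Ω, ∀ j ∈ Ω, ∀ z ∈ Ω, z ∈ U i → z ∈ U j → Y₂ i z * Y₂ i z = Y₂ j z * Y₂ j z) :
    ∃ y₁ y₂ : E → 𝕜, ∀ i ∈ Ω, ∃ c : 𝕜, c ^ 2 = 1 ∧
      ∀ᶠ z in 𝓝 i, y₁ z = c * Y₁ i z ∧ y₂ z = c * Y₂ i z := by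
  have compat : ∀ i ∈ Ω, ∀ j ∈ Ω, ∀ x ∈ Ω, x ∈ U i → x ∈ U j →
      ∃ h : ℤˣ, ∀ᶠ y in 𝓝 x, ((Y₁ i y, Y₂ i y) : 𝕜 × 𝕜) = h • ((Y₁ j y, Y₂ j y) : 𝕜 × 𝕜) := by
    intro i hi j hj x hx hxi hxj
    have nΩ := hΩ.mem_nhds hx
    have ni := (hU i hi).mem_nhds hxi
    have nj := (hU j hj).mem_nhds hxj
    have hce : ∀ {f : E → 𝕜} {V : Set E}, IsOpen V → ContinuousOn f V → V ∈ 𝓝 x →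
        ∀ᶠ y in 𝓝 x, ContinuousAt f y := by
      intro f V hV hf hxV
      filter_upwards [hxV] with y hy
      exact hf.continuousAt (hV.mem_nhds hy)
    have e11 : ∀ᶠ y in 𝓝 x, Y₁ i y * Y₁ i y = Y₁ j y * Y₁ j y := by
      filter_upwards [nΩ, ni, nj] with y a b c using h11 i hi j hj y a b c
    have e12 : ∀ᶠ y in 𝓝 x, Y₁ i y * Y₂ i y = Y₁ j y * Y₂ j y := by
      filter_upwards [nΩ, ni, nj] with y a b c using h12 i hi j hj y a b c
    have e22 : ∀ᶠ y in 𝓝 x, Y₂ i y * Y₂ i y = Y₂ j y * Y₂ j y := by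
      filter_upwards [nΩ, ni, nj] with y a b c using h22 i hi j hj y a b c
    -- The common sign is read off from whichever component does not vanish at `x`.
    rcases h0 j hj x hxj with hne | hne
    · obtain ⟨c, hc⟩ := eventually_eq_sign_mul (hce (hU i hi) (hc₁ i hi) ni)
        (hce (hU j hj) (hc₁ j hj) nj) hne e11 e12
      refine ⟨c, ?_⟩
      filter_upwards [hc] with y hy
      rw [hy.1, hy.2]
      rfl
    · obtain ⟨c, hc⟩ := eventually_eq_sign_mul (hce (hU i hi) (hc₂ i hi) ni)
        (hce (hU j hj) (hc₂ j hj) nj) hne e22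
        (f₂ := Y₁ i) (g₂ := Y₁ j) (by filter_upwards [e12] with y hy; linear_combination hy)
      refine ⟨c, ?_⟩
      filter_upwards [hc] with y hy
      rw [hy.1, hy.2]
      rfl
  obtain ⟨Ψ, hΨ⟩ := hsc.exists_glue (H := ℤˣ) (A := 𝕜 × 𝕜) hΩ U hU hmem
    (fun i z => (Y₁ i z, Y₂ i z))
    (by
      intro i hi x hx h hh
      rcases Int.units_eq_one_or h with rfl | rfl
      · rfl
      · exfalso
        simp only [Units.neg_smul, one_smul, Prod.neg_mk, Prod.mk.injEq, neg_eq_self] at hh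
        rcases h0 i hi x hx with h1 | h1
        · exact h1 hh.1
        · exact h1 hh.2)
    compat
  refine ⟨fun z => (Ψ z).1, fun z => (Ψ z).2, fun i hi => ?_⟩
  obtain ⟨h, hh⟩ := hΨ i hi
  rcases Int.units_eq_one_or h with rfl | rfl
  · refine ⟨1, one_pow 2, ?_⟩
    filter_upwards [hh] with z hz
    simp [hz]
  · refine ⟨-1, by norm_num, ?_⟩
    filter_upwards [hh] with z hz
    simp [hz]

/-! ### Density of the regular points -/

/-- If `y₁` vanished on an open set, so would its derivative and then the Wronskian. Applied to
small open sets, this says that the regular points are dense. -/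
theorem exists_ne_zero_of_wronsk {y₁ y₂ : E → 𝕜} {U : Set E} (hU : IsOpen U) (hUne : U.Nonempty)
    (hw : ∀ z ∈ U, wronsk e s y₁ y₂ z ≠ 0) : ∃ z ∈ U, y₁ z ≠ 0 := by
  by_contra! h
  obtain ⟨z, hz⟩ := hUne
  apply hw z hz
  have h1 : wirt e s y₁ z = 0 := by
    rw [wirt_eqOn (g := fun _ => 0) hU h hz, wirt_const]
  rw [wronsk, h z hz, h1]
  ring

/-- A function without zeros has constant sign on a connected set. -/
theorem abs_eq_const_mul_of_ne_zero {X : Type*} [TopologicalSpace X] {Ω : Set X} {f : X → ℝ}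
    (hc : IsPreconnected Ω) (hf : ContinuousOn f Ω)
    (h0 : ∀ z ∈ Ω, f z ≠ 0) : ∃ δ : ℝ, δ ^ 2 = 1 ∧ ∀ z ∈ Ω, |f z| = δ * f z := by
  rcases hc.eq_or_eq_neg_of_sq_eq (f := fun z => |f z|) (g := f) hf.abs hf
    (fun z _ => by simp) (fun hz => h0 _ hz) with h | h
  · exact ⟨1, by norm_num, fun z hz => by rw [one_mul]; exact h hz⟩
  · exact ⟨-1, by norm_num, fun z hz => by rw [neg_one_mul]; exact h hz⟩

end Global

/-! ### The Wirtinger operators on the complex plane -/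

section Complex

open Complex

variable {Ω : Set ℂ} {f : ℂ → ℂ} {z : ℂ}

theorem span_complexFrame : Submodule.span ℝ (Set.range complexFrame) = ⊤ := by
  rw [eq_top_iff]
  intro z _
  have h0 : complexFrame 0 ∈ Submodule.span ℝ (Set.range complexFrame) :=
    Submodule.subset_span ⟨0, rfl⟩
  have h1 : complexFrame 1 ∈ Submodule.span ℝ (Set.range complexFrame) :=
    Submodule.subset_span ⟨1, rfl⟩
  have h := Submodule.add_mem _ (Submodule.smul_mem _ z.re h0) (Submodule.smul_mem _ z.im h1)
  convert h
  apply Complex.ext <;> simp [complexFrame]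

theorem fderiv_real_apply (hf : DifferentiableAt ℂ f z) (v : ℂ) :
    fderiv ℝ f z v = v * deriv f z := by
  rw [hf.fderiv_restrictScalars ℝ]
  simp

theorem wirt_complex (hf : DifferentiableAt ℂ f z) : wirt complexFrame (-I) f z = deriv f z := by
  simp only [wirt, fderiv_real_apply hf, complexFrame]
  simp only [Matrix.cons_val_zero, Matrix.cons_val_one]
  linear_combination (-deriv f z / 2) * I_sq

/-- For the parameter `-I` the two operators are `∂/∂z` and `∂/∂z̄`, and the vanishing of the second
is the Cauchy-Riemann equation. -/
theorem holoOn_complex_iff (hΩ : IsOpen Ω) :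
    HoloOn complexFrame (-I) Ω f ↔ DifferentiableOn ℂ f Ω := by
  constructor
  · intro h z hz
    refine DifferentiableAt.differentiableWithinAt ?_
    rw [differentiableAt_complex_iff_differentiableAt_real]
    refine ⟨h.differentiableAt hΩ hz, ?_⟩
    have h1 := h.wirt_neg z hz
    simp only [wirt, complexFrame, neg_neg, Matrix.cons_val_zero, Matrix.cons_val_one] at h1
    rw [smul_eq_mul]
    have h2 : fderiv ℝ f z 1 + I * fderiv ℝ f z I = 0 := by simpa using h1
    linear_combination (-I) * h2 + fderiv ℝ f z I * I_sq
  · intro h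
    refine ⟨(h.contDiffOn hΩ).restrict_scalars ℝ, fun z hz => ?_⟩
    have hd := h.differentiableAt (hΩ.mem_nhds hz)
    simp only [wirt, fderiv_real_apply hd, complexFrame]
    simp only [Matrix.cons_val_zero, Matrix.cons_val_one, neg_neg]
    linear_combination (deriv f z / 2) * I_sq

theorem wirt_conj {E : Type*} [NormedAddCommGroup E] [NormedSpace ℝ E] {e : Fin 2 → E} {f : E → ℂ}
    {z : E} {s : ℂ} :
    wirt e s (fun w => (starRingEnd ℂ) (f w)) z =
      (starRingEnd ℂ) (wirt e ((starRingEnd ℂ) s) f z) := by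
  have h1 : fderiv ℝ (fun w => (starRingEnd ℂ) (f w)) z =
      (conjCLE : ℂ →L[ℝ] ℂ).comp (fderiv ℝ f z) := conjCLE.comp_fderiv
  simp [wirt, h1]
  exact Or.inl (map_ofNat (starRingEnd ℂ) 2).symm

theorem HoloOn.conj {E : Type*} [NormedAddCommGroup E] [NormedSpace ℝ E] {e : Fin 2 → E}
    {f : E → ℂ} {Ω : Set E} {s : ℂ} (h : HoloOn e s Ω f) :
    HoloOn e ((starRingEnd ℂ) s) Ω fun w => (starRingEnd ℂ) (f w) := by
  refine ⟨conjCLE.contDiff.comp_contDiffOn h.smooth, fun z hz => ?_⟩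
  rw [wirt_conj, map_neg, conj_conj, h.wirt_neg z hz, map_zero]

/-! ### Power series solutions of `y'' = q y` -/

/-- The radius `1 / (4 K)` is far from optimal; it makes the differentiated series dominated by the
fixed series `n (1 / 4)^n`. -/
theorem hasDerivAt_tsum_pow {c : ℕ → ℂ} {M K : ℝ} (hK : 0 < K) (hc : ∀ n, ‖c n‖ ≤ M * K ^ n)
    (hz : ‖z‖ < (4 * K)⁻¹) :
    HasDerivAt (fun z => ∑' n, c n * z ^ n) (∑' n, ((n + 1 : ℕ) * c (n + 1)) * z ^ n) z := by
  have hM : 0 ≤ M := by simpa using (norm_nonneg _).trans (hc 0)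
  have hsum : Summable fun n : ℕ => (4 * K * M) * ((n : ℝ) * (1 / 4 : ℝ) ^ n) := by
    have := summable_pow_mul_geometric_of_norm_lt_one (R := ℝ) 1 (r := 1 / 4) (by norm_num)
    simpa using this.mul_left (4 * K * M)
  have hbound : ∀ (n : ℕ) (w : ℂ), w ∈ Metric.ball (0 : ℂ) (4 * K)⁻¹ →
      ‖c n * (n * w ^ (n - 1))‖ ≤ (4 * K * M) * ((n : ℝ) * (1 / 4 : ℝ) ^ n) := by
    intro n w hw
    rw [mem_ball_zero_iff] at hw
    rcases n with _ | n
    · simp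
    · rw [norm_mul, norm_mul, norm_pow, Nat.add_sub_cancel, Complex.norm_natCast]
      have h1 : ‖w‖ ^ n ≤ ((4 * K)⁻¹) ^ n := pow_le_pow_left₀ (norm_nonneg _) hw.le n
      calc ‖c (n + 1)‖ * (((n + 1 : ℕ) : ℝ) * ‖w‖ ^ n)
          ≤ (M * K ^ (n + 1)) * (((n + 1 : ℕ) : ℝ) * ((4 * K)⁻¹) ^ n) := by
            gcongr
            exact hc _
        _ = _ := by
            rw [mul_inv, mul_pow, inv_pow K, one_div, pow_succ (4⁻¹ : ℝ), pow_succ K]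
            field_simp
  have hd := hasDerivAt_tsum_of_isPreconnected (𝕜 := ℂ) hsum Metric.isOpen_ball
    Metric.isPreconnected_ball (g := fun n w => c n * w ^ n)
    (g' := fun n w => c n * (n * w ^ (n - 1)))
    (fun n w _ => (hasDerivAt_pow n w).const_mul (c n)) hbound
    (y₀ := 0) (Metric.mem_ball_self (by positivity))
    (summable_of_ne_finset_zero (s := {0}) (fun n hn => by
      have : n ≠ 0 := by simpa using hn
      simp [this]))
    (mem_ball_zero_iff.2 hz)
  refine hd.congr_deriv ?_
  rw [(Summable.of_norm_bounded hsum
    (fun n => hbound n z (mem_ball_zero_iff.2 hz))).tsum_eq_zero_add]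
  simp only [Nat.cast_zero, zero_mul, mul_zero, zero_add, Nat.add_sub_cancel]
  exact tsum_congr fun n => by ring

/-- The coefficients of the power series solution of `y'' = q y`. -/
def odeCoeff (q : ℕ → ℂ) (α β : ℂ) : ℕ → ℂ
  | 0 => α
  | 1 => β
  | n + 2 => (∑ k : Fin (n + 1), q (n - k) * odeCoeff q α β k) / ((n + 2) * (n + 1))

/-- The recursion has `n + 1` terms, each at most `C K^n ≤ K^(n + 2)`, and divides by `(n + 2)(n +
1)`, which more than compensates for their number. -/
theorem norm_odeCoeff_le {q : ℕ → ℂ} {C K : ℝ} (hq : ∀ n, ‖q n‖ ≤ C * K ^ n) (hK : 1 ≤ K)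
    (hCK : C ≤ K ^ 2) {α β : ℂ} (hα : ‖α‖ ≤ 1) (hβ : ‖β‖ ≤ 1) (n : ℕ) :
    ‖odeCoeff q α β n‖ ≤ 1 * K ^ n := by
  have hC : 0 ≤ C := by simpa using (norm_nonneg _).trans (hq 0)
  induction n using Nat.strong_induction_on with
  | _ n ih =>
    match n with
    | 0 => simpa [odeCoeff] using hα
    | 1 => simpa [odeCoeff] using hβ.trans hK
    | n + 2 =>
      rw [odeCoeff, norm_div, one_mul]
      have h1 : ‖∑ k : Fin (n + 1), q (n - k) * odeCoeff q α β k‖ ≤ (n + 1) * (C * K ^ n) := by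
        calc _ ≤ ∑ k : Fin (n + 1), ‖q (n - k) * odeCoeff q α β k‖ := norm_sum_le _ _
          _ ≤ ∑ _k : Fin (n + 1), C * K ^ n := by
            refine Finset.sum_le_sum fun k _ => ?_
            have hk : (k : ℕ) ≤ n := Nat.lt_succ_iff.1 k.2
            rw [norm_mul]
            calc _ ≤ (C * K ^ (n - k : ℕ)) * (1 * K ^ (k : ℕ)) := by
                  gcongr
                  · exact hq _
                  · exact ih k (by omega)
              _ = C * K ^ n := by
                  rw [one_mul, mul_assoc, ← pow_add, Nat.sub_add_cancel hk]
          _ = _ := by simp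
      have h2 : ‖((n : ℂ) + 2) * (n + 1)‖ = ((n : ℝ) + 2) * (n + 1) := by
        rw [norm_mul]
        congr 1
        · exact_mod_cast Complex.norm_natCast (n + 2)
        · exact_mod_cast Complex.norm_natCast (n + 1)
      rw [h2, div_le_iff₀ (by positivity)]
      refine h1.trans ?_
      have h3 : C * K ^ n ≤ K ^ (n + 2) := by
        rw [pow_add, mul_comm (K ^ n)]
        gcongr
      have h4 : 0 ≤ K ^ (n + 2) := by positivity
      calc ((n : ℝ) + 1) * (C * K ^ n) ≤ (n + 1) * K ^ (n + 2) := by gcongr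
        _ ≤ (n + 2) * ((n + 1) * K ^ (n + 2)) :=
            le_mul_of_one_le_left (by positivity) (by linarith [n.cast_nonneg (α := ℝ)])
        _ = _ := by ring

/-- The equation is solved by a power series at `z₀` for the initial data `(1, 0)` and `(0, 1)`; the
constant Wronskian is computed at `z₀`. -/
theorem exists_isFundamental_of_analyticAt {q : ℂ → ℂ} {z₀ : ℂ} (hq : AnalyticAt ℂ q z₀) :
    ∃ U, IsOpen U ∧ z₀ ∈ U ∧ ∃ y₁ y₂, IsFundamental complexFrame (-I) q U y₁ y₂ := by
  obtain ⟨p, hp⟩ := hq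
  obtain ⟨C, r, hC, hr, hCr⟩ := p.le_mul_pow_of_radius_pos hp.radius_pos
  obtain ⟨ρ, hρ, hsum⟩ := Metric.eventually_nhds_iff_ball.1 (hasFPowerSeriesAt_iff.1 hp)
  set K : ℝ := max 1 (max r C) with hKdef
  have hK1 : 1 ≤ K := le_max_left _ _
  have hK0 : 0 < K := by linarith
  have hb : ∀ n, ‖p.coeff n‖ ≤ C * K ^ n := by
    intro n
    rw [← FormalMultilinearSeries.norm_apply_eq_norm_coef]
    refine (hCr n).trans ?_
    gcongr
    exact (le_max_left _ _).trans (le_max_right _ _)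
  have hCK : C ≤ K ^ 2 := by
    have : C ≤ K := (le_max_right _ _).trans (le_max_right _ _)
    nlinarith
  -- The coefficients of `y'` grow like `(2 K)^n`, since `n + 1 ≤ 2^n`. Differentiating a second
  -- time therefore requires radius `1 / (4 · 2 K)`.
  set R : ℝ := min ρ (8 * K)⁻¹ with hR
  have hR0 : 0 < R := lt_min hρ (by positivity)
  have hR4 : ∀ w : ℂ, ‖w‖ < R → ‖w‖ < (4 * K)⁻¹ := by
    intro w hw
    refine (hw.trans_le (min_le_right _ _)).trans_le ?_
    gcongr
    norm_num
  have sol : ∀ α β : ℂ, ‖α‖ ≤ 1 → ‖β‖ ≤ 1 → ∃ y : ℂ → ℂ, y z₀ = α ∧ deriv y z₀ = β ∧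
      DifferentiableOn ℂ y (Metric.ball z₀ R) ∧
      ∀ z ∈ Metric.ball z₀ R, deriv (deriv y) z = q z * y z := by
    intro α β hα hβ
    set a := odeCoeff p.coeff α β with ha
    have hab := norm_odeCoeff_le hb hK1 hCK hα hβ
    rw [← ha] at hab
    set a1 : ℕ → ℂ := fun n => (n + 1 : ℕ) * a (n + 1) with ha1
    have ha1b : ∀ n, ‖a1 n‖ ≤ K * (2 * K) ^ n := by
      intro n
      rw [ha1, norm_mul, Complex.norm_natCast]
      have h2 : ((n + 1 : ℕ) : ℝ) ≤ 2 ^ n := by exact_mod_cast Nat.lt_two_pow_self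
      calc ((n + 1 : ℕ) : ℝ) * ‖a (n + 1)‖ ≤ 2 ^ n * (1 * K ^ (n + 1)) := by
            gcongr
            exact hab _
        _ = _ := by ring
    have hd0 : ∀ w : ℂ, ‖w‖ < R →
        HasDerivAt (fun z => ∑' n, a n * z ^ n) (∑' n, a1 n * w ^ n) w :=
      fun w hw => hasDerivAt_tsum_pow hK0 hab (hR4 w hw)
    have hd1 : ∀ w : ℂ, ‖w‖ < R → HasDerivAt (fun z => ∑' n, a1 n * z ^ n)
        (∑' n, ((n + 1 : ℕ) * a1 (n + 1)) * w ^ n) w := fun w hw =>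
      hasDerivAt_tsum_pow (K := 2 * K) (by positivity) ha1b
        ((hw.trans_le (min_le_right _ _)).trans_le (by rw [← mul_assoc]; norm_num))
    set y : ℂ → ℂ := fun z => ∑' n, a n * (z - z₀) ^ n with hy
    have hnorm : ∀ z ∈ Metric.ball z₀ R, ‖z - z₀‖ < R := fun z hz => by
      rwa [mem_ball_iff_norm] at hz
    have hyd : ∀ z ∈ Metric.ball z₀ R, HasDerivAt y (∑' n, a1 n * (z - z₀) ^ n) z := fun z hz =>
      HasDerivAt.comp_sub_const z z₀ (hd0 (z - z₀) (hnorm z hz))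
    have h0 : z₀ ∈ Metric.ball z₀ R := Metric.mem_ball_self hR0
    have hzero : ∀ b : ℕ → ℂ, ∑' n, b n * (z₀ - z₀) ^ n = b 0 := by
      intro b
      rw [tsum_eq_single 0 (fun n hn => by simp [hn])]
      simp
    refine ⟨y, ?_, ?_, fun z hz => (hyd z hz).differentiableAt.differentiableWithinAt,
      fun z hz => ?_⟩
    · rw [hy]
      simp only [hzero]
      simp [ha, odeCoeff]
    · rw [(hyd z₀ h0).deriv, hzero]
      simp [ha1, ha, odeCoeff]
    · have h1 : deriv y =ᶠ[𝓝 z] fun z => ∑' n, a1 n * (z - z₀) ^ n := by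
        filter_upwards [Metric.isOpen_ball.mem_nhds hz] with w hw
        exact (hyd w hw).deriv
      rw [h1.deriv_eq, (HasDerivAt.comp_sub_const z z₀ (hd1 (z - z₀) (hnorm z hz))).deriv]
      set w := z - z₀ with hw
      have hwR : ‖w‖ < R := hnorm z hz
      have hKw : K * ‖w‖ < 1 := by
        have := hR4 w hwR
        have h3 : K * ‖w‖ < K * (4 * K)⁻¹ := by gcongr
        refine h3.trans_le ?_
        rw [mul_inv]
        field_simp
        norm_num
      have hgeom : ∀ (b : ℕ → ℂ) (B : ℝ), (∀ n, ‖b n‖ ≤ B * K ^ n) →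
          Summable fun n => ‖b n * w ^ n‖ := by
        intro b B hB
        refine Summable.of_nonneg_of_le (fun n => norm_nonneg _) (fun n => ?_)
          ((summable_geometric_of_lt_one (by positivity) hKw).mul_left B)
        rw [norm_mul, norm_pow, mul_pow, ← mul_assoc]
        gcongr
        exact hB n
      have hqs : q z = ∑' n, p.coeff n * w ^ n := by
        have h4 := hsum w (by
          rw [mem_ball_zero_iff]
          exact hwR.trans_le (min_le_left _ _))
        rw [hw, add_sub_cancel] at h4
        rw [← h4.tsum_eq]
        exact tsum_congr fun n => by rw [smul_eq_mul, mul_comm]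
      rw [hqs, hy]
      simp only
      -- The Cauchy product of the series of `q` and `y` reproduces the recursion for the
      -- coefficients; what remains is to reindex the finite sums.
      rw [← hw, tsum_mul_tsum_eq_tsum_sum_antidiagonal_of_summable_norm (hgeom _ _ hb)
        (hgeom _ _ hab)]
      refine tsum_congr fun n => ?_
      have h5 : (n + 1 : ℕ) * a1 (n + 1) = ∑ k : Fin (n + 1), p.coeff (n - k) * a k := by
        rw [ha1, ha]
        simp only [odeCoeff]
        push_cast
        have h6 : (n : ℂ) + 1 ≠ 0 := by exact_mod_cast Nat.succ_ne_zero n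
        have h7 : (n : ℂ) + 2 ≠ 0 := by exact_mod_cast Nat.succ_ne_zero (n + 1)
        field_simp
        ring
      rw [h5, Finset.sum_mul, Finset.Nat.sum_antidiagonal_eq_sum_range_succ_mk,
        ← Finset.sum_range_reflect, Finset.sum_range]
      refine Finset.sum_congr rfl fun k _ => ?_
      have hk : (k : ℕ) ≤ n := Nat.lt_succ_iff.1 k.2
      have h8 : n - (n + 1 - 1 - k) = (k : ℕ) := by omega
      simp only [h8]
      have h10 : n.succ - 1 - (k : ℕ) = n - k := by omega
      rw [h10]
      have h9 : w ^ n = w ^ (n - k : ℕ) * w ^ (k : ℕ) := by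
        rw [← pow_add, Nat.sub_add_cancel hk]
      rw [h9]
      ring
  obtain ⟨y₁, a1, b1, d1, e1⟩ := sol 1 0 (by simp) (by simp)
  obtain ⟨y₂, a2, b2, d2, e2⟩ := sol 0 1 (by simp) (by simp)
  have hB := Metric.isOpen_ball (x := z₀) (ε := R)
  have h0 : z₀ ∈ Metric.ball z₀ R := Metric.mem_ball_self hR0
  have w1 : ∀ {y : ℂ → ℂ}, DifferentiableOn ℂ y (Metric.ball z₀ R) →
      Set.EqOn (wirt complexFrame (-I) y) (deriv y) (Metric.ball z₀ R) :=
    fun hd z hz => wirt_complex (hd.differentiableAt (hB.mem_nhds hz))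
  have w2 : ∀ {y : ℂ → ℂ}, DifferentiableOn ℂ y (Metric.ball z₀ R) → ∀ z ∈ Metric.ball z₀ R,
      wirt complexFrame (-I) (wirt complexFrame (-I) y) z = deriv (deriv y) z := by
    intro y hd z hz
    rw [wirt_eqOn hB (w1 hd) hz, w1 (hd.deriv hB) hz]
  have h1 := (holoOn_complex_iff hB).2 d1
  have h2 := (holoOn_complex_iff hB).2 d2
  have o1 : ∀ z ∈ Metric.ball z₀ R, wirt complexFrame (-I) (wirt complexFrame (-I) y₁) z =
      q z * y₁ z := fun z hz => by rw [w2 d1 z hz, e1 z hz]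
  have o2 : ∀ z ∈ Metric.ball z₀ R, wirt complexFrame (-I) (wirt complexFrame (-I) y₂) z =
      q z * y₂ z := fun z hz => by rw [w2 d2 z hz, e2 z hz]
  obtain ⟨c, hc⟩ := exists_const_wronsk span_complexFrame (neg_ne_zero.2 I_ne_zero) hB
    Metric.isPreconnected_ball h1 h2 o1 o2
  refine ⟨_, hB, h0, y₁, y₂, h1, h2, o1, o2, fun z hz => ?_⟩
  rw [hc z hz, ← hc z₀ h0, wronsk, w1 d1 h0, w1 d2 h0, a1, a2, b1, b2]
  simp

end Complex

section ComplexLift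

open Complex

variable {Ω : Set ℂ} {g y₁ y₂ : ℂ → ℂ} {z : ℂ}

/-! ### Lifts of meromorphic functions to pairs of holomorphic functions -/

/-- Two holomorphic functions with Wronskian `1` and different absolute values. -/
structure IsComplexSpinor (Ω : Set ℂ) (y₁ y₂ : ℂ → ℂ) : Prop where
  diff₁ : DifferentiableOn ℂ y₁ Ω
  diff₂ : DifferentiableOn ℂ y₂ Ω
  wronsk_eq : ∀ z ∈ Ω, y₁ z * deriv y₂ z - y₂ z * deriv y₁ z = 1
  normSq_ne : ∀ z ∈ Ω, normSq (y₁ z) ≠ normSq (y₂ z)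

/-- `g = y₂ / y₁`, with poles at the zeros of `y₁`. -/
structure IsComplexLift (Ω : Set ℂ) (g y₁ y₂ : ℂ → ℂ) : Prop extends
    IsComplexSpinor Ω y₁ y₂ where
  regular_iff : ∀ z ∈ Ω, AnalyticAt ℂ g z ↔ y₁ z ≠ 0
  mul_eq : ∀ z ∈ Ω, y₁ z ≠ 0 → g z * y₁ z = y₂ z

/-- The function is `1 / √k'`. Dividing by `k' z₀` first brings the argument of the principal root
near `1`, inside the slit plane. -/
theorem exists_sq_mul_deriv_eq_one {k : ℂ → ℂ} {z₀ : ℂ} (hk : AnalyticAt ℂ k z₀)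
    (hk' : deriv k z₀ ≠ 0) :
    ∃ r : ℂ → ℂ, AnalyticAt ℂ r z₀ ∧ ∀ᶠ z in 𝓝 z₀, r z ≠ 0 ∧ r z ^ 2 * deriv k z = 1 := by
  set c : ℂ := deriv k z₀ ^ ((2 : ℕ) : ℂ)⁻¹ with hc
  have hc2 : c ^ 2 = deriv k z₀ := cpow_nat_inv_pow _ two_ne_zero
  have hc0 : c ≠ 0 := fun h => hk' (by rw [← hc2, h]; ring)
  have hd : AnalyticAt ℂ (fun z => deriv k z / deriv k z₀) z₀ := hk.deriv.div_const
  set u : ℂ → ℂ := fun z => (deriv k z / deriv k z₀) ^ ((2 : ℕ) : ℂ)⁻¹ with hu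
  have hu2 : ∀ z, u z ^ 2 = deriv k z / deriv k z₀ := fun z => cpow_nat_inv_pow _ two_ne_zero
  have hua : AnalyticAt ℂ u z₀ :=
    hd.cpow analyticAt_const (by rw [div_self hk']; exact one_mem_slitPlane)
  have hu0 : u z₀ ≠ 0 := by
    intro h
    have := hu2 z₀
    rw [h, div_self hk'] at this
    simp at this
  refine ⟨fun z => (c * u z)⁻¹, (analyticAt_const.mul hua).inv (mul_ne_zero hc0 hu0), ?_⟩
  filter_upwards [hua.continuousAt.eventually_ne hu0] with z hz
  refine ⟨inv_ne_zero (mul_ne_zero hc0 hz), ?_⟩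
  have h1 : (c * u z) ^ 2 = deriv k z := by
    rw [mul_pow, hc2, hu2]
    field_simp
  rw [← h1]
  have := mul_ne_zero hc0 hz
  field_simp

theorem normSq_ne_of_quotient {w v g : ℂ} (hg : normSq g ≠ 1) (hw : w ≠ 0) (h : g * w = v) :
    normSq w ≠ normSq v := by
  rw [← h, normSq_mul]
  intro h1
  apply hg
  have := normSq_pos.2 hw
  field_simp at h1
  exact h1.symm

/-- At a regular point the lift is `y₁ = r`, `y₂ = g r` with `r² g' = 1`. At a simple pole `k = 1 /
g` extends holomorphically with `k' ≠ 0`, and with `r² k' = 1` the lift is `y₁ = i k r`, `y₂ = i r`;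
the factor `i` restores the Wronskian to `1` after the exchange of numerator and denominator. -/
theorem IsComplexDatum.exists_local_lift (hΩ : IsOpen Ω) (hg : IsComplexDatum Ω g)
    {z₀ : ℂ} (hz₀ : z₀ ∈ Ω) :
    ∃ U, IsOpen U ∧ z₀ ∈ U ∧ U ⊆ Ω ∧ ∃ y₁ y₂, IsComplexLift U g y₁ y₂ := by
  obtain ⟨hmer, hreg, hadm⟩ := hg
  have wr : ∀ {k r : ℂ → ℂ} {z : ℂ}, DifferentiableAt ℂ k z → DifferentiableAt ℂ r z →
      r z * deriv (fun w => k w * r w) z - k z * r z * deriv r z = r z ^ 2 * deriv k z := by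
    intro k r z hk hr
    rw [deriv_fun_mul hk hr]
    ring
  have wrI : ∀ {k r : ℂ → ℂ} {z : ℂ}, DifferentiableAt ℂ k z → DifferentiableAt ℂ r z →
      I * (k z * r z) * deriv (fun w => I * r w) z -
        I * r z * deriv (fun w => I * (k w * r w)) z = r z ^ 2 * deriv k z := by
    intro k r z hk hr
    rw [deriv_const_mul _ hr, deriv_const_mul _ (hk.fun_mul hr), deriv_fun_mul hk hr]
    linear_combination (-(r z ^ 2 * deriv k z)) * I_sq
  rcases hreg z₀ hz₀ with han | hord
  · obtain ⟨r, hr, hev⟩ := exists_sq_mul_deriv_eq_one han (normSq_pos.1 (hadm z₀ hz₀ han).2)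
    obtain ⟨U, hU, hUo, hzU⟩ := eventually_nhds_iff.1
      ((hev.and (hr.eventually_analyticAt.and han.eventually_analyticAt)).and (hΩ.eventually_mem hz₀))
    refine ⟨U, hUo, hzU, fun z hz => (hU z hz).2, r, fun z => g z * r z, ⟨⟨?_, ?_, ?_, ?_⟩, ?_, ?_⟩⟩
    · exact fun z hz => (hU z hz).1.2.1.differentiableAt.differentiableWithinAt
    · exact fun z hz => ((hU z hz).1.2.2.mul
        (hU z hz).1.2.1).differentiableAt.differentiableWithinAt
    · intro z hz
      rw [wr (hU z hz).1.2.2.differentiableAt (hU z hz).1.2.1.differentiableAt, (hU z hz).1.1.2]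
    · intro z hz
      exact normSq_ne_of_quotient (hadm z (hU z hz).2 (hU z hz).1.2.2).1 (hU z hz).1.1.1 rfl
    · exact fun z hz => ⟨fun _ => (hU z hz).1.1.1, fun _ => (hU z hz).1.2.2⟩
    · exact fun z hz _ => rfl
  · obtain ⟨h, hh, hh0, hgh⟩ := (meromorphicOrderAt_eq_int_iff (hmer z₀ hz₀)).1 hord
    set k : ℂ → ℂ := fun z => (z - z₀) / h z with hk
    have hka : AnalyticAt ℂ k z₀ := (analyticAt_id.sub analyticAt_const).div hh hh0
    -- The derivative at the pole is `1 / h z₀`.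
    have hk' : deriv k z₀ ≠ 0 := by
      have h1 : HasDerivAt k ((1 * h z₀ - (z₀ - z₀) * deriv h z₀) / h z₀ ^ 2) z₀ :=
        ((hasDerivAt_id z₀).sub_const z₀).div hh.differentiableAt.hasDerivAt hh0
      rw [h1.deriv]
      simp [hh0]
    obtain ⟨r, hr, hev⟩ := exists_sq_mul_deriv_eq_one hka hk'
    obtain ⟨U, hU, hUo, hzU⟩ := eventually_nhds_iff.1
      ((hev.and ((hr.eventually_analyticAt.and hka.eventually_analyticAt).and
        (hh.eventually_analyticAt.and (hh.continuousAt.eventually_ne hh0)))).and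
        ((hΩ.eventually_mem hz₀).and (eventually_nhdsWithin_iff.1 hgh)))
    have hr0 : ∀ z ∈ U, r z ≠ 0 := fun z hz => (hU z hz).1.1.1
    have hrd : ∀ z ∈ U, DifferentiableAt ℂ r z := fun z hz => (hU z hz).1.2.1.1.differentiableAt
    have hkd : ∀ z ∈ U, DifferentiableAt ℂ k z := fun z hz => (hU z hz).1.2.1.2.differentiableAt
    have hgk : ∀ z ∈ U, z ≠ z₀ → g z = h z / (z - z₀) := by
      intro z hz hne
      rw [(hU z hz).2.2 hne]
      simp [div_eq_inv_mul]
    have hgan : ∀ z ∈ U, z ≠ z₀ → AnalyticAt ℂ g z := by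
      intro z hz hne
      have h1 : AnalyticAt ℂ (fun w => h w / (w - z₀)) z :=
        (hU z hz).1.2.2.1.div (analyticAt_id.sub analyticAt_const) (sub_ne_zero.2 hne)
      refine h1.congr ?_
      filter_upwards [hUo.mem_nhds hz, isOpen_ne.mem_nhds hne] with w hw hwne
      exact (hgk w hw hwne).symm
    have hy0 : ∀ z ∈ U, I * (k z * r z) ≠ 0 ↔ z ≠ z₀ := by
      intro z hz
      have h1 := (hU z hz).1.2.2.2
      simp [hk, hr0 z hz, sub_eq_zero, h1]
    have hmul : ∀ z ∈ U, z ≠ z₀ → g z * (I * (k z * r z)) = I * r z := by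
      intro z hz hne
      rw [hgk z hz hne, hk]
      have h1 := (hU z hz).1.2.2.2
      have h2 := sub_ne_zero.2 hne
      field_simp
    refine ⟨U, hUo, hzU, fun z hz => (hU z hz).2.1, fun z => I * (k z * r z), fun z => I * r z,
      ⟨⟨?_, ?_, ?_, ?_⟩, ?_, ?_⟩⟩
    · exact fun z hz => (((hkd z hz).mul (hrd z hz)).const_mul I).differentiableWithinAt
    · exact fun z hz => ((hrd z hz).const_mul I).differentiableWithinAt
    · intro z hz
      rw [wrI (hkd z hz) (hrd z hz), (hU z hz).1.1.2]
    · intro z hz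
      by_cases hne : z = z₀
      · have h1 : k z = 0 := by simp [hk, hne]
        simp only [h1, zero_mul, mul_zero, map_zero]
        exact (normSq_pos.2 (mul_ne_zero I_ne_zero (hr0 z hz))).ne
      · exact normSq_ne_of_quotient (hadm z (hU z hz).2.1 (hgan z hz hne)).1
          ((hy0 z hz).2 hne) (hmul z hz hne)
    · intro z hz
      rw [hy0 z hz]
      refine ⟨fun han hne => ?_, hgan z hz⟩
      subst hne
      have := han.meromorphicOrderAt_nonneg
      rw [hord] at this
      exact absurd this (by decide)
    · exact fun z hz h0 => hmul z hz ((hy0 z hz).1 h0)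

/-! ### Consequences of the Wronskian condition. -/

theorem IsComplexSpinor.wronsk (hΩ : IsOpen Ω) (h : IsComplexSpinor Ω y₁ y₂) (hz : z ∈ Ω) :
    _root_.wronsk complexFrame (-I) y₁ y₂ z = 1 := by
  rw [_root_.wronsk, wirt_complex (h.diff₁.differentiableAt (hΩ.mem_nhds hz)),
    wirt_complex (h.diff₂.differentiableAt (hΩ.mem_nhds hz)), h.wronsk_eq z hz]

theorem IsComplexSpinor.exists_ne_zero (hΩ : IsOpen Ω) (h : IsComplexSpinor Ω y₁ y₂) {V : Set ℂ}
    (hV : IsOpen V) (hVΩ : V ⊆ Ω) (hne : V.Nonempty) : ∃ z ∈ V, y₁ z ≠ 0 :=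
  exists_ne_zero_of_wronsk (e := complexFrame) (s := -I) (y₂ := y₂) hV hne fun z hz => by
    rw [h.wronsk hΩ (hVΩ hz)]
    exact one_ne_zero

theorem IsComplexSpinor.ne_zero_or (h : IsComplexSpinor Ω y₁ y₂) (hz : z ∈ Ω) :
    y₁ z ≠ 0 ∨ y₂ z ≠ 0 := by
  by_contra! h0
  have := h.wronsk_eq z hz
  simp [h0.1, h0.2] at this

theorem IsComplexSpinor.hasDerivAt_div (hΩ : IsOpen Ω) (h : IsComplexSpinor Ω y₁ y₂)
    (hz : z ∈ Ω) (h0 : y₁ z ≠ 0) : HasDerivAt (fun z => y₂ z / y₁ z) (1 / y₁ z ^ 2) z := by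
  have h1 := (h.diff₂.differentiableAt (hΩ.mem_nhds hz)).hasDerivAt.div
    (h.diff₁.differentiableAt (hΩ.mem_nhds hz)).hasDerivAt h0
  refine h1.congr_deriv ?_
  rw [← h.wronsk_eq z hz]
  ring

theorem IsComplexLift.eventually_eq_div (hΩ : IsOpen Ω) (h : IsComplexLift Ω g y₁ y₂)
    (hz : z ∈ Ω) (h0 : y₁ z ≠ 0) : g =ᶠ[𝓝 z] fun z => y₂ z / y₁ z := by
  filter_upwards [hΩ.mem_nhds hz,
    (h.diff₁.differentiableAt (hΩ.mem_nhds hz)).continuousAt.eventually_ne h0] with w hw hw0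
  rw [eq_div_iff hw0, h.mul_eq w hw hw0]

theorem IsComplexLift.deriv_eq (hΩ : IsOpen Ω) (h : IsComplexLift Ω g y₁ y₂)
    (hz : z ∈ Ω) (h0 : y₁ z ≠ 0) : deriv g z = 1 / y₁ z ^ 2 := by
  rw [(h.eventually_eq_div hΩ hz h0).deriv_eq, (h.hasDerivAt_div hΩ hz h0).deriv]

/-- Local lifts are determined up to sign, because `y₁² = 1 / g'` and `y₂ = g y₁`. Hence all
products `yᵢ yⱼ` are determined by `g`, and the pairs glue. -/
theorem IsComplexDatum.exists_lift (hΩ : IsOpen Ω) (hsc : IsSimplyConnected Ω)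
    (hg : IsComplexDatum Ω g) : ∃ y₁ y₂, IsComplexLift Ω g y₁ y₂ := by
  have hloc : ∀ z : ℂ, ∃ U : Set ℂ, ∃ y₁ y₂ : ℂ → ℂ, z ∈ Ω →
      IsOpen U ∧ z ∈ U ∧ U ⊆ Ω ∧ IsComplexLift U g y₁ y₂ := by
    intro z
    by_cases hz : z ∈ Ω
    · obtain ⟨U, h1, h2, h3, y₁, y₂, h4⟩ := hg.exists_local_lift hΩ hz
      exact ⟨U, y₁, y₂, fun _ => ⟨h1, h2, h3, h4⟩⟩
    · exact ⟨∅, 0, 0, fun h => absurd h hz⟩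
  choose U Y₁ Y₂ hU using hloc
  have s11 : ∀ i ∈ Ω, ∀ j ∈ Ω, ∀ z ∈ Ω, z ∈ U i → z ∈ U j →
      Y₁ i z * Y₁ i z = Y₁ j z * Y₁ j z := by
    intro i hi j hj z _ hzi hzj
    obtain ⟨oi, -, -, li⟩ := hU i hi
    obtain ⟨oj, -, -, lj⟩ := hU j hj
    by_cases h0 : Y₁ i z = 0
    · have h0' : Y₁ j z = 0 := by
        by_contra hne
        exact (li.regular_iff z hzi).1 ((lj.regular_iff z hzj).2 hne) h0
      rw [h0, h0']
    · have h0' : Y₁ j z ≠ 0 := (lj.regular_iff z hzj).1 ((li.regular_iff z hzi).2 h0)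
      have h1 := li.deriv_eq oi hzi h0
      rw [lj.deriv_eq oj hzj h0'] at h1
      field_simp at h1
      linear_combination h1
  have s12 : ∀ i ∈ Ω, ∀ j ∈ Ω, ∀ z ∈ Ω, z ∈ U i → z ∈ U j →
      Y₁ i z * Y₂ i z = Y₁ j z * Y₂ j z := by
    intro i hi j hj z hz hzi hzj
    obtain ⟨oi, -, -, li⟩ := hU i hi
    obtain ⟨oj, -, -, lj⟩ := hU j hj
    have h11 := s11 i hi j hj z hz hzi hzj
    by_cases h0 : Y₁ i z = 0
    · have h0' : Y₁ j z = 0 := by simpa [h0] using h11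
      rw [h0, h0']
      ring
    · have h0' : Y₁ j z ≠ 0 := by
        intro h
        exact h0 (by simpa [h] using h11)
      rw [← li.mul_eq z hzi h0, ← lj.mul_eq z hzj h0']
      linear_combination g z * h11
  have s22 : ∀ i ∈ Ω, ∀ j ∈ Ω, ∀ z ∈ Ω, z ∈ U i → z ∈ U j →
      Y₂ i z * Y₂ i z = Y₂ j z * Y₂ j z := by
    intro i hi j hj z hz hzi hzj
    obtain ⟨oi, -, -, li⟩ := hU i hi
    obtain ⟨oj, -, -, lj⟩ := hU j hj
    by_contra hne
    have hcont : ContinuousAt (fun z => Y₂ i z * Y₂ i z - Y₂ j z * Y₂ j z) z := by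
      have ci := (li.diff₂.differentiableAt (oi.mem_nhds hzi)).continuousAt
      have cj := (lj.diff₂.differentiableAt (oj.mem_nhds hzj)).continuousAt
      exact (ci.mul ci).sub (cj.mul cj)
    -- At a pole `g` does not determine `Y₂`. A difference of the squares would persist on a
    -- neighbourhood, which contains a regular point.
    obtain ⟨V, hV, hVo, hzV⟩ := eventually_nhds_iff.1 ((hcont.eventually_ne (sub_ne_zero.2 hne)).and
      ((oi.eventually_mem hzi).and (oj.eventually_mem hzj)))
    obtain ⟨w, hw, hw0⟩ := li.exists_ne_zero oi hVo (fun w hw => (hV w hw).2.1) ⟨z, hzV⟩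
    obtain ⟨h1, h2, h3⟩ := hV w hw
    have hwΩ : w ∈ Ω := (hU i hi).2.2.1 h2
    apply h1
    have h11 := s11 i hi j hj w hwΩ h2 h3
    have hw0' : Y₁ j w ≠ 0 := by
      intro h
      exact hw0 (by simpa [h] using h11)
    rw [← li.mul_eq w h2 hw0, ← lj.mul_eq w h3 hw0']
    linear_combination g w ^ 2 * h11
  obtain ⟨y₁, y₂, hy⟩ := exists_glue_of_sq_eq hΩ hsc U (fun i hi => (hU i hi).1)
    (fun i hi => (hU i hi).2.1) Y₁ Y₂ (fun i hi => (hU i hi).2.2.2.diff₁.continuousOn)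
    (fun i hi => (hU i hi).2.2.2.diff₂.continuousOn)
    (fun i hi z hz => (hU i hi).2.2.2.ne_zero_or hz) s11 s12 s22
  have key : ∀ i ∈ Ω, ∃ c : ℂ, c ≠ 0 ∧ c ^ 2 = 1 ∧ (y₁ =ᶠ[𝓝 i] fun z => c * Y₁ i z) ∧
      y₂ =ᶠ[𝓝 i] fun z => c * Y₂ i z := by
    intro i hi
    obtain ⟨c, hc, hev⟩ := hy i hi
    exact ⟨c, fun h => by simp [h] at hc, hc, hev.mono fun _ h => h.1, hev.mono fun _ h => h.2⟩
  -- All six conditions are local, and near `i` the glued pair is `c` times the local lift with `c²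
  -- = 1`; each of them is invariant under this change.
  refine ⟨y₁, y₂, ⟨⟨fun i hi => ?_, fun i hi => ?_, fun i hi => ?_, fun i hi => ?_⟩,
    fun i hi => ?_, fun i hi => ?_⟩⟩ <;>
  · obtain ⟨c, hc0, hc, h1, h2⟩ := key i hi
    obtain ⟨oi, mi, -, li⟩ := hU i hi
    have d1 := li.diff₁.differentiableAt (oi.mem_nhds mi)
    have d2 := li.diff₂.differentiableAt (oi.mem_nhds mi)
    have hn : normSq c = 1 := by
      have := congrArg normSq hc
      rw [map_pow, map_one] at this
      exact (pow_eq_one_iff_of_nonneg (normSq_nonneg c) two_ne_zero).1 this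
    first
      | exact ((d1.const_mul c).congr_of_eventuallyEq h1).differentiableWithinAt
      | exact ((d2.const_mul c).congr_of_eventuallyEq h2).differentiableWithinAt
      | (rw [h1.deriv_eq, h2.deriv_eq, h1.eq_of_nhds, h2.eq_of_nhds, deriv_const_mul _ d1,
          deriv_const_mul _ d2]
         linear_combination c ^ 2 * li.wronsk_eq i mi + hc)
      | (rw [h1.eq_of_nhds, h2.eq_of_nhds, normSq_mul, normSq_mul, hn, one_mul, one_mul]
         exact li.normSq_ne i mi)
      | (rw [h1.eq_of_nhds, li.regular_iff i mi]
         simp [hc0])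
      | (rw [h1.eq_of_nhds, h2.eq_of_nhds]
         intro h0
         rw [← li.mul_eq i mi (right_ne_zero_of_mul h0)]
         ring)

/-- At a zero of `y₁` the Wronskian forces `y₂ ≠ 0` and `y₁' ≠ 0`, so the quotient has a simple pole
there. The value that division by zero assigns at the pole plays no role. -/
theorem IsComplexSpinor.isComplexDatum (hΩ : IsOpen Ω) (h : IsComplexSpinor Ω y₁ y₂) :
    IsComplexDatum Ω (fun z => y₂ z / y₁ z) ∧ IsComplexLift Ω (fun z => y₂ z / y₁ z) y₁ y₂ := by
  have a1 : ∀ z ∈ Ω, AnalyticAt ℂ y₁ z := fun z hz => h.diff₁.analyticAt (hΩ.mem_nhds hz)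
  have a2 : ∀ z ∈ Ω, AnalyticAt ℂ y₂ z := fun z hz => h.diff₂.analyticAt (hΩ.mem_nhds hz)
  have hpole : ∀ z ∈ Ω, y₁ z = 0 → meromorphicOrderAt (fun z => y₂ z / y₁ z) z = -1 := by
    intro z hz h0
    have hw := h.wronsk_eq z hz
    have h2 : y₂ z ≠ 0 := fun h2 => by simp [h0, h2] at hw
    have h1 : deriv y₁ z ≠ 0 := fun h1 => by simp [h0, h1] at hw
    change meromorphicOrderAt (y₂ / y₁) z = -1
    rw [meromorphicOrderAt_div (a2 z hz).meromorphicAt (a1 z hz).meromorphicAt,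
      (a2 z hz).meromorphicOrderAt_eq, (a1 z hz).meromorphicOrderAt_eq,
      (a1 z hz).analyticOrderAt_eq_one_of_zero_deriv_ne_zero h0 h1,
      (a2 z hz).analyticOrderAt_eq_zero.2 h2]
    rfl
  have hiff : ∀ z ∈ Ω, AnalyticAt ℂ (fun z => y₂ z / y₁ z) z ↔ y₁ z ≠ 0 := by
    intro z hz
    refine ⟨fun han h0 => ?_, fun h0 => (a2 z hz).div (a1 z hz) h0⟩
    have := han.meromorphicOrderAt_nonneg
    rw [hpole z hz h0] at this
    exact absurd this (by decide)
  refine ⟨⟨fun z hz => (a2 z hz).meromorphicAt.div (a1 z hz).meromorphicAt, fun z hz => ?_,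
    fun z hz han => ⟨?_, ?_⟩⟩, ⟨h, hiff, fun z hz h0 => div_mul_cancel₀ _ h0⟩⟩
  · by_cases h0 : y₁ z = 0
    · exact Or.inr (hpole z hz h0)
    · exact Or.inl ((hiff z hz).2 h0)
  · have h0 := (hiff z hz).1 han
    rw [normSq_div, Ne, div_eq_one_iff_eq (normSq_pos.2 h0).ne']
    exact (h.normSq_ne z hz).symm
  · have h0 := (hiff z hz).1 han
    rw [(h.hasDerivAt_div hΩ hz h0).deriv, normSq_pos]
    exact one_div_ne_zero (pow_ne_zero 2 h0)

/-! ### The representation formula in terms of a lift. -/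

theorem IsComplexLift.represents_iff (hΩ : IsOpen Ω) (h : IsComplexLift Ω g y₁ y₂)
    {lam : ℂ → ℝ} : ComplexRepresents Ω g lam ↔ ∀ z ∈ Ω, y₁ z ≠ 0 →
      Real.exp (lam z) = |normSq (y₁ z) - normSq (y₂ z)| / 2 := by
  have key : ∀ z ∈ Ω, y₁ z ≠ 0 → |1 - normSq (g z)| / (2 * √(normSq (deriv g z))) =
      |normSq (y₁ z) - normSq (y₂ z)| / 2 := by
    intro z hz h0
    have hp := normSq_pos.2 h0
    rw [h.deriv_eq hΩ hz h0, ← h.mul_eq z hz h0, normSq_div, map_one, map_pow, normSq_mul,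
      ← one_pow 2, ← div_pow, Real.sqrt_sq (by positivity), ← one_sub_mul, abs_mul,
      abs_of_pos hp]
    field_simp
  unfold ComplexRepresents
  constructor
  · intro hr z hz h0
    rw [hr z hz ((h.regular_iff z hz).2 h0), key z hz h0]
  · intro hr z hz han
    have h0 := (h.regular_iff z hz).1 han
    rw [hr z hz h0, key z hz h0]

/-- Both sides are continuous and the regular points are dense, so the identity extends across the
poles. -/
theorem IsComplexLift.represents_iff_of_continuousOn (hΩ : IsOpen Ω)
    (h : IsComplexLift Ω g y₁ y₂) {lam : ℂ → ℝ} (hlam : ContinuousOn lam Ω) :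
    ComplexRepresents Ω g lam ↔
      ∀ z ∈ Ω, Real.exp (lam z) = |normSq (y₁ z) - normSq (y₂ z)| / 2 := by
  rw [h.represents_iff hΩ]
  refine ⟨fun hr z hz => ?_, fun hr z hz _ => hr z hz⟩
  by_contra hne
  have c1 := (h.diff₁.differentiableAt (hΩ.mem_nhds hz)).continuousAt
  have c2 := (h.diff₂.differentiableAt (hΩ.mem_nhds hz)).continuousAt
  have hc : ContinuousAt (fun z => Real.exp (lam z) - |normSq (y₁ z) - normSq (y₂ z)| / 2) z :=
    (hlam.continuousAt (hΩ.mem_nhds hz)).rexp.sub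
      ((((continuous_normSq.continuousAt.comp c1).sub
        (continuous_normSq.continuousAt.comp c2)).abs).div_const 2)
  obtain ⟨V, hV, hVo, hzV⟩ := eventually_nhds_iff.1
    ((hc.eventually_ne (sub_ne_zero.2 hne)).and (hΩ.eventually_mem hz))
  obtain ⟨w, hw, hw0⟩ := h.exists_ne_zero hΩ hVo (fun w hw => (hV w hw).2) ⟨z, hzV⟩
  exact (hV w hw).1 (sub_eq_zero.2 (hr w (hV w hw).2 hw0))

end ComplexLift

section Bilinear

variable {E 𝕜 : Type*} [NormedAddCommGroup E] [NormedSpace ℝ E] [RCLike 𝕜]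
  {e : Fin 2 → E} {s : 𝕜} {Ω : Set E}

/-! ### Independence of solutions -/

/-- The relation and its derivative form a homogeneous linear system whose determinant is the
Wronskian. -/
theorem eq_zero_of_combination_eq_zero {w₁ w₂ : E → 𝕜} (hΩ : IsOpen Ω) (hne : Ω.Nonempty)
    (h1 : HoloOn e s Ω w₁) (h2 : HoloOn e s Ω w₂) (hw : ∀ z ∈ Ω, wronsk e s w₁ w₂ z ≠ 0)
    {a b : 𝕜} (h : ∀ z ∈ Ω, a * w₁ z + b * w₂ z = 0) : a = 0 ∧ b = 0 := by
  obtain ⟨z, hz⟩ := hne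
  have hd : a * wirt e s w₁ z + b * wirt e s w₂ z = 0 := by
    rw [← wirt_combination (h1.differentiableAt hΩ hz) (h2.differentiableAt hΩ hz),
      wirt_eqOn (g := fun _ => 0) hΩ h hz, wirt_const]
  have hz0 := h z hz
  have hw0 := hw z hz
  constructor
  · refine (mul_eq_zero.1 (?_ : a * wronsk e s w₁ w₂ z = 0)).resolve_right hw0
    unfold wronsk
    linear_combination wirt e s w₂ z * hz0 - w₂ z * hd
  · refine (mul_eq_zero.1 (?_ : b * wronsk e s w₁ w₂ z = 0)).resolve_right hw0
    unfold wronsk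
    linear_combination w₁ z * hd - wirt e s w₁ z * hz0

/-- The quantifier over `ψ` leaves freedom outside `Ω` and hides the embedding of `ℝ` into `𝕜`. -/
theorem exp_bilinear_iff {lam : E → ℝ} {ε : ℝ} (hε : ε ^ 2 = 1) (hs : s ^ 2 = -(ε : 𝕜))
    (hΩ : IsOpen Ω) :
    IsLiouvilleSolution ε e Ω lam ↔ ContDiffOn ℝ ∞ lam Ω ∧ ∀ ψ : E → 𝕜,
      (∀ z ∈ Ω, ψ z = (Real.exp (lam z) : ℝ)) → ∀ z ∈ Ω,
        ψ z * wirt e s (wirt e (-s) ψ) z - wirt e s ψ z * wirt e (-s) ψ z = -(ε : 𝕜) / 4 :=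
  ⟨fun h => ⟨h.1, fun _ hψ z hz => (laplaceBeltrami_eq_iff hε hs hΩ h.1 hz hψ).1 (h.2 z hz)⟩,
    fun h => ⟨h.1, fun z hz => (laplaceBeltrami_eq_iff hε hs hΩ h.1 hz fun _ _ => rfl).2
      (h.2 _ (fun _ _ => rfl) z hz)⟩⟩

end Bilinear

section ComplexLiouville

open Complex

variable {Ω : Set ℂ} {y₁ y₂ : ℂ → ℂ} {z : ℂ} {lam : ℂ → ℝ}

/-! ### Solutions of the Liouville equation in the complex case -/

/-- Conjugation exchanges the operators with parameters `s` and its conjugate. For `s = -I` these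
are `∂/∂z` and `∂/∂z̄`, so conjugated solutions can serve as the second pair in a separation. -/
theorem wronsk_conj {E : Type*} [NormedAddCommGroup E] [NormedSpace ℝ E] {e : Fin 2 → E}
    {f g : E → ℂ} {z : E} {s : ℂ} :
    wronsk e ((starRingEnd ℂ) s) (fun w => (starRingEnd ℂ) (f w)) (fun w => (starRingEnd ℂ) (g w)) z
      = (starRingEnd ℂ) (wronsk e s f g z) := by
  simp only [wronsk, wirt_conj, conj_conj, map_sub, map_mul]

theorem conj_negI_eq : (starRingEnd ℂ) (-I) = - -I := by simp

theorem conj_negI_neg_eq : (starRingEnd ℂ) (- -I) = -I := by simp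

theorem IsComplexSpinor.holo₁ (hΩ : IsOpen Ω) (h : IsComplexSpinor Ω y₁ y₂) :
    HoloOn complexFrame (-I) Ω y₁ := (holoOn_complex_iff hΩ).2 h.diff₁

theorem IsComplexSpinor.holo₂ (hΩ : IsOpen Ω) (h : IsComplexSpinor Ω y₁ y₂) :
    HoloOn complexFrame (-I) Ω y₂ := (holoOn_complex_iff hΩ).2 h.diff₂

theorem HoloOn.conj_I {f : ℂ → ℂ} (h : HoloOn complexFrame (-I) Ω f) :
    HoloOn complexFrame (- -I) Ω fun w => (starRingEnd ℂ) (f w) := by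
  have := h.conj
  rwa [conj_negI_eq] at this

theorem IsComplexSpinor.wronsk_conj (hΩ : IsOpen Ω) (h : IsComplexSpinor Ω y₁ y₂) (hz : z ∈ Ω) :
    _root_.wronsk complexFrame (- -I) (fun w => (starRingEnd ℂ) (y₁ w))
      (fun w => (starRingEnd ℂ) (y₂ w)) z = 1 := by
  rw [← conj_negI_eq, _root_.wronsk_conj, h.wronsk hΩ hz, map_one]

theorem IsComplexSpinor.contDiffOn_normSq_sub (hΩ : IsOpen Ω) (h : IsComplexSpinor Ω y₁ y₂) :
    ContDiffOn ℝ ∞ (fun z => normSq (y₁ z) - normSq (y₂ z)) Ω := by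
  have hn : ∀ {y : ℂ → ℂ}, HoloOn complexFrame (-I) Ω y →
      ContDiffOn ℝ ∞ (fun z => normSq (y z)) Ω := by
    intro y hy
    simp only [normSq_apply]
    have h1 : ContDiffOn ℝ ∞ (fun z => (y z).re) Ω := reCLM.contDiff.comp_contDiffOn hy.smooth
    have h2 : ContDiffOn ℝ ∞ (fun z => (y z).im) Ω := imCLM.contDiff.comp_contDiffOn hy.smooth
    exact (h1.mul h1).add (h2.mul h2)
  exact (hn (h.holo₁ hΩ)).sub (hn (h.holo₂ hΩ))

theorem IsComplexSpinor.exists_sign (hΩ : IsOpen Ω) (hc : IsPreconnected Ω)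
    (h : IsComplexSpinor Ω y₁ y₂) : ∃ δ : ℝ, δ ^ 2 = 1 ∧ ∀ z ∈ Ω,
      |normSq (y₁ z) - normSq (y₂ z)| = δ * (normSq (y₁ z) - normSq (y₂ z)) :=
  abs_eq_const_mul_of_ne_zero hc (h.contDiffOn_normSq_sub hΩ).continuousOn
    fun z hz => sub_ne_zero.2 (h.normSq_ne z hz)

/-- With `δ` the constant sign of `‖y₁‖² - ‖y₂‖²`, the function `e^lam` is separated by `(y₁, y₂)`
and `(δ ȳ₁ / 2, -δ ȳ₂ / 2)`, whose Wronskians are `1` and `-δ² / 4 = -1 / 4`. -/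
theorem IsComplexSpinor.isLiouvilleSolution (hΩ : IsOpen Ω) (hc : IsPreconnected Ω)
    (h : IsComplexSpinor Ω y₁ y₂)
    (hlam : ∀ z ∈ Ω, Real.exp (lam z) = |normSq (y₁ z) - normSq (y₂ z)| / 2) :
    IsLiouvilleSolution 1 complexFrame Ω lam := by
  obtain ⟨δ, hδ, habs⟩ := h.exists_sign hΩ hc
  have hexp : ∀ z ∈ Ω, Real.exp (lam z) = δ / 2 * (normSq (y₁ z) - normSq (y₂ z)) := by
    intro z hz
    rw [hlam z hz, habs z hz]
    ring
  rw [exp_bilinear_iff (s := -I) (by norm_num) (by simp) hΩ]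
  constructor
  · have h1 : ContDiffOn ℝ ∞ (fun z => Real.log (δ / 2 * (normSq (y₁ z) - normSq (y₂ z)))) Ω := by
      refine (contDiffOn_const.mul (h.contDiffOn_normSq_sub hΩ)).log fun z hz => ?_
      rw [← hexp z hz]
      exact (Real.exp_pos _).ne'
    refine h1.congr fun z hz => ?_
    rw [← hexp z hz, Real.log_exp]
  · intro ψ hψ z hz
    have hw1 := ((h.holo₁ hΩ).conj_I).const_mul hΩ ((δ : ℂ) / 2)
    have hw2 := ((h.holo₂ hΩ).conj_I).const_mul hΩ (-(δ : ℂ) / 2)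
    rw [separated_bilinear hΩ (h.holo₁ hΩ) (h.holo₂ hΩ) hw1 hw2 ?_ hz, h.wronsk hΩ hz]
    · have d1 := ((h.holo₁ hΩ).conj_I).differentiableAt hΩ hz
      have d2 := ((h.holo₂ hΩ).conj_I).differentiableAt hΩ hz
      have hw := h.wronsk_conj hΩ hz
      unfold _root_.wronsk at hw ⊢
      rw [wirt_const_mul _ d1, wirt_const_mul _ d2]
      have hδ' : (δ : ℂ) ^ 2 = 1 := by exact_mod_cast hδ
      simp only [RCLike.ofReal_one]
      linear_combination (-(δ : ℂ) ^ 2 / 4) * hw - hδ' / 4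
    · intro z hz
      rw [hψ z hz, hexp z hz]
      have m1 := mul_conj (y₁ z)
      have m2 := mul_conj (y₂ z)
      simp only [coe_algebraMap]
      push_cast
      linear_combination (-(δ : ℂ) / 2) * m1 + (δ : ℂ) / 2 * m2

/-- Since `ψ` is real, the conjugates of the antiholomorphic factors solve the same linear equation
as the `yᵢ`, so they are constant combinations of these. A basis adapted to the `1`-jet of `ψ` at
one point makes the combinations diagonal, with entries `1 / 2` and `-1 / 2`. -/
theorem IsLiouvilleSolution.exists_complexSpinor (hΩ : IsOpen Ω) (hsc : IsSimplyConnected Ω)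
    (h : IsLiouvilleSolution 1 complexFrame Ω lam) : ∃ y₁ y₂, IsComplexSpinor Ω y₁ y₂ ∧
      ∀ z ∈ Ω, Real.exp (lam z) = |normSq (y₁ z) - normSq (y₂ z)| / 2 := by
  have hc : IsPreconnected Ω := hsc.isPathConnected.isConnected.isPreconnected
  have hI : -I ≠ 0 := neg_ne_zero.2 I_ne_zero
  rw [exp_bilinear_iff (s := -I) (by norm_num) (by simp) hΩ] at h
  obtain ⟨hsm, hκ⟩ := h
  set ψ : ℂ → ℂ := fun z => ((Real.exp (lam z) : ℝ) : ℂ) with hψdef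
  replace hκ := hκ ψ (fun _ _ => rfl)
  have hψs : ContDiffOn ℝ ∞ ψ Ω := contDiffOn_ofReal hsm.exp
  have hψ0 : ∀ z ∈ Ω, ψ z ≠ 0 := fun z _ => by simp [hψdef]
  set q : ℂ → ℂ := fun z => wirt complexFrame (-I) (wirt complexFrame (-I) ψ) z / ψ z with hq
  have hqh : HoloOn complexFrame (-I) Ω q := holoOn_potential hΩ hψs hψ0 hκ
  have hqψ : ∀ z ∈ Ω, wirt complexFrame (-I) (wirt complexFrame (-I) ψ) z = q z * ψ z :=
    fun z hz => (div_mul_cancel₀ _ (hψ0 z hz)).symm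
  have hconjψ : (fun w => (starRingEnd ℂ) (ψ w)) = ψ := by
    funext w
    exact conj_ofReal _
  have hconj1 : ∀ r : ℂ, ∀ z, wirt complexFrame r ψ z =
      (starRingEnd ℂ) (wirt complexFrame ((starRingEnd ℂ) r) ψ z) := by
    intro r z
    rw [← wirt_conj, hconjψ]
  obtain ⟨u₁, u₂, hu⟩ := exists_isFundamental span_complexFrame hI hΩ hsc (q := q)
    fun z hz => exists_isFundamental_of_analyticAt
      (((holoOn_complex_iff hΩ).1 hqh).analyticAt (hΩ.mem_nhds hz))
  obtain ⟨z₀, hz₀⟩ := hsc.nonempty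
  -- The initial values come from the desired identity `‖y₁‖² - ‖y₂‖² = 2 ψ` with `y₂ z₀ = 0`: its
  -- value gives `y₁ z₀ = √(2 ψ z₀)`, its `z`-derivative gives `y₁' = 2 p / s`, and the Wronskian
  -- gives `y₂' = 1 / s`.
  set s : ℝ := √(2 * Real.exp (lam z₀)) with hs
  have hs0 : 0 < s := Real.sqrt_pos.2 (by positivity)
  have hs0' : (s : ℂ) ≠ 0 := by exact_mod_cast hs0.ne'
  have hs2 : (s : ℂ) ^ 2 = 2 * ψ z₀ := by
    have : s ^ 2 = 2 * Real.exp (lam z₀) := Real.sq_sqrt (by positivity)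
    have h2 := congrArg (fun x : ℝ => (x : ℂ)) this
    simpa [hψdef] using h2
  set p : ℂ := wirt complexFrame (-I) ψ z₀ with hp
  set v₁ := wirt complexFrame (-I) u₁ z₀ with hv1
  set v₂ := wirt complexFrame (-I) u₂ z₀ with hv2
  have huw : u₁ z₀ * v₂ - u₂ z₀ * v₁ = 1 := hu.wronsk_eq z₀ hz₀
  have hy := hu.combination hΩ (α := s * v₂ - u₂ z₀ * (2 * p / s))
    (β := -(s * v₁ - u₁ z₀ * (2 * p / s))) (γ := -u₂ z₀ / s) (δ := u₁ z₀ / s) (by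
      field_simp
      linear_combination (s : ℂ) ^ 2 * huw)
  set y₁ : ℂ → ℂ := fun w => (s * v₂ - u₂ z₀ * (2 * p / s)) * u₁ w +
    -(s * v₁ - u₁ z₀ * (2 * p / s)) * u₂ w with hy₁
  set y₂ : ℂ → ℂ := fun w => (-u₂ z₀ / s) * u₁ w + (u₁ z₀ / s) * u₂ w with hy₂
  have e1 : y₁ z₀ = s := by
    rw [hy₁]
    linear_combination (s : ℂ) * huw
  have e2 : y₂ z₀ = 0 := by
    rw [hy₂]
    ring
  have d1 : wirt complexFrame (-I) y₁ z₀ = 2 * p / s := by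
    rw [hy₁, wirt_combination (hu.holo₁.differentiableAt hΩ hz₀)
      (hu.holo₂.differentiableAt hΩ hz₀), ← hv1, ← hv2]
    linear_combination (2 * p / s) * huw
  have d2 : wirt complexFrame (-I) y₂ z₀ = 1 / s := by
    rw [hy₂, wirt_combination (hu.holo₁.differentiableAt hΩ hz₀)
      (hu.holo₂.differentiableAt hΩ hz₀), ← hv1, ← hv2]
    linear_combination (1 / s) * huw
  clear_value y₁ y₂
  obtain ⟨hw1, hw2, hsep⟩ := exists_separated hΩ hψs hqψ hy.holo₁ hy.holo₂ hy.ode₁ hy.ode₂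
    hy.wronsk_eq
  set w₁ := wronsk complexFrame (-I) ψ y₂ with hw₁
  set w₂ := fun z => -wronsk complexFrame (-I) ψ y₁ z with hw₂
  -- The product of the two Wronskians is `-1 / 4` by the bilinear equation, and the first factor is
  -- `1`.
  have hww : ∀ z ∈ Ω, wronsk complexFrame (- -I) w₁ w₂ z = -1 / 4 := by
    intro z hz
    have := separated_bilinear hΩ hy.holo₁ hy.holo₂ hw1 hw2 hsep hz
    rw [hκ z hz, hy.wronsk_eq z hz, one_mul] at this
    rw [← this]
    simp
  have hode : ∀ z ∈ Ω, wirt complexFrame (- -I) (wirt complexFrame (- -I) ψ) z / ψ z =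
      (starRingEnd ℂ) (q z) := by
    intro z hz
    have h1 : wirt complexFrame (- -I) ψ = fun z =>
        (starRingEnd ℂ) (wirt complexFrame (-I) ψ z) := by
      funext z
      rw [hconj1, conj_negI_neg_eq]
    rw [h1, wirt_conj, conj_negI_neg_eq, hq, map_div₀]
    congr 1
    exact (congrFun hconjψ z).symm
  have hwode : ∀ z ∈ Ω,
      wirt complexFrame (- -I) (wirt complexFrame (- -I) w₁) z = (starRingEnd ℂ) (q z) * w₁ z ∧
      wirt complexFrame (- -I) (wirt complexFrame (- -I) w₂) z = (starRingEnd ℂ) (q z) * w₂ z := by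
    intro z hz
    have h1 := separated_ode hΩ hw1 hw2 hy.holo₁.neg_neg hy.holo₂.neg_neg
      (fun z hz => by rw [hsep z hz]; ring) hww hψ0 hz
    rwa [hode z hz] at h1
  have hconjw : ∀ w : ℂ → ℂ, HoloOn complexFrame (- -I) Ω w →
      (∀ z ∈ Ω, wirt complexFrame (- -I) (wirt complexFrame (- -I) w) z =
        (starRingEnd ℂ) (q z) * w z) →
      ∃ α β : ℂ, ∀ z ∈ Ω, (starRingEnd ℂ) (w z) = α * y₁ z + β * y₂ z := by
    intro w hw hwq
    have h1 := hw.conj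
    rw [conj_negI_neg_eq] at h1
    refine hy.exists_combination span_complexFrame hI hΩ hc h1 fun z hz => ?_
    have h2 : wirt complexFrame (-I) (fun w_1 => (starRingEnd ℂ) (w w_1)) = fun z =>
        (starRingEnd ℂ) (wirt complexFrame (- -I) w z) := by
      funext z
      rw [wirt_conj, conj_negI_eq]
    rw [h2, wirt_conj, conj_negI_eq, hwq z hz, map_mul, conj_conj]
  have hcomb : ∀ w : ℂ → ℂ, ∀ α β : ℂ,
      (∀ z ∈ Ω, (starRingEnd ℂ) (w z) = α * y₁ z + β * y₂ z) →
      (starRingEnd ℂ) (w z₀) = α * s ∧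
        (starRingEnd ℂ) (wirt complexFrame (- -I) w z₀) = α * (2 * p / s) + β * (1 / s) := by
    intro w α β hw
    constructor
    · rw [hw z₀ hz₀, e1, e2]
      ring
    · have h2 := wirt_eqOn (e := complexFrame) (s := -I) hΩ hw hz₀
      rw [wirt_combination (hy.holo₁.differentiableAt hΩ hz₀) (hy.holo₂.differentiableAt hΩ hz₀),
        d1, d2] at h2
      rw [← h2, wirt_conj, conj_negI_eq]
  have hψ12 : wirt complexFrame (- -I) (wirt complexFrame (-I) ψ) z₀ =
      wirt complexFrame (-I) (wirt complexFrame (- -I) ψ) z₀ :=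
    wirt_comm (hψs.contDiffAt (hΩ.mem_nhds hz₀))
  set pb : ℂ := wirt complexFrame (- -I) ψ z₀ with hpb
  have hpbp : (starRingEnd ℂ) pb = p := by
    rw [hpb, hconj1, conj_negI_neg_eq, conj_conj]
  have hψr : (starRingEnd ℂ) (ψ z₀) = ψ z₀ := congrFun hconjψ z₀
  have hsr : (starRingEnd ℂ) (s : ℂ) = s := conj_ofReal s
  have hκ0 := hκ z₀ hz₀
  rw [← hp, ← hpb] at hκ0
  set m : ℂ := wirt complexFrame (-I) (wirt complexFrame (- -I) ψ) z₀ with hm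
  have hκ1 : ψ z₀ * m = p * pb - 1 / 4 := by
    have : ((1 : ℝ) : ℂ) = 1 := ofReal_one
    simp only [RCLike.ofReal_one] at hκ0
    linear_combination hκ0
  have hψ00 := hψ0 z₀ hz₀
  -- The coefficients of the combinations are found from the values and first derivatives of `w₁`,
  -- `w₂` at `z₀`; this is the derivative. The mixed second derivative `m` of `ψ` is eliminated by
  -- the bilinear equation.
  have hD : ∀ {y : ℂ → ℂ}, HoloOn complexFrame (-I) Ω y →
      wirt complexFrame (- -I) (wronsk complexFrame (-I) ψ y) z₀ =
        pb * wirt complexFrame (-I) y z₀ - y z₀ * m := by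
    intro y hy
    have h3 : wirt complexFrame (- -I) y z₀ = 0 := hy.wirt_neg z₀ hz₀
    have h4 : wirt complexFrame (- -I) (wirt complexFrame (-I) y) z₀ = 0 :=
      (hy.wirt hΩ).wirt_neg z₀ hz₀
    rw [wirt_wronsk hΩ hψs hy.smooth hz₀, h3, h4, hψ12, ← hpb]
    ring
  obtain ⟨α₁, β₁, hc1⟩ := hconjw w₁ hw1 (fun z hz => (hwode z hz).1)
  obtain ⟨α₂, β₂, hc2⟩ := hconjw w₂ hw2 (fun z hz => (hwode z hz).2)
  obtain ⟨a1, b1⟩ := hcomb w₁ α₁ β₁ hc1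
  obtain ⟨a2, b2⟩ := hcomb w₂ α₂ β₂ hc2
  have hα1 : α₁ = 1 / 2 := by
    have h1 : w₁ z₀ = ψ z₀ / s := by
      rw [hw₁, wronsk, d2, e2]
      ring
    rw [h1, map_div₀, hψr, hsr] at a1
    field_simp at a1
    apply mul_left_cancel₀ hψ00
    linear_combination -a1 / 2 - α₁ / 2 * hs2
  have hβ1 : β₁ = 0 := by
    have h1 : wirt complexFrame (- -I) w₁ z₀ = pb / s := by
      rw [hw₁, hD hy.holo₂, d2, e2]
      ring
    rw [h1, map_div₀, hpbp, hsr, hα1] at b1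
    field_simp at b1
    linear_combination -b1
  have hα2 : α₂ = 0 := by
    have h1 : w₂ z₀ = 0 := by
      simp only [hw₂]
      rw [wronsk, d1, e1, ← hp]
      field_simp
      linear_combination p * hs2
    rw [h1, map_zero] at a2
    exact (mul_eq_zero.1 a2.symm).resolve_right hs0'
  have hβ2 : β₂ = -1 / 2 := by
    have h1 : wirt complexFrame (- -I) w₂ z₀ = -1 / (2 * s) := by
      rw [hw₂, wirt_neg, hD hy.holo₁, d1, e1]
      field_simp
      linear_combination 2 * m * hs2 + 4 * hκ1
    rw [h1, map_div₀, map_mul, hsr, map_neg, map_one, map_ofNat, hα2] at b2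
    field_simp at b2
    linear_combination -b2 / 2
  have hψN : ∀ z ∈ Ω, Real.exp (lam z) = (normSq (y₁ z) - normSq (y₂ z)) / 2 := by
    intro z hz
    have h1 : w₁ z = (starRingEnd ℂ) (y₁ z) / 2 := by
      have := congrArg (starRingEnd ℂ) (hc1 z hz)
      rw [conj_conj, hα1, hβ1] at this
      rw [this]
      simp [map_ofNat]
      ring
    have h2 : w₂ z = -(starRingEnd ℂ) (y₂ z) / 2 := by
      have := congrArg (starRingEnd ℂ) (hc2 z hz)
      rw [conj_conj, hα2, hβ2] at this
      rw [this]
      simp [map_ofNat]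
      ring
    have h3 := hsep z hz
    change ψ z = y₁ z * w₁ z + y₂ z * w₂ z at h3
    rw [h1, h2] at h3
    have h4 : ((Real.exp (lam z) : ℝ) : ℂ) = (((normSq (y₁ z) - normSq (y₂ z)) / 2 : ℝ) : ℂ) := by
      change ψ z = _
      rw [h3]
      push_cast
      rw [← mul_conj, ← mul_conj]
      ring
    exact_mod_cast h4
  have hpos : ∀ z ∈ Ω, 0 < normSq (y₁ z) - normSq (y₂ z) := by
    intro z hz
    have := Real.exp_pos (lam z)
    rw [hψN z hz] at this
    linarith
  have dh1 := (holoOn_complex_iff hΩ).1 hy.holo₁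
  have dh2 := (holoOn_complex_iff hΩ).1 hy.holo₂
  refine ⟨y₁, y₂, ⟨dh1, dh2, fun z hz => ?_, fun z hz => ?_⟩, fun z hz => ?_⟩
  · rw [← hy.wronsk_eq z hz, wronsk, wirt_complex (dh1.differentiableAt (hΩ.mem_nhds hz)),
      wirt_complex (dh2.differentiableAt (hΩ.mem_nhds hz))]
  · exact (sub_pos.1 (hpos z hz)).ne'
  · rw [hψN z hz, abs_of_pos (hpos z hz)]

end ComplexLiouville

section Uniqueness

variable {E 𝕜 : Type*} [NormedAddCommGroup E] [NormedSpace ℝ E] [RCLike 𝕜]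
  {e : Fin 2 → E} {s : 𝕜} {Ω : Set E}

/-! ### Uniqueness of the representation -/

/-- Two separated forms of the same function are related by a constant matrix. -/
theorem exists_matrix_of_separated_eq (he : Submodule.span ℝ (Set.range e) = ⊤) (hs : s ≠ 0)
    (hΩ : IsOpen Ω) (hc : IsPreconnected Ω) {ψ y₁ y₂ w₁ w₂ Y₁ Y₂ V₁ V₂ : E → 𝕜}
    (hy1 : HoloOn e s Ω y₁) (hy2 : HoloOn e s Ω y₂)
    (hw1 : HoloOn e (-s) Ω w₁) (hw2 : HoloOn e (-s) Ω w₂)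
    (hY1 : HoloOn e s Ω Y₁) (hY2 : HoloOn e s Ω Y₂)
    (hV1 : HoloOn e (-s) Ω V₁) (hV2 : HoloOn e (-s) Ω V₂)
    (hψ : ∀ z ∈ Ω, ψ z = y₁ z * w₁ z + y₂ z * w₂ z)
    (hΨ : ∀ z ∈ Ω, ψ z = Y₁ z * V₁ z + Y₂ z * V₂ z) (hψ0 : ∀ z ∈ Ω, ψ z ≠ 0)
    {c C : 𝕜} (hc0 : c ≠ 0) (hcy : ∀ z ∈ Ω, wronsk e s y₁ y₂ z = c)
    (hCY : ∀ z ∈ Ω, wronsk e s Y₁ Y₂ z = C) :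
    ∃ p q r t : 𝕜, ∀ z ∈ Ω, Y₁ z = p * y₁ z + q * y₂ z ∧ Y₂ z = r * y₁ z + t * y₂ z ∧
      w₁ z = p * V₁ z + r * V₂ z ∧ w₂ z = q * V₁ z + t * V₂ z := by
  -- Both pairs solve the equation whose potential is computed from the common function `ψ`.
  have ode := fun z hz => separated_ode hΩ hy1 hy2 hw1 hw2 hψ hcy hψ0 (z := z) hz
  have Ode := fun z hz => separated_ode hΩ hY1 hY2 hV1 hV2 hΨ hCY hψ0 (z := z) hz
  obtain ⟨p, q, hpq⟩ := exists_combination he hs hΩ hc hy1 hy2 hY1 hc0 hcy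
    (fun z hz => (ode z hz).1) (fun z hz => (ode z hz).2) (fun z hz => (Ode z hz).1)
  obtain ⟨r, t, hrt⟩ := exists_combination he hs hΩ hc hy1 hy2 hY2 hc0 hcy
    (fun z hz => (ode z hz).1) (fun z hz => (ode z hz).2) (fun z hz => (Ode z hz).2)
  refine ⟨p, q, r, t, fun z hz => ⟨hpq z hz, hrt z hz, ?_⟩⟩
  -- Writing `ψ` and its derivative in both separated forms gives two linear equations for `w₁`,
  -- `w₂`, with determinant `c`.
  have h1 := wirt_separated hΩ hy1 hy2 hw1 hw2 hψ hz
  rw [wirt_separated hΩ hY1 hY2 hV1 hV2 hΨ hz, wirt_eqOn hΩ hpq hz, wirt_eqOn hΩ hrt hz,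
    wirt_combination (hy1.differentiableAt hΩ hz) (hy2.differentiableAt hΩ hz),
    wirt_combination (hy1.differentiableAt hΩ hz) (hy2.differentiableAt hΩ hz)] at h1
  have h2 := hψ z hz
  rw [hΨ z hz, hpq z hz, hrt z hz] at h2
  have h3 := hcy z hz
  unfold wronsk at h3
  constructor
  · apply mul_left_cancel₀ hc0
    rw [← h3]
    linear_combination y₂ z * h1 - wirt e s y₂ z * h2
  · apply mul_left_cancel₀ hc0
    rw [← h3]
    linear_combination wirt e s y₁ z * h2 - y₁ z * h1

end Uniqueness

section ComplexTheorem

open Complex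

variable {Ω : Set ℂ} {g g₂ y₁ y₂ Y₁ Y₂ : ℂ → ℂ} {z : ℂ} {lam : ℂ → ℝ}

/-! ### The complex case -/

theorem IsComplexSpinor.normSq_sub_ofReal (δ : ℝ) : (((δ * (normSq (y₁ z) - normSq (y₂ z)) : ℝ)) : ℂ)
    = y₁ z * ((δ : ℂ) * (starRingEnd ℂ) (y₁ z)) + y₂ z * (-(δ : ℂ) * (starRingEnd ℂ) (y₂ z)) := by
  have m1 := mul_conj (y₁ z)
  have m2 := mul_conj (y₂ z)
  push_cast
  linear_combination (-(δ : ℂ)) * m1 + (δ : ℂ) * m2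

/-- The second factors are the conjugates of the first up to sign. Comparing the conjugated relation
for them with the inverse of `(p q; r t)` gives `p = η t̄` and `q = η r̄`, where `η` is the product
of the two signs; the determinant then reads `η (‖t‖² - ‖r‖²) = 1`. -/
theorem IsComplexSpinor.exists_combination (hΩ : IsOpen Ω) (hc : IsPreconnected Ω)
    (hne : Ω.Nonempty) (h : IsComplexSpinor Ω y₁ y₂) (H : IsComplexSpinor Ω Y₁ Y₂)
    (habs : ∀ z ∈ Ω, |normSq (y₁ z) - normSq (y₂ z)| = |normSq (Y₁ z) - normSq (Y₂ z)|) :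
    ∃ a b c : ℂ, c ≠ 0 ∧ (normSq a - normSq b = 1 ∨ normSq a - normSq b = -1) ∧
      ∀ z ∈ Ω, Y₁ z = c * (star a * y₁ z + star b * y₂ z) ∧ Y₂ z = c * (b * y₁ z + a * y₂ z) := by
  obtain ⟨δ, hδ, hδy⟩ := h.exists_sign hΩ hc
  obtain ⟨δ', hδ', hδY⟩ := H.exists_sign hΩ hc
  have hψ0 : ∀ z ∈ Ω, ((|normSq (y₁ z) - normSq (y₂ z)| : ℝ) : ℂ) ≠ 0 := fun z hz => by
    exact_mod_cast abs_ne_zero.2 (sub_ne_zero.2 (h.normSq_ne z hz))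
  obtain ⟨p, q, r, t, hM⟩ := exists_matrix_of_separated_eq span_complexFrame
    (neg_ne_zero.2 I_ne_zero) hΩ hc (h.holo₁ hΩ) (h.holo₂ hΩ)
    (((h.holo₁ hΩ).conj_I).const_mul hΩ (δ : ℂ)) (((h.holo₂ hΩ).conj_I).const_mul hΩ (-δ : ℂ))
    (H.holo₁ hΩ) (H.holo₂ hΩ)
    (((H.holo₁ hΩ).conj_I).const_mul hΩ (δ' : ℂ)) (((H.holo₂ hΩ).conj_I).const_mul hΩ (-δ' : ℂ))
    (fun z hz => by rw [hδy z hz, IsComplexSpinor.normSq_sub_ofReal])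
    (fun z hz => by rw [habs z hz, hδY z hz, IsComplexSpinor.normSq_sub_ofReal])
    hψ0 one_ne_zero (fun z hz => h.wronsk hΩ hz) (fun z hz => H.wronsk hΩ hz)
  have hdet : p * t - q * r = 1 := by
    obtain ⟨z, hz⟩ := hne
    have h1 := H.wronsk hΩ hz
    rw [_root_.wronsk, wirt_eqOn hΩ (fun z hz => (hM z hz).1) hz,
      wirt_eqOn hΩ (fun z hz => (hM z hz).2.1) hz, (hM z hz).1, (hM z hz).2.1] at h1
    have h2 := wronsk_combination (e := complexFrame) (s := -I)
      ((h.holo₁ hΩ).differentiableAt hΩ hz) ((h.holo₂ hΩ).differentiableAt hΩ hz) p q r t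
    rw [h.wronsk hΩ hz, mul_one] at h2
    rw [← h2]
    exact h1
  have hsq : ∀ {x : ℝ}, x ^ 2 = 1 → ((x : ℂ)) ^ 2 = 1 := fun hx => by exact_mod_cast hx
  have hcc : ∀ z ∈ Ω, (δ : ℂ) * y₁ z = δ' * ((starRingEnd ℂ) p * Y₁ z - (starRingEnd ℂ) r * Y₂ z) ∧
      (δ : ℂ) * y₂ z = -δ' * ((starRingEnd ℂ) q * Y₁ z - (starRingEnd ℂ) t * Y₂ z) := by
    intro z hz
    obtain ⟨-, -, h3, h4⟩ := hM z hz
    have h3' := congrArg (starRingEnd ℂ) h3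
    have h4' := congrArg (starRingEnd ℂ) h4
    simp only [map_add, map_mul, conj_conj, conj_ofReal, map_neg] at h3' h4'
    constructor
    · linear_combination h3'
    · linear_combination -h4'
  have hWY : ∀ z ∈ Ω, _root_.wronsk complexFrame (-I) Y₁ Y₂ z ≠ 0 := fun z hz => by
    rw [H.wronsk hΩ hz]
    exact one_ne_zero
  have ind := fun a b => eq_zero_of_combination_eq_zero hΩ hne (H.holo₁ hΩ) (H.holo₂ hΩ) hWY
    (a := a) (b := b)
  obtain ⟨hp, hr⟩ := ind (δ' * (starRingEnd ℂ) p - δ * t) (δ * q - δ' * (starRingEnd ℂ) r)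
    fun z hz => by
      obtain ⟨h1, h2, -⟩ := hM z hz
      linear_combination -(hcc z hz).1 - δ * t * h1 + δ * q * h2 - δ * y₁ z * hdet
  set η : ℝ := δ * δ' with hη
  have hη2 : (η : ℂ) ^ 2 = 1 := by
    rw [hη]
    push_cast
    rw [mul_pow, hsq hδ, hsq hδ', one_mul]
  have hpt : (starRingEnd ℂ) p = η * t := by
    rw [hη]
    push_cast
    linear_combination (δ' : ℂ) * hp - (starRingEnd ℂ) p * hsq hδ'
  have hqr : (starRingEnd ℂ) r = η * q := by
    rw [hη]
    push_cast
    linear_combination -(δ' : ℂ) * hr - (starRingEnd ℂ) r * hsq hδ'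
  have hpt' : p = η * (starRingEnd ℂ) t := by
    have := congrArg (starRingEnd ℂ) hpt
    rwa [conj_conj, map_mul, conj_ofReal] at this
  have hqr' : q = η * (starRingEnd ℂ) r := by
    rw [hqr]
    linear_combination (-q) * hη2
  have hN : η * (normSq t - normSq r) = 1 := by
    have m1 := mul_conj t
    have m2 := mul_conj r
    rw [hpt', hqr'] at hdet
    have : ((η * (normSq t - normSq r) : ℝ) : ℂ) = 1 := by
      push_cast
      linear_combination hdet - η * m1 + η * m2
    exact_mod_cast this
  have hη1 : η = 1 ∨ η = -1 := by
    exact sq_eq_one_iff.1 (by exact_mod_cast hη2)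
  rcases hη1 with h1 | h1
  · rw [h1] at hpt' hqr' hN
    refine ⟨t, r, 1, one_ne_zero, Or.inl (by linarith), fun z hz => ?_⟩
    obtain ⟨e1, e2, -⟩ := hM z hz
    rw [e1, e2, hpt', hqr']
    simp
  · rw [h1] at hpt' hqr' hN
    -- For `η = -1` the factor `c = I` turns the matrix into the required form: `I · conj (-I t) =
    -- -t̄ = p` and `I · (-I t) = t`.
    refine ⟨-I * t, -I * r, I, I_ne_zero, Or.inr ?_, fun z hz => ?_⟩
    · simp only [normSq_mul, normSq_neg, normSq_I]
      linarith
    · obtain ⟨e1, e2, -⟩ := hM z hz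
      rw [e1, e2, hpt', hqr']
      simp only [star_def, map_mul, map_neg, conj_I]
      push_cast
      constructor
      · linear_combination (-((starRingEnd ℂ) t * y₁ z + (starRingEnd ℂ) r * y₂ z)) * I_sq
      · linear_combination (r * y₁ z + t * y₂ z) * I_sq

theorem IsComplexLift.isComplexTransform (h : IsComplexLift Ω g y₁ y₂)
    (H : IsComplexLift Ω g₂ Y₁ Y₂) {a b c : ℂ} (hc : c ≠ 0)
    (hY : ∀ z ∈ Ω, Y₁ z = c * (star a * y₁ z + star b * y₂ z) ∧ Y₂ z = c * (b * y₁ z + a * y₂ z)) :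
    IsComplexTransform Ω a b g g₂ := by
  intro z hz hg hg2
  have h0 := (h.regular_iff z hz).1 hg
  have H0 := (H.regular_iff z hz).1 hg2
  obtain ⟨h1, h2⟩ := hY z hz
  have e1 := h.mul_eq z hz h0
  have e2 := H.mul_eq z hz H0
  have hY1 : Y₁ z = c * y₁ z * (star b * g z + star a) := by
    rw [h1, ← e1]
    ring
  have h3 : star b * g z + star a ≠ 0 := by
    intro h3
    rw [h3, mul_zero] at hY1
    exact H0 hY1
  refine ⟨h3, ?_⟩
  rw [eq_div_iff h3]
  apply mul_left_cancel₀ (mul_ne_zero hc h0)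
  rw [h2, ← e1] at e2
  linear_combination e2 - g₂ z * hY1

/-- The matrix multiplies the Wronskian and `‖y₁‖² - ‖y₂‖²` by `‖a‖² - ‖b‖²`. The unimodular factor
`c`, equal to `1` or `I`, corrects the Wronskian back to `1` without changing absolute values. -/
theorem IsComplexSpinor.combination (hΩ : IsOpen Ω) (h : IsComplexSpinor Ω y₁ y₂) {a b : ℂ}
    (hab : normSq a - normSq b = 1 ∨ normSq a - normSq b = -1) : ∃ c : ℂ, c ≠ 0 ∧
      IsComplexSpinor Ω (fun z => c * (star a * y₁ z + star b * y₂ z))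
        (fun z => c * (b * y₁ z + a * y₂ z)) ∧
      ∀ z, |normSq (c * (star a * y₁ z + star b * y₂ z)) - normSq (c * (b * y₁ z + a * y₂ z))| =
        |normSq (y₁ z) - normSq (y₂ z)| := by
  obtain ⟨c, hc0, hc, hcn⟩ : ∃ c : ℂ, c ≠ 0 ∧ c ^ 2 * ((normSq a - normSq b : ℝ) : ℂ) = 1 ∧
      normSq c = 1 := by
    rcases hab with h1 | h1
    · exact ⟨1, one_ne_zero, by simp [h1], by simp⟩
    · exact ⟨I, I_ne_zero, by simp [h1], by simp⟩
  have habs : |normSq a - normSq b| = 1 := by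
    rcases hab with h1 | h1 <;> simp [h1]
  have hN : ∀ z, |normSq (c * (star a * y₁ z + star b * y₂ z)) -
      normSq (c * (b * y₁ z + a * y₂ z))| = |normSq (y₁ z) - normSq (y₂ z)| := by
    intro z
    have : normSq (c * (star a * y₁ z + star b * y₂ z)) - normSq (c * (b * y₁ z + a * y₂ z)) =
        (normSq a - normSq b) * (normSq (y₁ z) - normSq (y₂ z)) := by
      rw [normSq_mul, normSq_mul, hcn]
      simp only [normSq_apply, star_def, add_re, add_im, mul_re, mul_im, conj_re, conj_im]
      ring
    rw [this, abs_mul, habs, one_mul]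
  refine ⟨c, hc0, ⟨?_, ?_, fun z hz => ?_, fun z hz => ?_⟩, hN⟩
  · exact ((h.diff₁.const_mul _).add (h.diff₂.const_mul _)).const_mul c
  · exact ((h.diff₁.const_mul _).add (h.diff₂.const_mul _)).const_mul c
  · have d1 := h.diff₁.differentiableAt (hΩ.mem_nhds hz)
    have d2 := h.diff₂.differentiableAt (hΩ.mem_nhds hz)
    have hd : ∀ α β : ℂ, deriv (fun z => c * (α * y₁ z + β * y₂ z)) z =
        c * (α * deriv y₁ z + β * deriv y₂ z) := by
      intro α β
      exact (((d1.hasDerivAt.const_mul α).add (d2.hasDerivAt.const_mul β)).const_mul c).deriv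
    rw [hd, hd]
    push_cast at hc
    rw [← mul_conj, ← mul_conj] at hc
    simp only [star_def]
    linear_combination c ^ 2 * (a * (starRingEnd ℂ) a - b * (starRingEnd ℂ) b) * h.wronsk_eq z hz + hc
  · have := hN z
    intro heq
    rw [heq, sub_self, abs_zero] at this
    exact h.normSq_ne z hz (sub_eq_zero.1 (abs_eq_zero.1 this.symm))

/-- By `‖b̄ g + ā‖² - ‖a g + b‖² = (‖a‖² - ‖b‖²)(1 - ‖g‖²)`, the sign of `‖a‖² - ‖b‖²` tells whether
the transformation preserves the sign of `1 - ‖g‖²`. -/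
theorem IsComplexTransform.normSq_sub_pos {a b : ℂ} (h : IsComplexTransform Ω a b g g₂)
    (hz : z ∈ Ω) (hg : AnalyticAt ℂ g z) (hg2 : AnalyticAt ℂ g₂ z)
    (hpos : 0 < (1 - normSq (g z)) * (1 - normSq (g₂ z))) : 0 < normSq a - normSq b := by
  obtain ⟨h0, h1⟩ := h z hz hg hg2
  have hp := normSq_pos.2 h0
  rw [h1, normSq_div] at hpos
  have hid : normSq (star b * g z + star a) - normSq (a * g z + b) =
      (normSq a - normSq b) * (1 - normSq (g z)) := by
    simp only [normSq_apply, star_def, add_re, add_im, mul_re, mul_im, conj_re, conj_im]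
    ring
  have h2 : (1 - normSq (g z)) * (1 - normSq (a * g z + b) / normSq (star b * g z + star a)) =
      (normSq a - normSq b) * ((1 - normSq (g z)) ^ 2 / normSq (star b * g z + star a)) := by
    generalize normSq (star b * g z + star a) = D at hp hid ⊢
    field_simp
    linear_combination (1 - normSq (g z)) * hid
  rw [h2] at hpos
  exact pos_of_mul_pos_left hpos (by positivity)

/-! ### Assembly of the complex case. -/

theorem IsComplexLift.exists_solution (hΩ : IsOpen Ω) (hc : IsPreconnected Ω)
    (h : IsComplexLift Ω g y₁ y₂) :
    ∃ lam, IsLiouvilleSolution 1 complexFrame Ω lam ∧ ComplexRepresents Ω g lam := by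
  have hexp : ∀ z ∈ Ω, Real.exp (Real.log (|normSq (y₁ z) - normSq (y₂ z)| / 2)) =
      |normSq (y₁ z) - normSq (y₂ z)| / 2 := fun z hz =>
    Real.exp_log (half_pos (abs_pos.2 (sub_ne_zero.2 (h.normSq_ne z hz))))
  exact ⟨_, h.toIsComplexSpinor.isLiouvilleSolution hΩ hc hexp,
    (h.represents_iff hΩ).2 fun z hz _ => hexp z hz⟩

theorem complex_representation (hΩ : IsOpen Ω) (hsc : IsSimplyConnected Ω) :
      (∀ g : ℂ → ℂ, IsComplexDatum Ω g →
        (∃ lam : ℂ → ℝ, IsLiouvilleSolution 1 complexFrame Ω lam ∧ ComplexRepresents Ω g lam) ∧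
        (∀ lam : ℂ → ℝ, ContinuousOn lam Ω → ComplexRepresents Ω g lam →
          IsLiouvilleSolution 1 complexFrame Ω lam)) ∧
      (∀ lam : ℂ → ℝ, IsLiouvilleSolution 1 complexFrame Ω lam →
        (∃ g : ℂ → ℂ, IsComplexDatum Ω g ∧ ComplexRepresents Ω g lam) ∧
        (∀ g : ℂ → ℂ, IsComplexDatum Ω g → ComplexRepresents Ω g lam →
          (∀ a b : ℂ, (Complex.normSq a - Complex.normSq b = 1 ∨
              Complex.normSq a - Complex.normSq b = -1) →
            ∃ g₂ : ℂ → ℂ, IsComplexDatum Ω g₂ ∧ ComplexRepresents Ω g₂ lam ∧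
              IsComplexTransform Ω a b g g₂) ∧
          (∀ g₂ : ℂ → ℂ, IsComplexDatum Ω g₂ → ComplexRepresents Ω g₂ lam →
            (∃ a b : ℂ, (Complex.normSq a - Complex.normSq b = 1 ∨
              Complex.normSq a - Complex.normSq b = -1) ∧ IsComplexTransform Ω a b g g₂) ∧
            ((∃ z ∈ Ω, AnalyticAt ℂ g z ∧ AnalyticAt ℂ g₂ z ∧
                0 < (1 - Complex.normSq (g z)) * (1 - Complex.normSq (g₂ z))) →
              ∃ a b : ℂ, Complex.normSq a - Complex.normSq b = 1 ∧
                IsComplexTransform Ω a b g g₂)))) := by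
  have hc : IsPreconnected Ω := hsc.isPathConnected.isConnected.isPreconnected
  refine ⟨fun g hg => ?_, fun lam hlam => ⟨?_, fun g hg hrep => ?_⟩⟩
  · obtain ⟨y₁, y₂, h⟩ := hg.exists_lift hΩ hsc
    refine ⟨h.exists_solution hΩ hc, fun lam hlam hrep => ?_⟩
    exact h.toIsComplexSpinor.isLiouvilleSolution hΩ hc
      ((h.represents_iff_of_continuousOn hΩ hlam).1 hrep)
  · obtain ⟨y₁, y₂, h, hexp⟩ := hlam.exists_complexSpinor hΩ hsc
    obtain ⟨hd, hl⟩ := h.isComplexDatum hΩ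
    exact ⟨_, hd, (hl.represents_iff hΩ).2 fun z hz _ => hexp z hz⟩
  · obtain ⟨y₁, y₂, h⟩ := hg.exists_lift hΩ hsc
    have hexp := (h.represents_iff_of_continuousOn hΩ hlam.1.continuousOn).1 hrep
    constructor
    · intro a b hab
      obtain ⟨c, hc0, hs, hN⟩ := h.toIsComplexSpinor.combination hΩ hab
      obtain ⟨hd, hl⟩ := hs.isComplexDatum hΩ
      exact ⟨_, hd, (hl.represents_iff hΩ).2 fun z hz _ => by rw [hN, hexp z hz],
        h.isComplexTransform hl hc0 fun z _ => ⟨rfl, rfl⟩⟩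
    · intro g₂ hg2 hrep2
      obtain ⟨Y₁, Y₂, H⟩ := hg2.exists_lift hΩ hsc
      have Hexp := (H.represents_iff_of_continuousOn hΩ hlam.1.continuousOn).1 hrep2
      obtain ⟨a, b, c, hc0, hab, hY⟩ := h.toIsComplexSpinor.exists_combination hΩ hc hsc.nonempty
        H.toIsComplexSpinor fun z hz => by linarith [hexp z hz, Hexp z hz]
      have ht := h.isComplexTransform H hc0 hY
      refine ⟨⟨a, b, hab, ht⟩, ?_⟩
      rintro ⟨z, hz, h1, h2, hpos⟩
      have := ht.normSq_sub_pos hz h1 h2 hpos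
      exact ⟨a, b, hab.resolve_right fun h => by linarith, ht⟩

end ComplexTheorem

namespace Paracomplex

variable {Ω : Set Paracomplex} {s : ℝ} {z c : Paracomplex}

/-! ### Null coordinates -/

/-- The null coordinates `x + s y`, `s = ±1`. -/
def coord (s : ℝ) : Paracomplex →L[ℝ] ℝ :=
  LinearMap.toContinuousLinearMap (QuadraticAlgebra.reₗ 1 0 + s • QuadraticAlgebra.imₗ 1 0)

theorem coord_apply (s : ℝ) (z : Paracomplex) : coord s z = z.re + s * z.im := rfl

/-- The null direction `1 + s τ`. -/
def dir (s : ℝ) : Paracomplex := 1 + s • tau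

@[simp] theorem re_dir : (dir s).re = 1 := by
  simp [dir, tau, QuadraticAlgebra.re_one]

@[simp] theorem im_dir : (dir s).im = s := by
  simp [dir, tau, QuadraticAlgebra.im_one]

theorem coord_dir (s t : ℝ) : coord s (dir t) = 1 + s * t := by
  rw [coord_apply, re_dir, im_dir]

theorem coord_one (s : ℝ) : coord s 1 = 1 := by
  simp [coord_apply, QuadraticAlgebra.re_one, QuadraticAlgebra.im_one]

theorem coord_tau (s : ℝ) : coord s tau = s := by
  simp [coord_apply, tau]

/-- The two null coordinates are ring homomorphisms and together an isomorphism onto `ℝ × ℝ`, so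
paracomplex identities are checked one coordinate at a time; conjugation exchanges the two. -/
theorem coord_mul (hs : s ^ 2 = 1) (z w : Paracomplex) :
    coord s (z * w) = coord s z * coord s w := by
  simp only [coord_apply, QuadraticAlgebra.re_mul, QuadraticAlgebra.im_mul]
  linear_combination (-(z.im * w.im)) * hs

theorem coord_star (s : ℝ) (z : Paracomplex) : coord s (star z) = coord (-s) z := by
  simp [coord_apply]

theorem norm_eq_coord_mul (z : Paracomplex) :
    QuadraticAlgebra.norm z = coord 1 z * coord (-1) z := by
  simp only [QuadraticAlgebra.norm_def, coord_apply]
  ring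

theorem coord_ext {z w : Paracomplex} (h : ∀ s : ℝ, s ^ 2 = 1 → coord s z = coord s w) :
    z = w := by
  have h1 := h 1 (by norm_num)
  have h2 := h (-1) (by norm_num)
  simp only [coord_apply] at h1 h2
  ext <;> linarith

theorem isUnit_iff_coord : IsUnit z ↔ ∀ s : ℝ, s ^ 2 = 1 → coord s z ≠ 0 := by
  rw [QuadraticAlgebra.isUnit_iff_norm_isUnit, isUnit_iff_ne_zero, norm_eq_coord_mul]
  constructor
  · intro h s hs
    rcases sq_eq_one_iff.1 hs with rfl | rfl
    · exact left_ne_zero_of_mul h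
    · exact right_ne_zero_of_mul h
  · exact fun h => mul_ne_zero (h 1 (by norm_num)) (h (-1) (by norm_num))

/-- The number with null coordinates `p` and `q`. -/
def ofCoords (p q : ℝ) : Paracomplex := ⟨(p + q) / 2, (p - q) / 2⟩

theorem coord_one_ofCoords (p q : ℝ) : coord 1 (ofCoords p q) = p := by
  simp only [coord_apply, ofCoords]
  ring

theorem coord_neg_one_ofCoords (p q : ℝ) : coord (-1) (ofCoords p q) = q := by
  simp only [coord_apply, ofCoords]
  ring

theorem eq_add_smul_dir (hs : s ^ 2 = 1) (z : Paracomplex) :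
    z = (coord s z / 2) • dir s + (coord (-s) z / 2) • dir (-s) := by
  ext
  · simp only [coord_apply, QuadraticAlgebra.re_add, QuadraticAlgebra.re_smul, re_dir, smul_eq_mul]
    ring
  · simp only [coord_apply, QuadraticAlgebra.im_add, QuadraticAlgebra.im_smul, im_dir, smul_eq_mul]
    linear_combination (-z.im) * hs

theorem span_frame : Submodule.span ℝ (Set.range frame) = ⊤ := by
  rw [eq_top_iff]
  intro z _
  have h : z = z.re • (1 : Paracomplex) + z.im • tau := by
    ext <;> simp [tau, QuadraticAlgebra.re_one, QuadraticAlgebra.im_one]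
  rw [h]
  exact Submodule.add_mem _
    (Submodule.smul_mem _ _ (Submodule.subset_span ⟨0, rfl⟩))
    (Submodule.smul_mem _ _ (Submodule.subset_span ⟨1, rfl⟩))

theorem wirt_frame (s : ℝ) (f : Paracomplex → ℝ) (z : Paracomplex) :
    wirt frame s f z = fderiv ℝ f z (dir s) / 2 := by
  rw [wirt, dir, map_add, map_smul, smul_eq_mul, div_eq_inv_mul]
  rfl

theorem fderiv_dir_eq_zero {f : Paracomplex → ℝ} (h : HoloOn frame s Ω f) (hz : z ∈ Ω) :
    fderiv ℝ f z (dir (-s)) = 0 := by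
  have := h.wirt_neg z hz
  rw [wirt_frame] at this
  linarith

theorem holoOn_comp_coord (hs : s ^ 2 = 1) {φ : ℝ → ℝ} (hφ : ContDiff ℝ ∞ φ) (c : Paracomplex)
    (Ω : Set Paracomplex) : HoloOn frame s Ω fun z => φ (coord s (z - c)) := by
  have hc : ContDiff ℝ ∞ fun z : Paracomplex => coord s (z - c) :=
    (coord s).contDiff.comp (contDiff_id.sub contDiff_const)
  refine ⟨(hφ.comp hc).contDiffOn, fun z _ => ?_⟩
  have h1 : HasFDerivAt (fun z : Paracomplex => coord s (z - c)) (coord s) z :=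
    (coord s).hasFDerivAt.comp z ((hasFDerivAt_id z).sub_const c)
  rw [wirt_comp (hφ.differentiable (by simp)).differentiableAt.hasDerivAt h1.differentiableAt,
    wirt_frame, h1.fderiv, coord_dir]
  linear_combination (-(deriv φ (coord s (z - c))) / 2) * hs

theorem wirt_coord_sub (hs : s ^ 2 = 1) (c z : Paracomplex) :
    wirt frame s (fun z => coord s (z - c)) z = 1 := by
  have h1 : HasFDerivAt (fun z : Paracomplex => coord s (z - c)) (coord s) z :=
    (coord s).hasFDerivAt.comp z ((hasFDerivAt_id z).sub_const c)
  rw [wirt_frame, h1.fderiv, coord_dir]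
  linarith

/-- The value of a function of one null coordinate depends on that coordinate only. -/
theorem eq_of_coord_eq {f : Paracomplex → ℝ} (hs : s ^ 2 = 1) (hΩ : IsOpen Ω)
    (hconv : Convex ℝ Ω) (h : HoloOn frame s Ω f) {z w : Paracomplex} (hz : z ∈ Ω) (hw : w ∈ Ω)
    (hzw : coord s z = coord s w) : f z = f w := by
  have hseg : ∀ t ∈ Set.Icc (0 : ℝ) 1, z + t • (w - z) ∈ Ω := by
    intro t ht
    have := hconv hz hw (sub_nonneg.2 ht.2) ht.1 (by ring)
    convert this using 1
    module
  have hd : ∀ t ∈ Set.Icc (0 : ℝ) 1, HasDerivAt (fun t : ℝ => f (z + t • (w - z))) 0 t := by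
    intro t ht
    have h1 : HasDerivAt (fun t : ℝ => z + t • (w - z)) (w - z) t := by
      simpa using ((hasDerivAt_id t).smul_const (w - z)).const_add z
    have h2 := ((h.differentiableAt hΩ (hseg t ht)).hasFDerivAt).comp_hasDerivAt t h1
    have h3 : fderiv ℝ f (z + t • (w - z)) (w - z) = 0 := by
      -- The segment from `z` to `w` is parallel to the null direction along which the derivative of
      -- `f` vanishes.
      have h4 : w - z = (coord (-s) (w - z) / 2) • dir (-s) := by
        conv_lhs => rw [eq_add_smul_dir hs (w - z)]
        rw [map_sub (coord s), hzw, sub_self, zero_div, zero_smul, zero_add]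
      have h5 := fderiv_dir_eq_zero h (hseg t ht)
      generalize fderiv ℝ f (z + t • (w - z)) = F at h5 ⊢
      rw [h4, map_smul, h5, smul_zero]
    rw [h3] at h2
    exact h2
  have h3 := constant_of_has_deriv_right_zero (f := fun t : ℝ => f (z + t • (w - z)))
    (fun t ht => (hd t ht).continuousAt.continuousWithinAt)
    (fun t ht => (hd t ⟨ht.1, ht.2.le⟩).hasDerivWithinAt) 1 (by simp)
  simpa using h3.symm

/-! ### Freezing the other coordinate -/

/-- The projection along `1 - s τ` to the line through `c` in the direction `1 + s τ`. -/
def freeze (s : ℝ) (c z : Paracomplex) : Paracomplex := c + (coord s (z - c) / 2) • dir s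

theorem freeze_self (s : ℝ) (c : Paracomplex) : freeze s c c = c := by
  simp [freeze]

theorem freeze_eq_of_coord_eq (s : ℝ) {c z : Paracomplex} (h : coord s z = coord s c) :
    freeze s c z = c := by
  simp [freeze, h]

theorem coord_freeze (hs : s ^ 2 = 1) (c z : Paracomplex) : coord s (freeze s c z) = coord s z := by
  rw [freeze, map_add, map_smul, coord_dir, map_sub, smul_eq_mul]
  linear_combination ((coord s z - coord s c) / 2) * hs

theorem coord_neg_freeze (hs : s ^ 2 = 1) (c z : Paracomplex) :
    coord (-s) (freeze s c z) = coord (-s) c := by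
  rw [freeze, map_add, map_smul, coord_dir, smul_eq_mul]
  linear_combination (-(coord s (z - c) / 2)) * hs

theorem contDiff_freeze (s : ℝ) (c : Paracomplex) : ContDiff ℝ ∞ (freeze s c) :=
  contDiff_const.add ((((coord s).contDiff.comp (contDiff_id.sub contDiff_const)).div_const 2).smul
    contDiff_const)

theorem hasFDerivAt_freeze (s : ℝ) (c z : Paracomplex) :
    HasFDerivAt (freeze s c) (((2 : ℝ)⁻¹ • coord s).smulRight (dir s)) z := by
  have h1 : HasFDerivAt (fun z : Paracomplex => (2 : ℝ)⁻¹ * coord s (z - c)) ((2 : ℝ)⁻¹ • coord s) z :=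
    ((coord s).hasFDerivAt.comp z ((hasFDerivAt_id z).sub_const c)).const_mul _
  have h2 := (h1.smul_const (dir s)).const_add c
  refine h2.congr_of_eventuallyEq (Eventually.of_forall fun w => ?_)
  simp only [freeze, div_eq_inv_mul]

theorem wirt_freeze (hs : s ^ 2 = 1) {f : Paracomplex → ℝ}
    (hf : DifferentiableAt ℝ f (freeze s c z)) :
    wirt frame s (fun w => f (freeze s c w)) z = wirt frame s f (freeze s c z) ∧
      wirt frame (-s) (fun w => f (freeze s c w)) z = 0 := by
  have h1 : fderiv ℝ (fun w => f (freeze s c w)) z = _ :=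
    (hf.hasFDerivAt.comp z (hasFDerivAt_freeze s c z)).fderiv
  simp only [wirt_frame, h1, ContinuousLinearMap.comp_apply, ContinuousLinearMap.smulRight_apply,
    map_smul, smul_eq_mul, _root_.smul_apply, coord_dir]
  constructor
  · linear_combination (fderiv ℝ f (freeze s c z) (dir s) / 4) * hs
  · linear_combination (-(fderiv ℝ f (freeze s c z) (dir s) / 4)) * hs

theorem isOpen_preimage_freeze (hΩ : IsOpen Ω) : IsOpen (freeze s c ⁻¹' Ω) :=
  hΩ.preimage (contDiff_freeze s c).continuous

/-- Restricting to a null line and extending constantly along the other null direction turns any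
smooth function into a function of one null coordinate. This replaces the solution of differential
equations and extension arguments. -/
theorem holoOn_freeze (hs : s ^ 2 = 1) (hΩ : IsOpen Ω) {f : Paracomplex → ℝ}
    (hf : ContDiffOn ℝ ∞ f Ω) :
    HoloOn frame s (freeze s c ⁻¹' Ω) fun w => f (freeze s c w) :=
  ⟨hf.comp (contDiff_freeze s c).contDiffOn fun _ h => h,
    fun _ hz => (wirt_freeze hs (hf.differentiableAt_of_isOpen hΩ hz)).2⟩

/-! ### Paraholomorphic functions in null coordinates -/

theorem coord_dz (hs : s ^ 2 = 1) {f : Paracomplex → Paracomplex} (hf : DifferentiableAt ℝ f z) :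
    coord s (dz f z) = wirt frame s (fun w => coord s (f w)) z ∧
      coord s (dzbar f z) = wirt frame (-s) (fun w => coord s (f w)) z := by
  have h1 : HasFDerivAt (fun w => coord s (f w)) ((coord s).comp (fderiv ℝ f z)) z :=
    (coord s).hasFDerivAt.comp z hf.hasFDerivAt
  simp only [dz, dzbar, wirt_frame, h1.fderiv, hf.lineDeriv_eq_fderiv, dir, map_smul, map_add,
    map_sub, coord_mul hs, coord_tau, ContinuousLinearMap.comp_apply, smul_eq_mul]
  constructor <;> ring

/-- In null coordinates the para-Cauchy-Riemann equations decouple: each coordinate of `f` depends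
only on the same coordinate of the argument. -/
theorem holomorphicAt_iff {f : Paracomplex → Paracomplex} :
    HolomorphicAt f z ↔ ∃ U, IsOpen U ∧ z ∈ U ∧
      ∀ s : ℝ, s ^ 2 = 1 → HoloOn frame s U fun w => coord s (f w) := by
  constructor
  · intro h
    obtain ⟨U, hU, hUo, hz⟩ := eventually_nhds_iff.1 h
    refine ⟨U, hUo, hz, fun s hs => ⟨fun w hw => ?_, fun w hw => ?_⟩⟩
    · exact ((coord s).contDiff.contDiffAt.comp w (hU w hw).1).contDiffWithinAt
    · rw [← (coord_dz hs ((hU w hw).1.differentiableAt (by simp))).2, (hU w hw).2, map_zero]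
  · rintro ⟨U, hU, hz, h⟩
    filter_upwards [hU.mem_nhds hz] with w hw
    have hd : ContDiffAt ℝ ∞ f w := by
      have h1 : ∀ s : ℝ, s ^ 2 = 1 → ContDiffAt ℝ ∞ (fun w => coord s (f w)) w :=
        fun s hs => (h s hs).smooth.contDiffAt (hU.mem_nhds hw)
      have h2 : f = fun w => (coord 1 (f w) / 2) • dir 1 + (coord (-1) (f w) / 2) • dir (-1) := by
        funext w
        exact eq_add_smul_dir (by norm_num) (f w)
      rw [h2]
      exact (((h1 1 (by norm_num)).div_const 2).smul contDiffAt_const).add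
        (((h1 (-1) (by norm_num)).div_const 2).smul contDiffAt_const)
    refine ⟨hd, coord_ext fun s hs => ?_⟩
    rw [(coord_dz hs (hd.differentiableAt (by simp))).2, (h s hs).wirt_neg w hw, map_zero]

theorem HolomorphicAt.eventually {f : Paracomplex → Paracomplex} (h : HolomorphicAt f z) :
    ∀ᶠ w in 𝓝 z, HolomorphicAt f w := eventually_eventually_nhds.2 h

theorem HolomorphicAt.differentiableAt {f : Paracomplex → Paracomplex} (h : HolomorphicAt f z) :
    DifferentiableAt ℝ f z := h.self_of_nhds.1.differentiableAt (by simp)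

end Paracomplex

namespace Paracomplex

variable {Ω : Set Paracomplex} {s σ : ℝ} {z : Paracomplex} {lam : Paracomplex → ℝ}
  {y₁ y₂ w₁ w₂ : Paracomplex → ℝ}

/-! ### Solutions of the Liouville equation in the paracomplex case -/

theorem wirt_wirt_freeze (hs : s ^ 2 = 1) (hΩ : IsOpen Ω) {f : Paracomplex → ℝ}
    (hf : ContDiffOn ℝ ∞ f Ω) {c : Paracomplex} (hz : freeze s c z ∈ Ω) :
    wirt frame s (wirt frame s fun w => f (freeze s c w)) z =
      wirt frame s (wirt frame s f) (freeze s c z) := by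
  rw [wirt_eqOn (g := fun w => wirt frame s f (freeze s c w)) (isOpen_preimage_freeze hΩ)
    (fun w hw => (wirt_freeze hs (hf.differentiableAt_of_isOpen hΩ hw)).1) hz,
    (wirt_freeze hs ((contDiffOn_wirt hΩ hf).differentiableAt_of_isOpen hΩ hz)).1]

/-- No differential equation has to be solved: `ψ` and `D'ψ` both satisfy `DDy = q y`, the second
because `q` is annihilated by `D'`. Freezing the other coordinate makes them functions of one
variable, and by the bilinear equation `ψ` and `4 D'ψ` have Wronskian `1`. -/
theorem exists_local_isFundamental (hs : s ^ 2 = 1) (hΩ : IsOpen Ω) {ψ : Paracomplex → ℝ}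
    (hψ : ContDiffOn ℝ ∞ ψ Ω) (hψ0 : ∀ z ∈ Ω, ψ z ≠ 0)
    (hκ : ∀ z ∈ Ω, ψ z * wirt frame s (wirt frame (-s) ψ) z -
      wirt frame s ψ z * wirt frame (-s) ψ z = 1 / 4) (hz : z ∈ Ω) :
    ∃ U, IsOpen U ∧ z ∈ U ∧ ∃ y₁ y₂, IsFundamental frame s
      (fun z => wirt frame s (wirt frame s ψ) z / ψ z) U y₁ y₂ := by
  obtain ⟨r, hr, hB⟩ := Metric.isOpen_iff.1 hΩ z hz
  set B := Metric.ball z r with hBdef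
  have hBo : IsOpen B := Metric.isOpen_ball
  have hq := holoOn_potential hΩ hψ hψ0 hκ
  set q := fun z => wirt frame s (wirt frame s ψ) z / ψ z with hqdef
  have hψB := hψ.mono hB
  have hD2 : ContDiffOn ℝ ∞ (wirt frame (-s) ψ) B := (contDiffOn_wirt hΩ hψ).mono hB
  -- The potential depends on one null coordinate only, so freezing does not change it.
  have hqf : ∀ w ∈ B, freeze s z w ∈ B → q (freeze s z w) = q w := fun w hw hw' =>
    eq_of_coord_eq hs hBo (convex_ball z r) (hq.mono hB) hw' hw (coord_freeze hs z w)
  have e1 : ∀ w ∈ Ω, wirt frame s (wirt frame s ψ) w = q w * ψ w := fun w hw =>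
    (div_mul_cancel₀ _ (hψ0 w hw)).symm
  have e2 : ∀ w ∈ Ω, wirt frame s (wirt frame s (wirt frame (-s) ψ)) w =
      q w * wirt frame (-s) ψ w := by
    intro w hw
    have h1 : Set.EqOn (wirt frame s (wirt frame (-s) ψ)) (wirt frame (-s) (wirt frame s ψ)) Ω :=
      fun x hx => wirt_comm (hψ.contDiffAt (hΩ.mem_nhds hx))
    rw [wirt_eqOn hΩ h1 hw,
      wirt_comm ((contDiffOn_wirt hΩ hψ).contDiffAt (hΩ.mem_nhds hw)), wirt_eqOn hΩ e1 hw,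
      wirt_mul (hq.differentiableAt hΩ hw) (hψ.differentiableAt_of_isOpen hΩ hw),
      hq.wirt_neg w hw, zero_mul, add_zero]
  have hUo : IsOpen (freeze s z ⁻¹' B) := isOpen_preimage_freeze hBo
  have g1 := (holoOn_freeze (c := z) hs hBo hψB).mono
    (Set.inter_subset_right : B ∩ freeze s z ⁻¹' B ⊆ _)
  have g2 := (holoOn_freeze (c := z) hs hBo hD2).mono
    (Set.inter_subset_right : B ∩ freeze s z ⁻¹' B ⊆ _)
  have hU := hBo.inter hUo
  refine ⟨B ∩ freeze s z ⁻¹' B, hU, ⟨Metric.mem_ball_self hr, ?_⟩,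
    fun w => ψ (freeze s z w), fun w => 4 * wirt frame (-s) ψ (freeze s z w),
    ⟨g1, g2.const_mul hU 4, fun w hw => ?_, fun w hw => ?_, fun w hw => ?_⟩⟩
  · rw [Set.mem_preimage, freeze_self]
    exact Metric.mem_ball_self hr
  · rw [wirt_wirt_freeze hs hBo hψB hw.2, e1 _ (hB hw.2), hqf w hw.1 hw.2]
  · rw [wirt_eqOn hU (fun x hx => wirt_const_mul 4 (g2.differentiableAt hU hx)) hw,
      wirt_const_mul 4 ((g2.wirt hU).differentiableAt hU hw), wirt_wirt_freeze hs hBo hD2 hw.2,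
      e2 _ (hB hw.2), hqf w hw.1 hw.2]
    ring
  · rw [wronsk, wirt_const_mul 4 (g2.differentiableAt hU hw),
      (wirt_freeze hs (hψB.differentiableAt_of_isOpen hBo hw.2)).1,
      (wirt_freeze hs (hD2.differentiableAt_of_isOpen hBo hw.2)).1]
    linear_combination 4 * hκ _ (hB hw.2)

/-- Two pairs of functions of one null coordinate each, with the same Wronskian `σ = ±1`, and
with a bilinear combination without zeros. -/
structure IsSpinor (Ω : Set Paracomplex) (σ : ℝ) (y₁ y₂ w₁ w₂ : Paracomplex → ℝ) : Prop where
  sq_eq : σ ^ 2 = 1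
  holo₁ : HoloOn frame 1 Ω y₁
  holo₂ : HoloOn frame 1 Ω y₂
  conj₁ : HoloOn frame (-1) Ω w₁
  conj₂ : HoloOn frame (-1) Ω w₂
  wronsk_eq : ∀ z ∈ Ω, wronsk frame 1 y₁ y₂ z = σ
  wronsk_conj_eq : ∀ z ∈ Ω, wronsk frame (-1) w₁ w₂ z = σ
  ne_zero : ∀ z ∈ Ω, y₁ z * w₁ z + y₂ z * w₂ z ≠ 0

theorem IsSpinor.sign_ne_zero (h : IsSpinor Ω σ y₁ y₂ w₁ w₂) : σ ≠ 0 := fun h0 => by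
  have := h.sq_eq
  simp [h0] at this

theorem IsSpinor.contDiffOn (h : IsSpinor Ω σ y₁ y₂ w₁ w₂) :
    ContDiffOn ℝ ∞ (fun z => y₁ z * w₁ z + y₂ z * w₂ z) Ω :=
  (h.holo₁.smooth.mul h.conj₁.smooth).add (h.holo₂.smooth.mul h.conj₂.smooth)

theorem IsSpinor.exists_sign (hc : IsPreconnected Ω) (h : IsSpinor Ω σ y₁ y₂ w₁ w₂) :
    ∃ δ : ℝ, δ ^ 2 = 1 ∧ ∀ z ∈ Ω,
      |y₁ z * w₁ z + y₂ z * w₂ z| = δ * (y₁ z * w₁ z + y₂ z * w₂ z) :=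
  abs_eq_const_mul_of_ne_zero hc h.contDiffOn.continuousOn h.ne_zero

/-- Both Wronskians equal `σ`, so the bilinear expression of `δ (y₁ w₁ + y₂ w₂) / 2` is `σ² δ² / 4 =
1 / 4`. -/
theorem IsSpinor.isLiouvilleSolution (hΩ : IsOpen Ω) (hc : IsPreconnected Ω)
    (h : IsSpinor Ω σ y₁ y₂ w₁ w₂)
    (hlam : ∀ z ∈ Ω, Real.exp (lam z) = |y₁ z * w₁ z + y₂ z * w₂ z| / 2) :
    IsLiouvilleSolution (-1) frame Ω lam := by
  obtain ⟨δ, hδ, habs⟩ := h.exists_sign hc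
  have hexp : ∀ z ∈ Ω, Real.exp (lam z) = δ / 2 * (y₁ z * w₁ z + y₂ z * w₂ z) := by
    intro z hz
    rw [hlam z hz, habs z hz]
    ring
  rw [exp_bilinear_iff (s := (1 : ℝ)) (by norm_num) (by simp) hΩ]
  constructor
  · have h1 : ContDiffOn ℝ ∞ (fun z => Real.log (δ / 2 * (y₁ z * w₁ z + y₂ z * w₂ z))) Ω := by
      refine (contDiffOn_const.mul h.contDiffOn).log fun z hz => ?_
      rw [← hexp z hz]
      exact (Real.exp_pos _).ne'
    refine h1.congr fun z hz => ?_
    rw [← hexp z hz, Real.log_exp]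
  · intro ψ hψ z hz
    rw [separated_bilinear hΩ h.holo₁ h.holo₂ (h.conj₁.const_mul hΩ (δ / 2))
      (h.conj₂.const_mul hΩ (δ / 2)) ?_ hz, h.wronsk_eq z hz]
    · have hw := h.wronsk_conj_eq z hz
      unfold wronsk at hw ⊢
      rw [wirt_const_mul _ (h.conj₁.differentiableAt hΩ hz),
        wirt_const_mul _ (h.conj₂.differentiableAt hΩ hz)]
      simp only [RCLike.ofReal_real_eq_id, id]
      linear_combination (σ * δ ^ 2 / 4) * hw + δ ^ 2 / 4 * h.sq_eq + hδ / 4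
    · intro z hz
      rw [hψ z hz, hexp z hz]
      simp only [RCLike.ofReal_real_eq_id, id]
      ring

/-- Unlike the complex case, the second pair is not tied to the first by conjugation, so no initial
values need adjusting; doubling it changes its Wronskian from `1 / 4` to `1`. -/
theorem exists_spinor_of_isLiouvilleSolution (hΩ : IsOpen Ω) (hsc : IsSimplyConnected Ω)
    (h : IsLiouvilleSolution (-1) frame Ω lam) : ∃ y₁ y₂ w₁ w₂, IsSpinor Ω 1 y₁ y₂ w₁ w₂ ∧
      ∀ z ∈ Ω, Real.exp (lam z) = |y₁ z * w₁ z + y₂ z * w₂ z| / 2 := by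
  rw [exp_bilinear_iff (s := (1 : ℝ)) (by norm_num) (by simp) hΩ] at h
  obtain ⟨hsm, hκ⟩ := h
  set ψ : Paracomplex → ℝ := fun z => Real.exp (lam z) with hψdef
  replace hκ := hκ ψ (fun _ _ => rfl)
  simp only [RCLike.ofReal_real_eq_id, id, neg_neg] at hκ
  have hψs : ContDiffOn ℝ ∞ ψ Ω := hsm.exp
  have hψ0 : ∀ z ∈ Ω, ψ z ≠ 0 := fun z _ => (Real.exp_pos _).ne'
  obtain ⟨y₁, y₂, hy⟩ := exists_isFundamental span_frame one_ne_zero hΩ hsc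
    fun z hz => exists_local_isFundamental (by norm_num) hΩ hψs hψ0 hκ hz
  obtain ⟨hw1, hw2, hsep⟩ := exists_separated hΩ hψs
    (fun z hz => (div_mul_cancel₀ _ (hψ0 z hz)).symm) hy.holo₁ hy.holo₂ hy.ode₁ hy.ode₂
    hy.wronsk_eq
  set v₁ := wronsk frame 1 ψ y₂ with hv₁
  set v₂ := fun z => -wronsk frame 1 ψ y₁ z with hv₂
  have hN : ∀ z ∈ Ω, y₁ z * (2 * v₁ z) + y₂ z * (2 * v₂ z) = 2 * ψ z := by
    intro z hz
    rw [hsep z hz]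
    ring
  refine ⟨y₁, y₂, fun z => 2 * v₁ z, fun z => 2 * v₂ z, ⟨by norm_num, hy.holo₁, hy.holo₂,
    hw1.const_mul hΩ 2, hw2.const_mul hΩ 2, hy.wronsk_eq, fun z hz => ?_, fun z hz => ?_⟩,
    fun z hz => ?_⟩
  · have := separated_bilinear hΩ hy.holo₁ hy.holo₂ hw1 hw2 hsep hz
    rw [hκ z hz, hy.wronsk_eq z hz, one_mul] at this
    unfold wronsk at this ⊢
    rw [wirt_const_mul _ (hw1.differentiableAt hΩ hz), wirt_const_mul _ (hw2.differentiableAt hΩ hz)]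
    linear_combination -4 * this
  · rw [hN z hz]
    exact mul_ne_zero two_ne_zero (hψ0 z hz)
  · rw [hN z hz, abs_of_pos (mul_pos two_pos (Real.exp_pos _))]
    ring

end Paracomplex

section Hadamard

open MeasureTheory

/-! ### Hadamard's lemma -/

/-- A bump function extends the germ to the whole line. -/
theorem exists_contDiff_eventuallyEq {f : ℝ → ℝ} {U : Set ℝ} (hU : IsOpen U) (h0 : (0 : ℝ) ∈ U)
    (hf : ContDiffOn ℝ ∞ f U) : ∃ F : ℝ → ℝ, ContDiff ℝ ∞ F ∧ F =ᶠ[𝓝 0] f := by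
  obtain ⟨r, hr, hB⟩ := Metric.isOpen_iff.1 hU 0 h0
  let χ : ContDiffBump (0 : ℝ) := ⟨r / 4, r / 2, by positivity, by linarith⟩
  refine ⟨fun t => χ t * f t, ?_, ?_⟩
  · rw [contDiff_iff_contDiffAt]
    intro t
    by_cases ht : t ∈ U
    · exact χ.contDiff.contDiffAt.mul (hf.contDiffAt (hU.mem_nhds ht))
    · have h1 : t ∉ tsupport χ := by
        rw [χ.tsupport_eq]
        intro h
        exact ht (hB (Metric.closedBall_subset_ball (by change r / 2 < r; linarith) h))
      have h2 : (fun t => χ t * f t) =ᶠ[𝓝 t] fun _ => 0 := by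
        filter_upwards [notMem_tsupport_iff_eventuallyEq.1 h1] with x hx
        rw [hx]
        exact zero_mul _
      exact contDiffAt_const.congr_of_eventuallyEq h2
  · filter_upwards [χ.eventuallyEq_one] with t ht
    rw [ht]
    exact one_mul _

/-- The quotient is `m t = ∫₀¹ f'(x t) dx`. Its smoothness is obtained by writing it as a
convolution, at `0`, of the indicator of `(0, 1]` with the compactly supported `x ↦ χ(x) f'(-x t)`,
depending smoothly on the parameter `t`. -/
theorem exists_mul_eq_of_contDiff {f : ℝ → ℝ} (hf : ContDiff ℝ ∞ f) (h0 : f 0 = 0) :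
    ∃ m : ℝ → ℝ, ContDiff ℝ ∞ m ∧ ∀ t, f t = t * m t := by
  let χ : ContDiffBump (0 : ℝ) := ⟨1, 2, one_pos, one_lt_two⟩
  have hdf : ContDiff ℝ ∞ (deriv f) := (contDiff_infty_iff_deriv.1 hf).2
  let g : ℝ → ℝ → ℝ := fun p x => χ x * deriv f (-x * p)
  have hg : ContDiff ℝ ∞ (fun q : ℝ × ℝ => g q.1 q.2) :=
    (χ.contDiff.comp contDiff_snd).mul (hdf.comp (contDiff_snd.neg.mul contDiff_fst))
  have hind : LocallyIntegrable (Set.indicator (Set.Ioc (0 : ℝ) 1) fun _ => (1 : ℝ)) volume :=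
    ((integrable_indicator_iff measurableSet_Ioc).2 (by simp)).locallyIntegrable
  have hconv := contDiffOn_convolution_right_with_param_comp (𝕜 := ℝ) (μ := (volume : Measure ℝ))
    (n := ⊤) (ContinuousLinearMap.mul ℝ ℝ) (s := Set.univ) (v := fun _ : ℝ => (0 : ℝ)) (g := g)
    contDiffOn_const isOpen_univ (isCompact_closedBall (0 : ℝ) 2)
    (fun p x _ hx => by
      have : χ x = 0 := χ.zero_of_le_dist (by
        rw [Metric.mem_closedBall, not_le] at hx
        exact hx.le)
      simp only [g, this, zero_mul])
    hind hg.contDiffOn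
  rw [contDiffOn_univ] at hconv
  refine ⟨_, hconv, fun t => ?_⟩
  have h1 : (convolution (Set.indicator (Set.Ioc (0 : ℝ) 1) fun _ => (1 : ℝ)) (g t)
      (ContinuousLinearMap.mul ℝ ℝ) volume) 0 = ∫ x in (0 : ℝ)..1, deriv f (x * t) := by
    rw [convolution_def, intervalIntegral.integral_of_le zero_le_one,
      ← integral_indicator measurableSet_Ioc]
    refine integral_congr_ae (Eventually.of_forall fun x => ?_)
    by_cases hx : x ∈ Set.Ioc (0 : ℝ) 1
    · have : χ ((0 : ℝ) - x) = 1 := ContDiffBump.one_of_mem_closedBall χ (by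
        change dist (0 - x) 0 ≤ 1
        rw [Real.dist_eq, sub_zero, zero_sub, abs_neg, abs_of_pos hx.1]
        exact hx.2)
      simp only [g, Set.indicator_of_mem hx, ContinuousLinearMap.mul_apply', this, one_mul]
      congr 1
      ring
    · simp [Set.indicator_of_notMem hx]
  have h2 : ∫ x in (0 : ℝ)..1, t * deriv f (x * t) = f (1 * t) - f (0 * t) := by
    refine intervalIntegral.integral_eq_sub_of_hasDerivAt (f := fun x => f (x * t))
      (fun x _ => ?_) ?_
    · have h3 := (hf.differentiable (by simp)).differentiableAt (x := x * t) |>.hasDerivAt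
      have h4 : HasDerivAt (fun x : ℝ => x * t) t x := by simpa using (hasDerivAt_id x).mul_const t
      have h5 := h3.comp x h4
      rwa [mul_comm] at h5
    · exact (continuous_const.mul
        (hdf.continuous.comp (continuous_id.mul continuous_const))).intervalIntegrable _ _
  rw [h1, ← intervalIntegral.integral_const_mul, h2, one_mul, zero_mul, h0, sub_zero]

end Hadamard

/-! ### Division by a null coordinate. -/

namespace Paracomplex

variable {Ω : Set Paracomplex} {s σ : ℝ} {z : Paracomplex} {lam : Paracomplex → ℝ}
  {g : Paracomplex → Paracomplex} {y₁ y₂ w₁ w₂ : Paracomplex → ℝ}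

/-- Near `z` the function `y` is a function of the single real variable `coord s (w - z)`, and
Hadamard's lemma divides it by this variable. -/
theorem exists_coord_mul_eq (hs : s ^ 2 = 1) (hΩ : IsOpen Ω) {y : Paracomplex → ℝ}
    (hy : HoloOn frame s Ω y) (hz : z ∈ Ω) (h0 : y z = 0) :
    ∃ m, HoloOn frame s Set.univ m ∧ ∀ᶠ w in 𝓝 z, y w = coord s (w - z) * m w := by
  obtain ⟨r, hr, hB⟩ := Metric.isOpen_iff.1 hΩ z hz
  set B := Metric.ball z r with hBdef
  have hBo : IsOpen B := Metric.isOpen_ball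
  have hzB : z ∈ B := Metric.mem_ball_self hr
  have hγ : ContDiff ℝ ∞ fun t : ℝ => z + (t / 2) • dir s :=
    contDiff_const.add ((contDiff_id.div_const 2).smul contDiff_const)
  obtain ⟨F, hF, hFe⟩ := exists_contDiff_eventuallyEq (f := fun t : ℝ => y (z + (t / 2) • dir s))
    (hBo.preimage hγ.continuous) (by simpa using hzB)
    ((hy.mono hB).smooth.comp hγ.contDiffOn fun _ h => h)
  have hF0 : F 0 = 0 := by
    rw [hFe.self_of_nhds]
    simpa using h0
  obtain ⟨m, hm, hmF⟩ := exists_mul_eq_of_contDiff hF hF0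
  refine ⟨fun w => m (coord s (w - z)), holoOn_comp_coord hs hm z _, ?_⟩
  have hc : Tendsto (fun w => coord s (w - z)) (𝓝 z) (𝓝 0) := by
    have : ContinuousAt (fun w => coord s (w - z)) z := by fun_prop
    simpa [ContinuousAt] using this
  filter_upwards [hBo.mem_nhds hzB, hc.eventually hFe, (isOpen_preimage_freeze hBo).mem_nhds
    (show z ∈ freeze s z ⁻¹' B by rw [Set.mem_preimage, freeze_self]; exact hzB)] with w hw h1 h2
  rw [← hmF, h1]
  exact eq_of_coord_eq hs hBo (convex_ball z r) (hy.mono hB) hw h2 (coord_freeze hs z w).symm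

/-- If `y₁ z = 0`, then `y₁ = coord s (w - z) · m` with `m z` the derivative of `y₁`, nonzero by the
Wronskian; the numerator is `y₂ / m`. Otherwise it is the regular quotient times the coordinate, and
vanishes at `z`. -/
theorem exists_numerator (hs : s ^ 2 = 1) (hΩ : IsOpen Ω) (h1 : HoloOn frame s Ω y₁)
    (h2 : HoloOn frame s Ω y₂) (hz : z ∈ Ω) (hw : wronsk frame s y₁ y₂ z ≠ 0) :
    ∃ U k, IsOpen U ∧ z ∈ U ∧ HoloOn frame s U k ∧ (∀ w ∈ U, coord s (w - z) ≠ 0 →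
      y₂ w / y₁ w * coord s (w - z) = k w) ∧ (y₁ z = 0 → k z ≠ 0) := by
  by_cases h0 : y₁ z = 0
  · obtain ⟨m, hm, hev⟩ := exists_coord_mul_eq hs hΩ h1 hz h0
    have hd : wirt frame s y₁ z = m z := by
      have d1 : DifferentiableAt ℝ (fun w : Paracomplex => coord s (w - z)) z := by fun_prop
      rw [wirt_congr hev, wirt_mul d1 (hm.differentiableAt isOpen_univ trivial), wirt_coord_sub hs]
      simp
    have hm0 : m z ≠ 0 := by
      intro hm0
      apply hw
      rw [wronsk, h0, hd, hm0]
      ring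
    have hmc : ContinuousAt m z :=
      (hm.differentiableAt isOpen_univ trivial).continuousAt
    obtain ⟨U, hU, hUo, hzU⟩ := eventually_nhds_iff.1
      ((hΩ.eventually_mem hz).and (hev.and (hmc.eventually_ne hm0)))
    refine ⟨U, fun w => y₂ w / m w, hUo, hzU, (h2.mono fun w hw => (hU w hw).1).div hUo
      (hm.mono (Set.subset_univ _)) fun w hw => (hU w hw).2.2, fun w hw hne => ?_, fun _ => ?_⟩
    · rw [(hU w hw).2.1]
      have := (hU w hw).2.2
      field_simp
    · refine div_ne_zero (fun h => hw ?_) hm0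
      rw [wronsk, h0, h]
      ring
  · obtain ⟨U, hU, hUo, hzU⟩ := eventually_nhds_iff.1 ((hΩ.eventually_mem hz).and
      ((h1.differentiableAt hΩ hz).continuousAt.eventually_ne h0))
    have hsub : U ⊆ Ω := fun w hw => (hU w hw).1
    refine ⟨U, fun w => y₂ w / y₁ w * coord s (w - z), hUo, hzU, ?_, fun _ _ _ => rfl,
      fun h => absurd h h0⟩
    exact ((h2.mono hsub).div hUo (h1.mono hsub) fun w hw => (hU w hw).2).mul hUo
      (holoOn_comp_coord hs contDiff_id z U)

/-! ### Lifts of parameromorphic functions -/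

/-- `g` has the null coordinates `y₂ / y₁` and `w₂ / w₁`, and is regular where both are. -/
structure IsLift (Ω : Set Paracomplex) (g : Paracomplex → Paracomplex) (σ : ℝ)
    (y₁ y₂ w₁ w₂ : Paracomplex → ℝ) : Prop extends IsSpinor Ω σ y₁ y₂ w₁ w₂ where
  regular_iff : ∀ z ∈ Ω, HolomorphicAt g z ↔ y₁ z ≠ 0 ∧ w₁ z ≠ 0
  mul_eq : ∀ z ∈ Ω, HolomorphicAt g z → coord 1 (g z) * y₁ z = y₂ z
  conj_mul_eq : ∀ z ∈ Ω, HolomorphicAt g z → coord (-1) (g z) * w₁ z = w₂ z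

theorem IsSpinor.exists_ne_zero (h : IsSpinor Ω σ y₁ y₂ w₁ w₂) {V : Set Paracomplex}
    (hV : IsOpen V) (hVΩ : V ⊆ Ω) (hne : V.Nonempty) : ∃ z ∈ V, y₁ z ≠ 0 ∧ w₁ z ≠ 0 := by
  have hσ := h.sign_ne_zero
  obtain ⟨z, hz, hz0⟩ := exists_ne_zero_of_wronsk (e := frame) (s := (1 : ℝ)) (y₂ := y₂) hV hne
    fun z hz => by rw [h.wronsk_eq z (hVΩ hz)]; exact hσ
  have hV' : IsOpen (V ∩ {z | y₁ z ≠ 0}) :=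
    ((h.holo₁.mono hVΩ).smooth.continuousOn.isOpen_inter_preimage hV isOpen_ne)
  obtain ⟨z', hz', hz0'⟩ := exists_ne_zero_of_wronsk (e := frame) (s := (-1 : ℝ)) (y₂ := w₂)
    (y₁ := w₁) hV' ⟨z, hz, hz0⟩ fun z hz => by rw [h.wronsk_conj_eq z (hVΩ hz.1)]; exact hσ
  exact ⟨z', hz'.1, hz'.2, hz0'⟩

/-- Continuous functions that agree where `y₁ w₁ ≠ 0` agree. -/
theorem IsSpinor.eq_of_continuousAt (hΩ : IsOpen Ω) (h : IsSpinor Ω σ y₁ y₂ w₁ w₂) (hz : z ∈ Ω)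
    {F G : Paracomplex → ℝ} (hF : ContinuousAt F z) (hG : ContinuousAt G z)
    (hFG : ∀ᶠ w in 𝓝 z, y₁ w ≠ 0 → w₁ w ≠ 0 → F w = G w) : F z = G z := by
  by_contra hne
  obtain ⟨V, hV, hVo, hzV⟩ := eventually_nhds_iff.1 ((((hF.sub hG).eventually_ne
    (sub_ne_zero.2 hne)).and hFG).and (hΩ.eventually_mem hz))
  obtain ⟨w, hw, h1, h2⟩ := h.exists_ne_zero hVo (fun w hw => (hV w hw).2) ⟨z, hzV⟩
  exact (hV w hw).1.1 (sub_eq_zero.2 ((hV w hw).1.2 h1 h2))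

/-! ### Continuation across null lines. -/

/-- The points `w` at which `w - c` is invertible are dense. -/
theorem frequently_isUnit_sub (z c : Paracomplex) : ∃ᶠ w in 𝓝 z, IsUnit (w - c) := by
  have h1 : Tendsto (fun t : ℝ => z + t • (1 : Paracomplex)) (𝓝[≠] 0) (𝓝 z) := by
    have : ContinuousAt (fun t : ℝ => z + t • (1 : Paracomplex)) 0 := by fun_prop
    have h2 := this.tendsto
    simp only [zero_smul, add_zero] at h2
    exact h2.mono_left nhdsWithin_le_nhds
  have h3 : ∀ a : ℝ, ∀ᶠ t in 𝓝[≠] (0 : ℝ), t ≠ a := by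
    intro a
    by_cases ha : a = 0
    · rw [ha]
      exact self_mem_nhdsWithin
    · exact nhdsWithin_le_nhds (isOpen_ne.mem_nhds (Ne.symm ha))
  refine h1.frequently (Eventually.frequently ?_)
  filter_upwards [h3 (-coord 1 (z - c)), h3 (-coord (-1) (z - c))] with t ht1 ht2
  have h4 : ∀ s : ℝ, coord s (z + t • (1 : Paracomplex) - c) = t - -coord s (z - c) := by
    intro s
    simp only [map_sub, map_add, map_smul, coord_one, smul_eq_mul]
    ring
  rw [isUnit_iff_coord]
  intro s hs
  rw [h4]
  rcases sq_eq_one_iff.1 hs with rfl | rfl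
  · exact sub_ne_zero.2 ht1
  · exact sub_ne_zero.2 ht2

theorem eq_of_eventually_isUnit {F G : Paracomplex → ℝ} (hF : ContinuousAt F z)
    (hG : ContinuousAt G z) (c : Paracomplex)
    (hFG : ∀ᶠ w in 𝓝 z, IsUnit (w - c) → F w = G w) : F z = G z := by
  by_contra hne
  obtain ⟨w, h1, h2, h3⟩ := ((frequently_isUnit_sub z c).and_eventually
    (((hF.sub hG).eventually_ne (sub_ne_zero.2 hne)).and hFG)).exists
  exact h2 (sub_eq_zero.2 (h3 h1))

theorem HolomorphicAt.continuousAt_coord (h : HolomorphicAt g z) (s : ℝ) :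
    ContinuousAt (fun w => coord s (g w)) z :=
  (coord s).continuous.continuousAt.comp h.differentiableAt.continuousAt

/-- A function whose null coordinates are quotients of continuous functions near `z` has no pole
at `z`. -/
theorem not_hasSimplePoleAt_of_mul_eq {a b : ℝ → Paracomplex → ℝ}
    (ha : ∀ s : ℝ, s ^ 2 = 1 → ContinuousAt (a s) z) (hb : ∀ s : ℝ, s ^ 2 = 1 → ContinuousAt (b s) z)
    (h0 : ∀ s : ℝ, s ^ 2 = 1 → a s z ≠ 0)
    (hab : ∀ s : ℝ, s ^ 2 = 1 → ∀ᶠ w in 𝓝 z, IsUnit (w - z) → coord s (g w) * a s w = b s w) :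
    ¬ HasSimplePoleAt g z := by
  rintro ⟨h, hh, hh0, hgh⟩
  refine hh0 (coord_ext fun s hs => ?_)
  rw [map_zero]
  have h1 : coord s (h z) * a s z = b s z * coord s (z - z) := by
    have c1 : ContinuousAt (fun w => b s w * coord s (w - z)) z := (hb s hs).mul (by fun_prop)
    refine eq_of_eventually_isUnit (F := fun w => coord s (h w) * a s w)
      ((hh.continuousAt_coord s).mul (ha s hs)) c1 z ?_
    filter_upwards [hgh, hab s hs] with w h1 h2 hu
    rw [← h1 hu, coord_mul hs, ← h2 hu]
    ring
  rw [sub_self, map_zero, mul_zero] at h1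
  exact (mul_eq_zero.1 h1).resolve_right (h0 s hs)

/-- Off the two null lines through `z` the function is a quotient with invertible denominator. -/
theorem HasSimplePoleAt.eventually_holomorphicAt (h : HasSimplePoleAt g z) :
    ∀ᶠ w in 𝓝 z, IsUnit (w - z) → HolomorphicAt g w := by
  obtain ⟨h, hh, -, hgh⟩ := h
  obtain ⟨U, hU, hzU, hhU⟩ := holomorphicAt_iff.1 hh
  obtain ⟨V, hV, hVo, hzV⟩ := eventually_nhds_iff.1 ((hU.eventually_mem hzU).and hgh)
  filter_upwards [hVo.mem_nhds hzV] with w hw hu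
  have hopen : IsOpen (V ∩ {x | IsUnit (x - z)}) := by
    have : {x | IsUnit (x - z)} = {x | coord 1 (x - z) * coord (-1) (x - z) ≠ 0} := by
      ext x
      rw [Set.mem_ofPred_eq, QuadraticAlgebra.isUnit_iff_norm_isUnit, isUnit_iff_ne_zero,
        norm_eq_coord_mul]
      rfl
    rw [this]
    refine hVo.inter (isOpen_ne_fun (by fun_prop) continuous_const)
  refine holomorphicAt_iff.2 ⟨_, hopen, ⟨hw, hu⟩, fun s hs => ?_⟩
  have hsub : V ∩ {x | IsUnit (x - z)} ⊆ U := fun x hx => (hV x hx.1).1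
  refine (((hhU s hs).mono hsub).div hopen (holoOn_comp_coord hs contDiff_id z _)
    fun x hx => isUnit_iff_coord.1 hx.2 s hs).congr hopen fun x hx => ?_
  have h1 : coord s (x - z) ≠ 0 := isUnit_iff_coord.1 hx.2 s hs
  change coord s (g x) = coord s (h x) / coord s (x - z)
  rw [eq_div_iff h1, ← coord_mul hs, (hV x hx.1).2 hx.2]

/-! ### From spinors back to parameromorphic functions. -/

theorem IsLift.eventually_eq_div (hΩ : IsOpen Ω) (h : IsLift Ω g σ y₁ y₂ w₁ w₂) (hz : z ∈ Ω)
    (hg : HolomorphicAt g z) :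
    ((fun w => coord 1 (g w)) =ᶠ[𝓝 z] fun w => y₂ w / y₁ w) ∧
      (fun w => coord (-1) (g w)) =ᶠ[𝓝 z] fun w => w₂ w / w₁ w := by
  constructor
  · filter_upwards [hg.eventually, hΩ.mem_nhds hz] with w hw hwΩ
    rw [eq_div_iff ((h.regular_iff w hwΩ).1 hw).1, h.mul_eq w hwΩ hw]
  · filter_upwards [hg.eventually, hΩ.mem_nhds hz] with w hw hwΩ
    rw [eq_div_iff ((h.regular_iff w hwΩ).1 hw).2, h.conj_mul_eq w hwΩ hw]

theorem IsSpinor.wirt_div_eq (hΩ : IsOpen Ω) (h : IsSpinor Ω σ y₁ y₂ w₁ w₂) (hz : z ∈ Ω) :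
    (y₁ z ≠ 0 → wirt frame 1 (fun w => y₂ w / y₁ w) z = σ / y₁ z ^ 2) ∧
      (w₁ z ≠ 0 → wirt frame (-1) (fun w => w₂ w / w₁ w) z = σ / w₁ z ^ 2) := by
  constructor
  · intro h0
    rw [wirt_div (h.holo₂.differentiableAt hΩ hz) (h.holo₁.differentiableAt hΩ hz) h0,
      ← h.wronsk_eq z hz, wronsk]
    ring
  · intro h0
    rw [wirt_div (h.conj₂.differentiableAt hΩ hz) (h.conj₁.differentiableAt hΩ hz) h0,
      ← h.wronsk_conj_eq z hz, wronsk]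
    ring

theorem IsLift.coord_dz_eq (hΩ : IsOpen Ω) (h : IsLift Ω g σ y₁ y₂ w₁ w₂) (hz : z ∈ Ω)
    (hg : HolomorphicAt g z) :
    coord 1 (dz g z) = σ / y₁ z ^ 2 ∧ coord (-1) (dz g z) = σ / w₁ z ^ 2 := by
  obtain ⟨h1, h2⟩ := h.eventually_eq_div hΩ hz hg
  obtain ⟨n1, n2⟩ := (h.regular_iff z hz).1 hg
  rw [(coord_dz (by norm_num) hg.differentiableAt).1, (coord_dz (by norm_num) hg.differentiableAt).1,
    wirt_congr h1, wirt_congr h2]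
  exact ⟨(h.wirt_div_eq hΩ hz).1 n1, (h.wirt_div_eq hΩ hz).2 n2⟩

theorem IsLift.norm_eq (h : IsLift Ω g σ y₁ y₂ w₁ w₂) (hz : z ∈ Ω) (hg : HolomorphicAt g z) :
    1 + QuadraticAlgebra.norm (g z) = (y₁ z * w₁ z + y₂ z * w₂ z) / (y₁ z * w₁ z) := by
  obtain ⟨n1, n2⟩ := (h.regular_iff z hz).1 hg
  rw [norm_eq_coord_mul, ← h.mul_eq z hz hg, ← h.conj_mul_eq z hz hg]
  field_simp

theorem IsLift.norm_dz_eq (hΩ : IsOpen Ω) (h : IsLift Ω g σ y₁ y₂ w₁ w₂) (hz : z ∈ Ω)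
    (hg : HolomorphicAt g z) :
    QuadraticAlgebra.norm (dz g z) = (1 / (y₁ z * w₁ z)) ^ 2 := by
  obtain ⟨n1, n2⟩ := (h.regular_iff z hz).1 hg
  obtain ⟨h1, h2⟩ := h.coord_dz_eq hΩ hz hg
  rw [norm_eq_coord_mul, h1, h2, div_pow, one_pow, ← h.sq_eq]
  field_simp

/-- Each null coordinate is treated separately. Where just one of `y₁`, `w₁` vanishes there is still
a simple pole in the sense required: the numerator is a nonzero zero divisor. -/
theorem IsSpinor.isDatum (hΩ : IsOpen Ω) (h : IsSpinor Ω σ y₁ y₂ w₁ w₂) :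
    IsDatum Ω (fun z => ofCoords (y₂ z / y₁ z) (w₂ z / w₁ z)) ∧
      IsLift Ω (fun z => ofCoords (y₂ z / y₁ z) (w₂ z / w₁ z)) σ y₁ y₂ w₁ w₂ := by
  set g : Paracomplex → Paracomplex := fun z => ofCoords (y₂ z / y₁ z) (w₂ z / w₁ z) with hg
  have hg1 : ∀ z, coord 1 (g z) = y₂ z / y₁ z := fun z => coord_one_ofCoords _ _
  have hg2 : ∀ z, coord (-1) (g z) = w₂ z / w₁ z := fun z => coord_neg_one_ofCoords _ _
  have cy1 : ∀ z ∈ Ω, ContinuousAt y₁ z := fun z hz => (h.holo₁.differentiableAt hΩ hz).continuousAt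
  have cy2 : ∀ z ∈ Ω, ContinuousAt y₂ z := fun z hz => (h.holo₂.differentiableAt hΩ hz).continuousAt
  have cw1 : ∀ z ∈ Ω, ContinuousAt w₁ z := fun z hz => (h.conj₁.differentiableAt hΩ hz).continuousAt
  have cw2 : ∀ z ∈ Ω, ContinuousAt w₂ z := fun z hz => (h.conj₂.differentiableAt hΩ hz).continuousAt
  have hreg : ∀ z ∈ Ω, y₁ z ≠ 0 → w₁ z ≠ 0 → HolomorphicAt g z := by
    intro z hz h1 h2
    obtain ⟨U, hU, hUo, hzU⟩ := eventually_nhds_iff.1 ((hΩ.eventually_mem hz).and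
      (((cy1 z hz).eventually_ne h1).and ((cw1 z hz).eventually_ne h2)))
    have hsub : U ⊆ Ω := fun w hw => (hU w hw).1
    refine holomorphicAt_iff.2 ⟨U, hUo, hzU, fun s hs => ?_⟩
    rcases sq_eq_one_iff.1 hs with rfl | rfl
    · simp only [hg1]
      exact (h.holo₂.mono hsub).div hUo (h.holo₁.mono hsub) fun w hw => (hU w hw).2.1
    · simp only [hg2]
      exact (h.conj₂.mono hsub).div hUo (h.conj₁.mono hsub) fun w hw => (hU w hw).2.2
  have hσ := h.sign_ne_zero
  -- Division by zero assigns a value to `g` at every point, so regularity there has to be refuted: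
  -- it would extend `coord 1 (g w) * y₁ w = y₂ w` by continuity to a zero of `y₁`, making `y₂`
  -- vanish as well, against the Wronskian. The same holds for the other coordinate.
  have hreg' : ∀ z ∈ Ω, HolomorphicAt g z → y₁ z ≠ 0 ∧ w₁ z ≠ 0 := by
    intro z hz hgz
    constructor
    · intro h0
      have h1 : coord 1 (g z) * y₁ z = y₂ z := by
        refine h.eq_of_continuousAt (F := fun w => coord 1 (g w) * y₁ w) hΩ hz
          ((hgz.continuousAt_coord 1).mul (cy1 z hz)) (cy2 z hz)
          (Eventually.of_forall fun w h1 _ => ?_)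
        rw [hg1, div_mul_cancel₀ _ h1]
      have h2 := h.wronsk_eq z hz
      rw [wronsk, ← h1, h0] at h2
      apply hσ
      rw [← h2]
      ring
    · intro h0
      have h1 : coord (-1) (g z) * w₁ z = w₂ z := by
        refine h.eq_of_continuousAt (F := fun w => coord (-1) (g w) * w₁ w) hΩ hz
          ((hgz.continuousAt_coord (-1)).mul (cw1 z hz)) (cw2 z hz)
          (Eventually.of_forall fun w _ h1 => ?_)
        rw [hg2, div_mul_cancel₀ _ h1]
      have h2 := h.wronsk_conj_eq z hz
      rw [wronsk, ← h1, h0] at h2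
      apply hσ
      rw [← h2]
      ring
  have hlift : IsLift Ω g σ y₁ y₂ w₁ w₂ := by
    refine ⟨h, fun z hz => ⟨hreg' z hz, fun h0 => hreg z hz h0.1 h0.2⟩, fun z hz hgz => ?_,
      fun z hz hgz => ?_⟩
    · rw [hg1, div_mul_cancel₀ _ (hreg' z hz hgz).1]
    · rw [hg2, div_mul_cancel₀ _ (hreg' z hz hgz).2]
  refine ⟨⟨fun z hz => ?_, fun z hz hgz => ⟨fun h1 => ?_, ?_⟩⟩, hlift⟩
  · by_cases h0 : y₁ z ≠ 0 ∧ w₁ z ≠ 0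
    · exact Or.inl (hreg z hz h0.1 h0.2)
    · right
      obtain ⟨U₁, k₁, o1, m1, hk1, e1, n1⟩ := exists_numerator (by norm_num) hΩ h.holo₁ h.holo₂ hz
        (by rw [h.wronsk_eq z hz]; exact hσ)
      obtain ⟨U₂, k₂, o2, m2, hk2, e2, n2⟩ := exists_numerator (by norm_num) hΩ h.conj₁ h.conj₂ hz
        (by rw [h.wronsk_conj_eq z hz]; exact hσ)
      refine ⟨fun w => ofCoords (k₁ w) (k₂ w), holomorphicAt_iff.2 ⟨U₁ ∩ U₂, o1.inter o2, ⟨m1, m2⟩,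
        fun s hs => ?_⟩, fun hz0 => ?_, ?_⟩
      · rcases sq_eq_one_iff.1 hs with rfl | rfl
        · simp only [coord_one_ofCoords]
          exact hk1.mono Set.inter_subset_left
        · simp only [coord_neg_one_ofCoords]
          exact hk2.mono Set.inter_subset_right
      · have z1 := congrArg (coord 1) hz0
        have z2 := congrArg (coord (-1)) hz0
        simp only [coord_one_ofCoords, map_zero] at z1
        simp only [coord_neg_one_ofCoords, map_zero] at z2
        -- At a non-regular point at least one of the denominators vanishes, and the corresponding
        -- numerator does not.
        exact h0 ⟨fun h => n1 h z1, fun h => n2 h z2⟩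
      · filter_upwards [o1.mem_nhds m1, o2.mem_nhds m2] with w hw1 hw2 hu
        rw [isUnit_iff_coord] at hu
        refine coord_ext fun s hs => ?_
        rw [coord_mul hs]
        rcases sq_eq_one_iff.1 hs with rfl | rfl
        · rw [hg1, coord_one_ofCoords, e1 w hw1 (hu 1 hs)]
        · rw [hg2, coord_neg_one_ofCoords, e2 w hw2 (hu (-1) hs)]
  · have h2 := hlift.norm_eq hz hgz
    obtain ⟨n1, n2⟩ := hreg' z hz hgz
    rw [h1, add_neg_cancel, eq_comm, div_eq_zero_iff] at h2
    exact h2.elim (h.ne_zero z hz) (mul_ne_zero n1 n2)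
  · obtain ⟨n1, n2⟩ := hreg' z hz hgz
    rw [hlift.norm_dz_eq hΩ hz hgz]
    positivity

theorem IsLift.represents_iff (hΩ : IsOpen Ω) (h : IsLift Ω g σ y₁ y₂ w₁ w₂) :
    Represents Ω g lam ↔ ∀ z ∈ Ω, y₁ z ≠ 0 → w₁ z ≠ 0 →
      Real.exp (lam z) = |y₁ z * w₁ z + y₂ z * w₂ z| / 2 := by
  have key : ∀ z ∈ Ω, HolomorphicAt g z →
      |1 + QuadraticAlgebra.norm (g z)| / (2 * √(QuadraticAlgebra.norm (dz g z))) =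
        |y₁ z * w₁ z + y₂ z * w₂ z| / 2 := by
    intro z hz hg
    obtain ⟨n1, n2⟩ := (h.regular_iff z hz).1 hg
    have h0 : |y₁ z * w₁ z| ≠ 0 := abs_ne_zero.2 (mul_ne_zero n1 n2)
    rw [h.norm_eq hz hg, h.norm_dz_eq hΩ hz hg, Real.sqrt_sq_eq_abs, abs_div, abs_div, abs_one]
    field_simp
  unfold Represents
  constructor
  · intro hr z hz h1 h2
    have hg := (h.regular_iff z hz).2 ⟨h1, h2⟩
    rw [hr z hz hg, key z hz hg]
  · intro hr z hz hg
    obtain ⟨n1, n2⟩ := (h.regular_iff z hz).1 hg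
    rw [hr z hz n1 n2, key z hz hg]

theorem IsLift.represents_iff_of_continuousOn (hΩ : IsOpen Ω) (h : IsLift Ω g σ y₁ y₂ w₁ w₂)
    (hlam : ContinuousOn lam Ω) : Represents Ω g lam ↔
      ∀ z ∈ Ω, Real.exp (lam z) = |y₁ z * w₁ z + y₂ z * w₂ z| / 2 := by
  rw [h.represents_iff hΩ]
  refine ⟨fun hr z hz => ?_, fun hr z hz _ _ => hr z hz⟩
  refine h.eq_of_continuousAt (F := fun z => Real.exp (lam z))
    (G := fun z => |y₁ z * w₁ z + y₂ z * w₂ z| / 2) hΩ hz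
    (hlam.continuousAt (hΩ.mem_nhds hz)).rexp
    ((h.contDiffOn.continuousOn.continuousAt (hΩ.mem_nhds hz)).abs.div_const 2) ?_
  filter_upwards [hΩ.mem_nhds hz] with w hw using hr w hw

end Paracomplex

namespace Paracomplex

variable {Ω : Set Paracomplex} {s σ τ : ℝ} {z : Paracomplex}
  {g : Paracomplex → Paracomplex} {y₁ y₂ w₁ w₂ : Paracomplex → ℝ}

/-! ### Lifts of one null coordinate -/

theorem _root_.HoloOn.comp_real {f : Paracomplex → ℝ} {e : Fin 2 → Paracomplex} (hΩ : IsOpen Ω)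
    (hf : HoloOn e s Ω f) {φ : ℝ → ℝ} (hφ : ∀ z ∈ Ω, ContDiffAt ℝ ∞ φ (f z)) :
    HoloOn e s Ω fun z => φ (f z) := by
  refine ⟨fun z hz => ((hφ z hz).comp z
    (hf.smooth.contDiffAt (hΩ.mem_nhds hz))).contDiffWithinAt, fun z hz => ?_⟩
  rw [wirt_comp ((hφ z hz).differentiableAt (by simp)).hasDerivAt (hf.differentiableAt hΩ hz),
    hf.wirt_neg z hz, mul_zero]

/-- As `1 / √k'` must be real, the sign `τ` of `k'` is inserted under the root. It becomes the sign
of the Wronskian of the lift. -/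
theorem exists_sq_mul_wirt_eq {U : Set Paracomplex} (hU : IsOpen U) {k : Paracomplex → ℝ}
    (hk : HoloOn frame s U k) (hz : z ∈ U) (hk' : wirt frame s k z ≠ 0) :
    ∃ V τ r, IsOpen V ∧ z ∈ V ∧ V ⊆ U ∧ τ ^ 2 = 1 ∧ HoloOn frame s V r ∧
      ∀ w ∈ V, r w ^ 2 * wirt frame s k w = τ := by
  obtain ⟨τ, hτ, hpos⟩ : ∃ τ : ℝ, τ ^ 2 = 1 ∧ 0 < τ * wirt frame s k z := by
    rcases lt_or_gt_of_ne hk' with h | h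
    · exact ⟨-1, by norm_num, by linarith⟩
    · exact ⟨1, by norm_num, by linarith⟩
  have hkw := (hk.wirt hU).const_mul hU τ
  obtain ⟨V, hV, hVo, hzV⟩ := eventually_nhds_iff.1 ((hU.eventually_mem hz).and
    ((hkw.differentiableAt hU hz).continuousAt.eventually (lt_mem_nhds hpos)))
  have hsub : V ⊆ U := fun w hw => (hV w hw).1
  refine ⟨V, τ, fun w => (√(τ * wirt frame s k w))⁻¹, hVo, hzV, hsub, hτ,
    ((hkw.mono hsub).comp_real hVo fun w hw => Real.contDiffAt_sqrt (hV w hw).2.ne').inv hVo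
      fun w hw => (Real.sqrt_pos.2 (hV w hw).2).ne', fun w hw => ?_⟩
  have h1 := (hV w hw).2
  rw [inv_pow, Real.sq_sqrt h1.le]
  have h2 : wirt frame s k w ≠ 0 := right_ne_zero_of_mul h1.ne'
  have h3 : τ ≠ 0 := left_ne_zero_of_mul h1.ne'
  field_simp
  exact hτ.symm

/-- A lift of the null coordinate `coord s ∘ g` of `g`. -/
structure IsHalfLift (s : ℝ) (Ω : Set Paracomplex) (g : Paracomplex → Paracomplex) (σ : ℝ)
    (y₁ y₂ : Paracomplex → ℝ) : Prop where
  sq_eq : σ ^ 2 = 1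
  holo₁ : HoloOn frame s Ω y₁
  holo₂ : HoloOn frame s Ω y₂
  wronsk_eq : ∀ z ∈ Ω, wronsk frame s y₁ y₂ z = σ
  mul_eq : ∀ z ∈ Ω, HolomorphicAt g z → coord s (g z) * y₁ z = y₂ z

theorem IsHalfLift.ne_zero_or (h : IsHalfLift s Ω g σ y₁ y₂) (hz : z ∈ Ω) :
    y₁ z ≠ 0 ∨ y₂ z ≠ 0 := by
  by_contra! h0
  have h1 := h.wronsk_eq z hz
  rw [wronsk, h0.1, h0.2] at h1
  have h2 := h.sq_eq
  rw [← h1] at h2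
  norm_num at h2

theorem IsHalfLift.ne_zero (h : IsHalfLift s Ω g σ y₁ y₂) (hz : z ∈ Ω) (hg : HolomorphicAt g z) :
    y₁ z ≠ 0 := by
  intro h0
  have h1 := h.mul_eq z hz hg
  rw [h0, mul_zero] at h1
  exact (h.ne_zero_or hz).elim (fun h => h h0) fun h => h h1.symm

theorem IsHalfLift.coord_dz_eq (hs : s ^ 2 = 1) (hΩ : IsOpen Ω) (h : IsHalfLift s Ω g σ y₁ y₂)
    (hz : z ∈ Ω) (hg : HolomorphicAt g z) : coord s (dz g z) = σ / y₁ z ^ 2 := by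
  have h1 : (fun w => coord s (g w)) =ᶠ[𝓝 z] fun w => y₂ w / y₁ w := by
    filter_upwards [hg.eventually, hΩ.mem_nhds hz] with w hw hwΩ
    rw [eq_div_iff (h.ne_zero hwΩ hw), h.mul_eq w hwΩ hw]
  rw [(coord_dz hs hg.differentiableAt).1, wirt_congr h1,
    wirt_div (h.holo₂.differentiableAt hΩ hz) (h.holo₁.differentiableAt hΩ hz) (h.ne_zero hz hg),
    ← h.wronsk_eq z hz, wronsk]
  ring

/-- The two alternatives are a regular coordinate `k` and a coordinate whose reciprocal `k` is
regular. In the second one numerator and denominator change roles, which reverses the sign of the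
Wronskian. -/
theorem exists_halfLift_of_eventually {U : Set Paracomplex} (hU : IsOpen U) {k : Paracomplex → ℝ}
    (hk : HoloOn frame s U k) (hz : z ∈ U) (hk' : wirt frame s k z ≠ 0)
    (hg : (∀ᶠ w in 𝓝 z, IsUnit (w - z) → coord s (g w) = k w) ∨
      ∀ᶠ w in 𝓝 z, IsUnit (w - z) → coord s (g w) * k w = 1) :
    ∃ V, IsOpen V ∧ z ∈ V ∧ V ⊆ U ∧ ∃ τ y₁ y₂, IsHalfLift s V g τ y₁ y₂ := by
  obtain ⟨V, τ, r, hV, hzV, hVU, hτ, hr, hrk⟩ := exists_sq_mul_wirt_eq hU hk hz hk'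
  -- The relation is known off the null lines through `z` only; at regular points of `g` it extends
  -- by continuity.
  have ext : ∀ {W : Set Paracomplex} {y₁ y₂ : Paracomplex → ℝ}, IsOpen W → HoloOn frame s W y₁ →
      HoloOn frame s W y₂ → (∀ w ∈ W, IsUnit (w - z) → coord s (g w) * y₁ w = y₂ w) →
      ∀ w ∈ W, HolomorphicAt g w → coord s (g w) * y₁ w = y₂ w := by
    intro W y₁ y₂ hW h1 h2 h w hw hgw
    refine eq_of_eventually_isUnit (F := fun w => coord s (g w) * y₁ w)
      ((hgw.continuousAt_coord s).mul (h1.differentiableAt hW hw).continuousAt)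
      (h2.differentiableAt hW hw).continuousAt z ?_
    filter_upwards [hW.mem_nhds hw] with x hx using h x hx
  have wr : ∀ w ∈ V, wronsk frame s r (fun w => k w * r w) w = τ := by
    intro w hw
    rw [wronsk, wirt_mul (hk.differentiableAt hU (hVU hw)) (hr.differentiableAt hV hw), ← hrk w hw]
    ring
  have hkr := (hk.mono hVU).mul hV hr
  rcases hg with hg | hg
  · obtain ⟨W, hW, hWo, hzW⟩ := eventually_nhds_iff.1 (hg.and (hV.eventually_mem hzV))
    have hWV : W ⊆ V := fun w hw => (hW w hw).2
    refine ⟨W, hWo, hzW, hWV.trans hVU, τ, r, fun w => k w * r w, hτ, hr.mono hWV, hkr.mono hWV,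
      fun w hw => wr w (hWV hw), ext hWo (hr.mono hWV) (hkr.mono hWV) fun w hw hu => ?_⟩
    rw [(hW w hw).1 hu]
  · obtain ⟨W, hW, hWo, hzW⟩ := eventually_nhds_iff.1 (hg.and (hV.eventually_mem hzV))
    have hWV : W ⊆ V := fun w hw => (hW w hw).2
    refine ⟨W, hWo, hzW, hWV.trans hVU, -τ, fun w => k w * r w, r, by rw [neg_sq, hτ],
      hkr.mono hWV, hr.mono hWV, fun w hw => ?_,
      ext hWo (hkr.mono hWV) (hr.mono hWV) fun w hw hu => ?_⟩
    · rw [← wr w (hWV hw), wronsk, wronsk]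
      ring
    · rw [← mul_assoc, (hW w hw).1 hu, one_mul]

theorem IsDatum.coord_dz_ne_zero (hg : IsDatum Ω g) (hs : s ^ 2 = 1) (hz : z ∈ Ω)
    (hgz : HolomorphicAt g z) : coord s (dz g z) ≠ 0 := by
  have h1 := (hg.2 z hz hgz).2
  rw [norm_eq_coord_mul] at h1
  rcases sq_eq_one_iff.1 hs with rfl | rfl
  · exact left_ne_zero_of_mul h1.ne'
  · exact right_ne_zero_of_mul h1.ne'

theorem IsDatum.eventually_holomorphicAt (hg : IsDatum Ω g) (hz : z ∈ Ω) :
    ∀ᶠ w in 𝓝 z, IsUnit (w - z) → HolomorphicAt g w := by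
  rcases hg.1 z hz with h | h
  · exact h.eventually.mono fun w hw _ => hw
  · exact h.eventually_holomorphicAt

theorem IsDatum.eq_of_continuousAt (hg : IsDatum Ω g) (hz : z ∈ Ω) {F G : Paracomplex → ℝ}
    (hF : ContinuousAt F z) (hG : ContinuousAt G z)
    (hFG : ∀ᶠ w in 𝓝 z, HolomorphicAt g w → F w = G w) : F z = G z := by
  refine eq_of_eventually_isUnit hF hG z ?_
  filter_upwards [hFG, hg.eventually_holomorphicAt hz] with w h1 h2 hu using h1 (h2 hu)

/-! ### Half lifts near regular points and poles. -/

theorem eq_or_eq_neg_of_sq {t : ℝ} (hs : s ^ 2 = 1) (ht : t ^ 2 = 1) : t = s ∨ t = -s :=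
  sq_eq_sq_iff_eq_or_eq_neg.1 (ht.trans hs.symm)

/-- Near a pole `h / (z - z₀)` whose residue `h z₀` has a vanishing null coordinate, the points on
the corresponding null line through `z₀` are regular. -/
theorem IsDatum.exists_holomorphicAt_of_coord_eq_zero (hg : IsDatum Ω g) (hs : s ^ 2 = 1)
    {B : Set Paracomplex} (hB : IsOpen B) (hconv : Convex ℝ B) (hBΩ : B ⊆ Ω) (hz : z ∈ B)
    {h : Paracomplex → Paracomplex}
    (hh : ∀ s : ℝ, s ^ 2 = 1 → HoloOn frame s B fun w => coord s (h w))
    (hgh : ∀ w ∈ B, IsUnit (w - z) → g w * (w - z) = h w) (h0 : coord s (h z) = 0) :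
    ∃ z₁ ∈ B, coord s z₁ = coord s z ∧ coord (-s) z₁ ≠ coord (-s) z ∧ HolomorphicAt g z₁ := by
  have hs' : (-s) ^ 2 = 1 := by rw [neg_sq, hs]
  obtain ⟨t, ht0, htB⟩ : ∃ t : ℝ, t ≠ 0 ∧ z + t • dir (-s) ∈ B := by
    have hc : Tendsto (fun t : ℝ => z + t • dir (-s)) (𝓝[≠] 0) (𝓝 z) := by
      have : ContinuousAt (fun t : ℝ => z + t • dir (-s)) 0 := by fun_prop
      have h2 := this.tendsto
      simp only [zero_smul, add_zero] at h2
      exact h2.mono_left nhdsWithin_le_nhds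
    obtain ⟨t, h1, h2⟩ := ((hc.eventually (hB.mem_nhds hz)).and self_mem_nhdsWithin).exists
    exact ⟨t, h2, h1⟩
  set z₁ := z + t • dir (-s) with hz₁
  have c1 : coord s z₁ = coord s z := by
    rw [hz₁, map_add, map_smul, coord_dir, smul_eq_mul]
    linear_combination (-t) * hs
  have c2 : coord (-s) (z₁ - z) ≠ 0 := by
    rw [hz₁, add_sub_cancel_left, map_smul, coord_dir, smul_eq_mul]
    have : 1 + -s * -s = 2 := by linear_combination hs
    rw [this]
    exact mul_ne_zero ht0 two_ne_zero
  refine ⟨z₁, htB, c1, fun h => c2 (by rw [map_sub, h, sub_self]), ?_⟩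
  refine (hg.1 z₁ (hBΩ htB)).resolve_right ?_
  rintro ⟨k, hk, hk0, hgk⟩
  have cont : ∀ a : ℝ, ∀ c w : Paracomplex, ContinuousAt (fun w => coord a (w - c)) w :=
    fun a c w => by fun_prop
  have hch : ∀ a : ℝ, a ^ 2 = 1 → ContinuousAt (fun w => coord a (h w)) z₁ := fun a ha =>
    ((hh a ha).differentiableAt hB htB).continuousAt
  have hu : ∀ᶠ w in 𝓝 z₁, IsUnit (w - z₁) → IsUnit (w - z) ∧ coord s (w - z₁) = coord s (w - z) := by
    filter_upwards [(cont (-s) z z₁).eventually_ne c2] with w hw hw1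
    have h1 : coord s (w - z₁) = coord s (w - z) := by rw [map_sub, map_sub, c1]
    refine ⟨isUnit_iff_coord.2 fun a ha => ?_, h1⟩
    rcases eq_or_eq_neg_of_sq hs ha with rfl | rfl
    · rw [← h1]
      exact isUnit_iff_coord.1 hw1 _ hs
    · exact hw
  -- If `z₁` were a pole with numerator `k`, both coordinates of `k z₁` would vanish: one equals the
  -- vanishing coordinate of `h`, and the other because the corresponding coordinate of `g` has an
  -- invertible denominator at `z₁`.
  refine hk0 (coord_ext fun a ha => ?_)
  rw [map_zero]
  rcases eq_or_eq_neg_of_sq hs ha with rfl | rfl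
  · have h1 : coord a (k z₁) = coord a (h z₁) := by
      refine eq_of_eventually_isUnit (F := fun w => coord a (k w)) (hk.continuousAt_coord a)
        (hch a ha) z₁ ?_
      filter_upwards [hgk, hu, hB.mem_nhds htB] with w e1 e2 hw hw1
      rw [← e1 hw1, ← hgh w hw (e2 hw1).1, coord_mul ha, coord_mul ha, (e2 hw1).2]
    exact h1.trans ((eq_of_coord_eq ha hB hconv (hh a ha) htB hz c1).trans h0)
  · have h1 : coord (-s) (k z₁) * coord (-s) (z₁ - z) =
        coord (-s) (h z₁) * coord (-s) (z₁ - z₁) := by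
      refine eq_of_eventually_isUnit (F := fun w => coord (-s) (k w) * coord (-s) (w - z))
        (G := fun w => coord (-s) (h w) * coord (-s) (w - z₁))
        ((hk.continuousAt_coord _).mul (cont _ _ _)) ((hch _ ha).mul (cont _ _ _)) z₁ ?_
      filter_upwards [hgk, hu, hB.mem_nhds htB] with w e1 e2 hw hw1
      rw [← e1 hw1, ← hgh w hw (e2 hw1).1, coord_mul ha, coord_mul ha]
      ring
    rw [sub_self, map_zero, mul_zero] at h1
    exact (mul_eq_zero.1 h1).resolve_right c2

/-- At a pole `h / (w - z)` the coordinate with `coord s (h z) ≠ 0` has a regular reciprocal with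
nonzero derivative. If `coord s (h z) = 0`, this coordinate of `g` is in fact regular: it can be
read off at a regular point `z₁` of the same null line and extended by freezing. -/
theorem IsDatum.exists_local_halfLift (hΩ : IsOpen Ω) (hg : IsDatum Ω g) (hs : s ^ 2 = 1)
    (hz : z ∈ Ω) : ∃ V, IsOpen V ∧ z ∈ V ∧ V ⊆ Ω ∧ ∃ τ y₁ y₂, IsHalfLift s V g τ y₁ y₂ := by
  have shrink : ∀ {U : Set Paracomplex} {P : Set Paracomplex → Prop},
      (∃ V, IsOpen V ∧ z ∈ V ∧ V ⊆ U ∩ Ω ∧ P V) → ∃ V, IsOpen V ∧ z ∈ V ∧ V ⊆ Ω ∧ P V :=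
    fun ⟨V, h1, h2, h3, h4⟩ => ⟨V, h1, h2, h3.trans Set.inter_subset_right, h4⟩
  rcases hg.1 z hz with hgz | ⟨h, hh, hh0, hgh⟩
  · obtain ⟨U, hU, hzU, hgU⟩ := holomorphicAt_iff.1 hgz
    refine shrink (U := U) (exists_halfLift_of_eventually (hU.inter hΩ)
      ((hgU s hs).mono Set.inter_subset_left) ⟨hzU, hz⟩ ?_ (Or.inl (Eventually.of_forall
        fun _ _ => rfl)))
    rw [← (coord_dz hs hgz.differentiableAt).1]
    exact hg.coord_dz_ne_zero hs hz hgz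
  · obtain ⟨U, hU, hzU, hhU⟩ := holomorphicAt_iff.1 hh
    by_cases h0 : coord s (h z) = 0
    · obtain ⟨r, hr, hball⟩ := Metric.eventually_nhds_iff_ball.1 ((hU.eventually_mem hzU).and
        ((hΩ.eventually_mem hz).and hgh))
      set B := Metric.ball z r with hBdef
      have hBo : IsOpen B := Metric.isOpen_ball
      have hzB : z ∈ B := Metric.mem_ball_self hr
      have hhB : ∀ s : ℝ, s ^ 2 = 1 → HoloOn frame s B fun w => coord s (h w) :=
        fun s hs => (hhU s hs).mono fun w hw => (hball w hw).1
      obtain ⟨z₁, hz₁, c1, c2, hgz₁⟩ := hg.exists_holomorphicAt_of_coord_eq_zero hs hBo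
        (convex_ball z r) (fun w hw => (hball w hw).2.1) hzB hhB (fun w hw => (hball w hw).2.2) h0
      obtain ⟨W, hW, hzW, hgW⟩ := holomorphicAt_iff.1 hgz₁
      have hfz : freeze s z₁ z = z₁ := freeze_eq_of_coord_eq s c1.symm
      have hWB := hW.inter hBo
      have hk := holoOn_freeze (c := z₁) hs hWB ((hgW s hs).mono
        (Set.inter_subset_left : W ∩ B ⊆ W)).smooth
      have hmem : z ∈ freeze s z₁ ⁻¹' (W ∩ B) := by
        rw [Set.mem_preimage, hfz]
        exact ⟨hzW, hz₁⟩
      have hopen : IsOpen (freeze s z₁ ⁻¹' (W ∩ B)) := isOpen_preimage_freeze hWB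
      refine shrink (U := freeze s z₁ ⁻¹' (W ∩ B)) (exists_halfLift_of_eventually
        (hopen.inter hΩ) (hk.mono Set.inter_subset_left) ⟨hmem, hz⟩ ?_ (Or.inl ?_))
      · rw [(wirt_freeze (f := fun w => coord s (g w)) hs (by
          rw [hfz]; exact (hgW s hs).differentiableAt hW hzW)).1, hfz,
          ← (coord_dz hs hgz₁.differentiableAt).1]
        exact hg.coord_dz_ne_zero hs (hball z₁ hz₁).2.1 hgz₁
      · filter_upwards [hopen.mem_nhds hmem, hBo.mem_nhds hzB] with w hw hwB hu
        have hu0 : coord s (w - z) ≠ 0 := isUnit_iff_coord.1 hu s hs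
        have e1 : coord s (freeze s z₁ w - z) = coord s (w - z) := by
          rw [map_sub, map_sub, coord_freeze hs]
        have hu' : IsUnit (freeze s z₁ w - z) := by
          refine isUnit_iff_coord.2 fun a ha => ?_
          rcases eq_or_eq_neg_of_sq hs ha with rfl | rfl
          · rwa [e1]
          · rw [map_sub, coord_neg_freeze hs]
            exact sub_ne_zero.2 c2
        -- The points `w` and `freeze s z₁ w` have the same `s`-coordinate, hence the same values of
        -- `coord s ∘ h` and of `coord s (· - z)`; dividing shows that `coord s ∘ g` agrees as well.
        have e2 := congrArg (coord s) ((hball w hwB).2.2 hu)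
        have e3 := congrArg (coord s) ((hball _ hw.2).2.2 hu')
        have e4 : coord s (h (freeze s z₁ w)) = coord s (h w) :=
          eq_of_coord_eq hs hBo (convex_ball z r) (hhB s hs) hw.2 hwB (coord_freeze hs z₁ w)
        rw [coord_mul hs] at e2 e3
        rw [e4, e1] at e3
        exact mul_right_cancel₀ hu0 (e2.trans e3.symm)
    · have hc : ContinuousAt (fun w => coord s (h w)) z :=
        ((hhU s hs).differentiableAt hU hzU).continuousAt
      obtain ⟨V, hV, hVo, hzV⟩ := eventually_nhds_iff.1
        ((hc.eventually_ne h0).and ((hU.eventually_mem hzU).and hgh))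
      have hVU : V ⊆ U := fun w hw => (hV w hw).2.1
      have hcs : HoloOn frame s V fun w => coord s (w - z) := holoOn_comp_coord hs contDiff_id z V
      have hk := hcs.div hVo ((hhU s hs).mono hVU) fun w hw => (hV w hw).1
      refine shrink (U := V) (exists_halfLift_of_eventually (hVo.inter hΩ)
        (hk.mono Set.inter_subset_left) ⟨hzV, hz⟩ ?_ (Or.inr ?_))
      · rw [wirt_div (hcs.differentiableAt hVo hzV) ((hhU s hs).differentiableAt hU hzU) h0,
          wirt_coord_sub hs]
        simp [h0]
      · filter_upwards [hVo.mem_nhds hzV] with w hw hu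
        have e1 := congrArg (coord s) ((hV w hw).2.2 hu)
        rw [coord_mul hs] at e1
        change coord s (g w) * (coord s (w - z) / coord s (h w)) = 1
        rw [← mul_div_assoc, e1, div_self (hV w hw).1]

/-- The derivative of the coordinate determines `y₁⁴`, hence `y₁²` by reality, whatever the local
signs of the Wronskian. The pairs glue up to sign, and the Wronskian, continuous with square `1`, is
constant. -/
theorem IsDatum.exists_halfLift (hΩ : IsOpen Ω) (hsc : IsSimplyConnected Ω) (hg : IsDatum Ω g)
    (hs : s ^ 2 = 1) : ∃ σ y₁ y₂, IsHalfLift s Ω g σ y₁ y₂ := by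
  have hloc : ∀ z : Paracomplex, ∃ U : Set Paracomplex, ∃ (τ : ℝ) (y₁ y₂ : Paracomplex → ℝ),
      z ∈ Ω → IsOpen U ∧ z ∈ U ∧ U ⊆ Ω ∧ IsHalfLift s U g τ y₁ y₂ := by
    intro z
    by_cases hz : z ∈ Ω
    · obtain ⟨U, h1, h2, h3, τ, y₁, y₂, h4⟩ := hg.exists_local_halfLift hΩ hs hz
      exact ⟨U, τ, y₁, y₂, fun _ => ⟨h1, h2, h3, h4⟩⟩
    · exact ⟨∅, 0, 0, 0, fun h => absurd h hz⟩
  choose U T Y₁ Y₂ hU using hloc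
  have cont : ∀ {i z}, i ∈ Ω → z ∈ U i → ContinuousAt (Y₁ i) z ∧ ContinuousAt (Y₂ i) z := by
    intro i z hi hz
    obtain ⟨o, -, -, l⟩ := hU i hi
    exact ⟨(l.holo₁.differentiableAt o hz).continuousAt, (l.holo₂.differentiableAt o hz).continuousAt⟩
  have sq : ∀ i ∈ Ω, ∀ j ∈ Ω, ∀ z, z ∈ U i → z ∈ U j → HolomorphicAt g z →
      Y₁ i z * Y₁ i z = Y₁ j z * Y₁ j z := by
    intro i hi j hj z hzi hzj hgz
    obtain ⟨oi, -, -, li⟩ := hU i hi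
    obtain ⟨oj, -, -, lj⟩ := hU j hj
    have h1 := li.coord_dz_eq hs oi hzi hgz
    rw [lj.coord_dz_eq hs oj hzj hgz] at h1
    have ni := li.ne_zero hzi hgz
    have nj := lj.ne_zero hzj hgz
    field_simp at h1
    have h2 : (Y₁ i z ^ 2) ^ 2 = (Y₁ j z ^ 2) ^ 2 := by
      have h3 := congrArg (fun x => x ^ 2) h1
      simp only [mul_pow, li.sq_eq, lj.sq_eq] at h3
      linear_combination h3
    have h4 := (pow_left_inj₀ (sq_nonneg (Y₁ i z)) (sq_nonneg (Y₁ j z)) two_ne_zero).1 h2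
    linear_combination h4
  have nhds : ∀ i ∈ Ω, ∀ j ∈ Ω, ∀ z, z ∈ U i → z ∈ U j → ∀ᶠ w in 𝓝 z, w ∈ U i ∧ w ∈ U j :=
    fun i hi j hj z hzi hzj =>
      ((hU i hi).1.eventually_mem hzi).and ((hU j hj).1.eventually_mem hzj)
  obtain ⟨y₁, y₂, hy⟩ := exists_glue_of_sq_eq hΩ hsc U (fun i hi => (hU i hi).1)
    (fun i hi => (hU i hi).2.1) Y₁ Y₂ (fun i hi => (hU i hi).2.2.2.holo₁.smooth.continuousOn)
    (fun i hi => (hU i hi).2.2.2.holo₂.smooth.continuousOn)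
    (fun i hi z hz => (hU i hi).2.2.2.ne_zero_or hz)
    (fun i hi j hj z hz hzi hzj => by
      refine hg.eq_of_continuousAt (F := fun z => Y₁ i z * Y₁ i z) (G := fun z => Y₁ j z * Y₁ j z) hz
        ((cont hi hzi).1.mul (cont hi hzi).1) ((cont hj hzj).1.mul (cont hj hzj).1) ?_
      filter_upwards [nhds i hi j hj z hzi hzj] with w hw hgw using sq i hi j hj w hw.1 hw.2 hgw)
    (fun i hi j hj z hz hzi hzj => by
      refine hg.eq_of_continuousAt (F := fun z => Y₁ i z * Y₂ i z) (G := fun z => Y₁ j z * Y₂ j z) hz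
        ((cont hi hzi).1.mul (cont hi hzi).2) ((cont hj hzj).1.mul (cont hj hzj).2) ?_
      filter_upwards [nhds i hi j hj z hzi hzj] with w hw hgw
      rw [← (hU i hi).2.2.2.mul_eq w hw.1 hgw, ← (hU j hj).2.2.2.mul_eq w hw.2 hgw]
      linear_combination coord s (g w) * sq i hi j hj w hw.1 hw.2 hgw)
    (fun i hi j hj z hz hzi hzj => by
      refine hg.eq_of_continuousAt (F := fun z => Y₂ i z * Y₂ i z) (G := fun z => Y₂ j z * Y₂ j z) hz
        ((cont hi hzi).2.mul (cont hi hzi).2) ((cont hj hzj).2.mul (cont hj hzj).2) ?_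
      filter_upwards [nhds i hi j hj z hzi hzj] with w hw hgw
      rw [← (hU i hi).2.2.2.mul_eq w hw.1 hgw, ← (hU j hj).2.2.2.mul_eq w hw.2 hgw]
      linear_combination coord s (g w) ^ 2 * sq i hi j hj w hw.1 hw.2 hgw)
  have loc : ∀ i ∈ Ω, ∃ V c, IsOpen V ∧ i ∈ V ∧ V ⊆ U i ∧ c ^ 2 = 1 ∧
      Set.EqOn y₁ (fun z => c * Y₁ i z) V ∧ Set.EqOn y₂ (fun z => c * Y₂ i z) V := by
    intro i hi
    obtain ⟨c, hc, hev⟩ := hy i hi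
    obtain ⟨V, hV, hVo, hiV⟩ := eventually_nhds_iff.1
      (hev.and ((hU i hi).1.eventually_mem (hU i hi).2.1))
    exact ⟨V, c, hVo, hiV, fun z hz => (hV z hz).2, hc, fun z hz => (hV z hz).1.1,
      fun z hz => (hV z hz).1.2⟩
  have h1 : HoloOn frame s Ω y₁ := HoloOn.of_nhds fun i hi => by
    obtain ⟨V, c, hVo, hiV, hVU, -, e1, -⟩ := loc i hi
    exact ⟨V, hVo, hiV, (((hU i hi).2.2.2.holo₁.mono hVU).const_mul hVo c).congr hVo e1⟩
  have h2 : HoloOn frame s Ω y₂ := HoloOn.of_nhds fun i hi => by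
    obtain ⟨V, c, hVo, hiV, hVU, -, -, e2⟩ := loc i hi
    exact ⟨V, hVo, hiV, (((hU i hi).2.2.2.holo₂.mono hVU).const_mul hVo c).congr hVo e2⟩
  have hw : ∀ i ∈ Ω, wronsk frame s y₁ y₂ i = T i := by
    intro i hi
    obtain ⟨V, c, hVo, hiV, hVU, hc, e1, e2⟩ := loc i hi
    obtain ⟨o, m, -, l⟩ := hU i hi
    rw [wronsk, e1 hiV, e2 hiV, wirt_eqOn hVo e1 hiV, wirt_eqOn hVo e2 hiV,
      wirt_const_mul _ (l.holo₁.differentiableAt o m), wirt_const_mul _ (l.holo₂.differentiableAt o m),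
      ← l.wronsk_eq i m, wronsk]
    linear_combination (Y₁ i i * wirt frame s (Y₂ i) i - Y₂ i i * wirt frame s (Y₁ i) i) * hc
  have hT : ∀ i ∈ Ω, wronsk frame s y₁ y₂ i ^ 2 = 1 := fun i hi => by
    rw [hw i hi, (hU i hi).2.2.2.sq_eq]
  obtain ⟨σ, hσ, hσw⟩ := abs_eq_const_mul_of_ne_zero hsc.isPathConnected.isConnected.isPreconnected
    (h1.wronsk hΩ h2).smooth.continuousOn fun i hi h0 => by
      have := hT i hi
      rw [h0] at this
      norm_num at this
  refine ⟨σ, y₁, y₂, hσ, h1, h2, fun i hi => ?_, fun i hi hgi => ?_⟩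
  · have h3 := hσw i hi
    rw [(pow_eq_one_iff_of_nonneg (abs_nonneg _) two_ne_zero).1
      ((sq_abs _).trans (hT i hi))] at h3
    linear_combination (-σ) * h3 - (wronsk frame s y₁ y₂ i) * hσ
  · obtain ⟨V, c, hVo, hiV, hVU, hc, e1, e2⟩ := loc i hi
    rw [e1 hiV, e2 hiV]
    change coord s (g i) * (c * Y₁ i i) = c * Y₂ i i
    rw [← (hU i hi).2.2.2.mul_eq i (hU i hi).2.1 hgi]
    ring

end Paracomplex

namespace Paracomplex

variable {Ω : Set Paracomplex} {s σ σ' : ℝ} {z : Paracomplex} {lam : Paracomplex → ℝ}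
  {g g₂ : Paracomplex → Paracomplex} {y₁ y₂ w₁ w₂ Y₁ Y₂ V₁ V₂ : Paracomplex → ℝ}

/-! ### Lifts of admissible functions -/

/-- A zero of `y₁ w₁ + y₂ w₂` on the null line `y₁ = 0` can be moved off this line. -/
theorem exists_zero_of_separated (hs : s ^ 2 = 1) (hΩ : IsOpen Ω) (hy1 : HoloOn frame s Ω y₁)
    (hy2 : HoloOn frame s Ω y₂) (hw1 : HoloOn frame (-s) Ω w₁) (hw2 : HoloOn frame (-s) Ω w₂)
    (hy : ∀ z ∈ Ω, wronsk frame s y₁ y₂ z ≠ 0) (hw : ∀ z ∈ Ω, wronsk frame (-s) w₁ w₂ z ≠ 0)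
    (hz : z ∈ Ω) (h1 : y₁ z = 0) (h2 : w₂ z = 0) :
    ∃ x ∈ Ω, y₁ x ≠ 0 ∧ w₁ x ≠ 0 ∧ y₁ x * w₁ x + y₂ x * w₂ x = 0 := by
  have hy0 := hy z hz
  have hw0 := hw z hz
  rw [wronsk, h1, zero_mul, zero_sub, neg_ne_zero] at hy0
  rw [wronsk, h2, zero_mul, sub_zero] at hw0
  have hNs : ContDiffOn ℝ ∞ (fun z => y₁ z * w₁ z + y₂ z * w₂ z) Ω :=
    (hy1.smooth.mul hw1.smooth).add (hy2.smooth.mul hw2.smooth)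
  set N : Paracomplex → ℝ := fun z => y₁ z * w₁ z + y₂ z * w₂ z with hN
  have hNz : N z = 0 := by
    rw [hN]
    simp only [h1, h2]
    ring
  have hdN : fderiv ℝ N z (dir (-s)) ≠ 0 := by
    have h3 := wirt_separated (ψ := N) hΩ hw1 hw2 hy1.neg_neg hy2.neg_neg
      (fun z _ => by rw [hN]; ring) hz
    rw [wirt_frame, h1, mul_zero, zero_add] at h3
    intro h4
    rw [h4, zero_div] at h3
    exact mul_ne_zero (right_ne_zero_of_mul hw0) (left_ne_zero_of_mul hy0) h3.symm
  obtain ⟨r, hr, hB⟩ := Metric.eventually_nhds_iff_ball.1 ((hΩ.eventually_mem hz).and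
    ((hw1.differentiableAt hΩ hz).continuousAt.eventually_ne (left_ne_zero_of_mul hw0)))
  set B := Metric.ball z r with hBdef
  have hBo : IsOpen B := Metric.isOpen_ball
  have hzB : z ∈ B := Metric.mem_ball_self hr
  have hBΩ : B ⊆ Ω := fun w hw => (hB w hw).1
  have hline : HasDerivAt (fun t : ℝ => z + t • dir (-s)) (dir (-s)) 0 := by
    simpa using ((hasDerivAt_id (0 : ℝ)).smul_const (dir (-s))).const_add z
  -- On the null line through `z` the derivative of `N` is nonzero, so `N` takes both signs there.
  -- This persists on nearby parallel lines; on one of them `y₁` has no zero in the ball, and the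
  -- intermediate value theorem gives the zero.
  have hLd : HasDerivAt (fun t : ℝ => N (z + t • dir (-s))) (fderiv ℝ N z (dir (-s))) 0 := by
    have h3 : HasFDerivAt N (fderiv ℝ N z) (z + (0 : ℝ) • dir (-s)) := by
      rw [zero_smul, add_zero]
      exact (hNs.differentiableAt_of_isOpen hΩ hz).hasFDerivAt
    exact h3.comp_hasDerivAt 0 hline
  have hL0 : N (z + (0 : ℝ) • dir (-s)) = 0 := by rw [zero_smul, add_zero, hNz]
  have hmem : ∀ᶠ t : ℝ in 𝓝 0, z + t • dir (-s) ∈ B := by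
    have h3 := hline.continuousAt.tendsto
    rw [zero_smul, add_zero] at h3
    exact h3.eventually (hBo.mem_nhds hzB)
  have hcoord : ∀ t : ℝ, coord s (z + t • dir (-s)) = coord s z := by
    intro t
    rw [map_add, map_smul, coord_dir, smul_eq_mul]
    linear_combination (-t) * hs
  obtain ⟨p, hpB, hpc, hp⟩ : ∃ p ∈ B, coord s p = coord s z ∧ N p < 0 := by
    have h3 : ∃ᶠ t : ℝ in 𝓝 0, N (z + t • dir (-s)) < 0 := by
      intro h3
      refine hdN (IsLocalMin.hasDerivAt_eq_zero (f := fun t : ℝ => N (z + t • dir (-s))) ?_ hLd)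
      filter_upwards [h3] with t ht
      rw [hL0]
      exact not_lt.1 ht
    obtain ⟨t, ht1, ht2⟩ := (h3.and_eventually hmem).exists
    exact ⟨_, ht2, hcoord t, ht1⟩
  obtain ⟨q, hqB, hqc, hq⟩ : ∃ q ∈ B, coord s q = coord s z ∧ 0 < N q := by
    have h3 : ∃ᶠ t : ℝ in 𝓝 0, 0 < N (z + t • dir (-s)) := by
      intro h3
      refine hdN (IsLocalMax.hasDerivAt_eq_zero (f := fun t : ℝ => N (z + t • dir (-s))) ?_ hLd)
      filter_upwards [h3] with t ht
      rw [hL0]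
      exact not_lt.1 ht
    obtain ⟨t, ht1, ht2⟩ := (h3.and_eventually hmem).exists
    exact ⟨_, ht2, hcoord t, ht1⟩
  have hNc : ∀ x ∈ B, ContinuousAt N x := fun x hx =>
    (hNs.differentiableAt_of_isOpen hΩ (hBΩ hx)).continuousAt
  have hshift : ∀ x : Paracomplex, Tendsto (fun w => x + (w - z)) (𝓝 z) (𝓝 x) := by
    intro x
    have : ContinuousAt (fun w => x + (w - z)) z := by fun_prop
    simpa [ContinuousAt] using this
  obtain ⟨V, hV, hVo, hzV⟩ := eventually_nhds_iff.1 ((hBo.eventually_mem hzB).and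
    (((hshift p).eventually (((hNc p hpB).eventually (gt_mem_nhds hp)).and
      (hBo.eventually_mem hpB))).and
    ((hshift q).eventually (((hNc q hqB).eventually (lt_mem_nhds hq)).and
      (hBo.eventually_mem hqB)))))
  obtain ⟨w, hw, hw0⟩ := exists_ne_zero_of_wronsk hVo ⟨z, hzV⟩
    fun x hx => hy x (hBΩ (hV x hx).1)
  obtain ⟨hwB, ⟨hp1, hp2⟩, hq1, hq2⟩ := hV w hw
  have hseg : segment ℝ (p + (w - z)) (q + (w - z)) ⊆ B :=
    (convex_ball z r).segment_subset hp2 hq2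
  obtain ⟨x, hx, hx0⟩ := (convex_segment (𝕜 := ℝ) (p + (w - z)) (q + (w - z))).isPreconnected.intermediate_value
    (left_mem_segment ℝ _ _) (right_mem_segment ℝ _ _)
    (fun x hx => (hNc x (hseg hx)).continuousWithinAt) ⟨hp1.le, hq1.le⟩
  have hxB := hseg hx
  refine ⟨x, hBΩ hxB, ?_, (hB x hxB).2, hx0⟩
  have hxc : coord s x = coord s w := by
    obtain ⟨α, β, -, -, hαβ, rfl⟩ := hx
    simp only [map_add, map_smul, map_sub, hpc, hqc, smul_eq_mul]
    linear_combination coord s w * hαβ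
  rwa [eq_of_coord_eq hs hBo (convex_ball z r) (hy1.mono hBΩ) hxB hwB hxc]

/-- The two half lifts are independent. Positivity of `g' ḡ'` makes their Wronskian signs equal, and
`g ḡ ≠ -1` makes `y₁ w₁ + y₂ w₂` nonzero at regular points. A zero elsewhere could be moved to a
regular point. -/
theorem IsDatum.exists_lift (hΩ : IsOpen Ω) (hsc : IsSimplyConnected Ω) (hg : IsDatum Ω g) :
    ∃ σ y₁ y₂ w₁ w₂, IsLift Ω g σ y₁ y₂ w₁ w₂ := by
  have one_sq : (1 : ℝ) ^ 2 = 1 := by norm_num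
  have neg_one_sq : (-1 : ℝ) ^ 2 = 1 := by norm_num
  obtain ⟨σ, y₁, y₂, hy⟩ := hg.exists_halfLift hΩ hsc one_sq
  obtain ⟨σ', w₁, w₂, hw⟩ := hg.exists_halfLift hΩ hsc neg_one_sq
  have hσ : σ' = σ := by
    obtain ⟨z, hz⟩ := hsc.nonempty
    obtain ⟨x, hx1, hx2, hx⟩ := ((frequently_isUnit_sub z z).and_eventually
      ((hg.eventually_holomorphicAt hz).and (hΩ.eventually_mem hz))).exists
    have h1 := (hg.2 x hx (hx2 hx1)).2
    rw [norm_eq_coord_mul, hy.coord_dz_eq one_sq hΩ hx (hx2 hx1),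
      hw.coord_dz_eq neg_one_sq hΩ hx (hx2 hx1)] at h1
    have h2 : 0 < σ * σ' := by
      by_contra! hle
      have : σ / y₁ x ^ 2 * (σ' / w₁ x ^ 2) = σ * σ' * (1 / (y₁ x ^ 2 * w₁ x ^ 2)) := by
        ring
      rw [this] at h1
      exact absurd h1 (not_lt.2 (mul_nonpos_of_nonpos_of_nonneg hle (by positivity)))
    rcases eq_or_eq_neg_of_sq hy.sq_eq hw.sq_eq with h | h
    · exact h
    · rw [h] at h2
      linarith [sq_nonneg σ]
  subst hσ
  have hσ0 : σ' ≠ 0 := fun h0 => by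
    have := hw.sq_eq
    rw [h0] at this
    norm_num at this
  have hwy : ∀ z ∈ Ω, wronsk frame 1 y₁ y₂ z ≠ 0 := fun z hz => by rw [hy.wronsk_eq z hz]; exact hσ0
  have hww : ∀ z ∈ Ω, wronsk frame (-1) w₁ w₂ z ≠ 0 := fun z hz => by
    rw [hw.wronsk_eq z hz]; exact hσ0
  have hreg : ∀ z ∈ Ω, y₁ z ≠ 0 → w₁ z ≠ 0 → HolomorphicAt g z := by
    intro z hz h1 h2
    refine (hg.1 z hz).resolve_right (not_hasSimplePoleAt_of_mul_eq
      (a := fun s => if s = 1 then y₁ else w₁) (b := fun s => if s = 1 then y₂ else w₂) ?_ ?_ ?_ ?_)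
    all_goals intro s hs
    all_goals have hne : (-1 : ℝ) ≠ 1 := by norm_num
    all_goals rcases sq_eq_one_iff.1 hs with rfl | rfl
    all_goals simp only [if_true, if_neg hne]
    · exact (hy.holo₁.differentiableAt hΩ hz).continuousAt
    · exact (hw.holo₁.differentiableAt hΩ hz).continuousAt
    · exact (hy.holo₂.differentiableAt hΩ hz).continuousAt
    · exact (hw.holo₂.differentiableAt hΩ hz).continuousAt
    · exact h1
    · exact h2
    · filter_upwards [hΩ.mem_nhds hz, hg.eventually_holomorphicAt hz] with x hx hgx hu
      exact hy.mul_eq x hx (hgx hu)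
    · filter_upwards [hΩ.mem_nhds hz, hg.eventually_holomorphicAt hz] with x hx hgx hu
      exact hw.mul_eq x hx (hgx hu)
  have hN : ∀ z ∈ Ω, y₁ z ≠ 0 → w₁ z ≠ 0 → y₁ z * w₁ z + y₂ z * w₂ z ≠ 0 := by
    intro z hz h1 h2 h0
    have hgz := hreg z hz h1 h2
    apply (hg.2 z hz hgz).1
    rw [norm_eq_coord_mul]
    rw [← hy.mul_eq z hz hgz, ← hw.mul_eq z hz hgz] at h0
    apply mul_left_cancel₀ (mul_ne_zero h1 h2)
    linear_combination h0
  refine ⟨σ', y₁, y₂, w₁, w₂, ⟨hy.sq_eq, hy.holo₁, hy.holo₂, hw.holo₁, hw.holo₂, hy.wronsk_eq,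
    hw.wronsk_eq, fun z hz h0 => ?_⟩, fun z hz => ⟨fun h => ⟨hy.ne_zero hz h, hw.ne_zero hz h⟩,
      fun h => hreg z hz h.1 h.2⟩, hy.mul_eq, hw.mul_eq⟩
  by_cases h1 : y₁ z = 0
  · have h2 : w₂ z = 0 := by
      rw [h1, zero_mul, zero_add] at h0
      exact (mul_eq_zero.1 h0).resolve_left ((hy.ne_zero_or hz).resolve_left (not_not.2 h1))
    obtain ⟨x, hx, n1, n2, n3⟩ := exists_zero_of_separated one_sq hΩ hy.holo₁ hy.holo₂ hw.holo₁
      hw.holo₂ hwy hww hz h1 h2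
    exact hN x hx n1 n2 n3
  · by_cases h2 : w₁ z = 0
    · have h3 : y₂ z = 0 := by
        rw [h2, mul_zero, zero_add] at h0
        exact (mul_eq_zero.1 h0).resolve_right ((hw.ne_zero_or hz).resolve_left (not_not.2 h2))
      obtain ⟨x, hx, n1, n2, n3⟩ := exists_zero_of_separated neg_one_sq hΩ hw.holo₁ hw.holo₂
        hy.holo₁.neg_neg hy.holo₂.neg_neg hww (by rwa [neg_neg]) hz h2 h3
      exact hN x hx n2 n1 (by linear_combination n3)
    · exact hN z hz h1 h2 h0

/-! ### Transformations -/

/-- Conjugation exchanges null coordinates, so the four real coordinates of `a` and `b` describe an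
arbitrary real matrix; only its determinant `σ σ'` is constrained. The second pair is transformed by
the contragredient matrix up to the sign `c`. -/
theorem IsSpinor.exists_combination (hΩ : IsOpen Ω) (hc : IsPreconnected Ω) (hne : Ω.Nonempty)
    (h : IsSpinor Ω σ y₁ y₂ w₁ w₂) (H : IsSpinor Ω σ' Y₁ Y₂ V₁ V₂)
    (habs : ∀ z ∈ Ω, |y₁ z * w₁ z + y₂ z * w₂ z| = |Y₁ z * V₁ z + Y₂ z * V₂ z|) :
    ∃ (a b : Paracomplex) (c : ℝ), c ≠ 0 ∧
      QuadraticAlgebra.norm a + QuadraticAlgebra.norm b = σ * σ' ∧ ∀ z ∈ Ω,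
        (Y₁ z = coord 1 (star a) * y₁ z + coord 1 (star b) * y₂ z ∧
          Y₂ z = coord 1 a * y₂ z - coord 1 b * y₁ z) ∧
        V₁ z = c * (coord (-1) (star a) * w₁ z + coord (-1) (star b) * w₂ z) ∧
          V₂ z = c * (coord (-1) a * w₂ z - coord (-1) b * w₁ z) := by
  obtain ⟨δ, hδ, hδy⟩ := h.exists_sign hc
  obtain ⟨δ', hδ', hδY⟩ := H.exists_sign hc
  obtain ⟨p, q, r, t, hM⟩ := exists_matrix_of_separated_eq span_frame one_ne_zero hΩ hc
    (ψ := fun z => |y₁ z * w₁ z + y₂ z * w₂ z|) h.holo₁ h.holo₂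
    (h.conj₁.const_mul hΩ δ) (h.conj₂.const_mul hΩ δ) H.holo₁ H.holo₂
    (H.conj₁.const_mul hΩ δ') (H.conj₂.const_mul hΩ δ')
    (fun z hz => by rw [hδy z hz]; ring) (fun z hz => by rw [habs z hz, hδY z hz]; ring)
    (fun z hz => abs_ne_zero.2 (h.ne_zero z hz)) h.sign_ne_zero h.wronsk_eq H.wronsk_eq
  have hdet : p * t - q * r = σ * σ' := by
    obtain ⟨z, hz⟩ := hne
    have h1 := H.wronsk_eq z hz
    rw [wronsk, wirt_eqOn hΩ (fun z hz => (hM z hz).1) hz,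
      wirt_eqOn hΩ (fun z hz => (hM z hz).2.1) hz, (hM z hz).1, (hM z hz).2.1] at h1
    have h2 := wronsk_combination (e := frame) (s := (1 : ℝ))
      (h.holo₁.differentiableAt hΩ hz) (h.holo₂.differentiableAt hΩ hz) p q r t
    rw [h.wronsk_eq z hz] at h2
    have h3 : (p * t - q * r) * σ = σ' := h2.symm.trans h1
    linear_combination σ * h3 - (p * t - q * r) * h.sq_eq
  have hsq : (σ * σ') ^ 2 = 1 := by rw [mul_pow, h.sq_eq, H.sq_eq, one_mul]
  -- The coordinates are dictated by `coord 1 ā = p`, `coord 1 b̄ = q`, `coord 1 b = -r`, `coord 1 a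
  -- = t`.
  refine ⟨ofCoords t p, ofCoords (-r) q, δ * δ' * (σ * σ'), ?_, ?_, fun z hz => ?_⟩
  · intro h0
    have : (δ * δ' * (σ * σ')) ^ 2 = 1 := by rw [mul_pow, mul_pow, hδ, hδ', hsq]; norm_num
    rw [h0] at this
    norm_num at this
  · rw [norm_eq_coord_mul, norm_eq_coord_mul, coord_one_ofCoords, coord_one_ofCoords,
      coord_neg_one_ofCoords, coord_neg_one_ofCoords, ← hdet]
    ring
  · obtain ⟨h1, h2, h3, h4⟩ := hM z hz
    simp only [coord_star, neg_neg, coord_one_ofCoords, coord_neg_one_ofCoords]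
    refine ⟨⟨h1, by rw [h2]; ring⟩, ?_, ?_⟩
    · linear_combination (-(δ' * (σ * σ')) * t) * h3 + (δ' * (σ * σ') * r) * h4
        - δ' ^ 2 * (σ * σ') * V₁ z * hdet - δ' ^ 2 * V₁ z * hsq - V₁ z * hδ'
    · linear_combination (δ' * (σ * σ') * q) * h3 - (δ' * (σ * σ') * p) * h4
        - δ' ^ 2 * (σ * σ') * V₂ z * hdet - δ' ^ 2 * V₂ z * hsq - V₂ z * hδ'

theorem IsLift.isTransform (h : IsLift Ω g σ y₁ y₂ w₁ w₂) (H : IsLift Ω g₂ σ' Y₁ Y₂ V₁ V₂)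
    {a b : Paracomplex} {c : ℝ} (hc : c ≠ 0)
    (hY : ∀ z ∈ Ω, (Y₁ z = coord 1 (star a) * y₁ z + coord 1 (star b) * y₂ z ∧
          Y₂ z = coord 1 a * y₂ z - coord 1 b * y₁ z) ∧
        V₁ z = c * (coord (-1) (star a) * w₁ z + coord (-1) (star b) * w₂ z) ∧
          V₂ z = c * (coord (-1) a * w₂ z - coord (-1) b * w₁ z)) : IsTransform Ω a b g g₂ := by
  intro z hz hg hg2
  obtain ⟨m1, m2⟩ := (h.regular_iff z hz).1 hg
  obtain ⟨n1, n2⟩ := (H.regular_iff z hz).1 hg2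
  obtain ⟨⟨e1, e2⟩, e3, e4⟩ := hY z hz
  have key : ∀ s : ℝ, s ^ 2 = 1 → coord s (star b * g z + star a) ≠ 0 ∧
      coord s (g₂ z) * coord s (star b * g z + star a) = coord s (a * g z - b) := by
    intro s hs
    rcases sq_eq_one_iff.1 hs with rfl | rfl
    · have f1 := h.mul_eq z hz hg
      have f2 := H.mul_eq z hz hg2
      rw [← f1] at e1 e2
      have e5 : Y₁ z = coord 1 (star b * g z + star a) * y₁ z := by
        rw [e1, map_add, coord_mul hs]
        ring
      refine ⟨fun h0 => n1 (by rw [e5, h0, zero_mul]), mul_right_cancel₀ m1 ?_⟩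
      rw [mul_assoc, ← e5, f2, e2, map_sub, coord_mul hs]
      ring
    · have f1 := h.conj_mul_eq z hz hg
      have f2 := H.conj_mul_eq z hz hg2
      rw [← f1] at e3 e4
      have e5 : V₁ z = coord (-1) (star b * g z + star a) * (c * w₁ z) := by
        rw [e3, map_add, coord_mul hs]
        ring
      refine ⟨fun h0 => n2 (by rw [e5, h0, zero_mul]), mul_right_cancel₀ (mul_ne_zero hc m2) ?_⟩
      rw [mul_assoc, ← e5, f2, e4, map_sub, coord_mul hs]
      ring
  have hu : IsUnit (star b * g z + star a) := isUnit_iff_coord.2 fun s hs => (key s hs).1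
  refine ⟨hu, (Ring.eq_mul_inverse_iff_mul_eq _ _ _ hu).2 (coord_ext fun s hs => ?_)⟩
  rw [coord_mul hs, (key s hs).2]

/-- Both Wronskians and the bilinear form are multiplied by `D = ±1`. No analogue of the factor `i`
is needed, because the sign of the Wronskians is left free. -/
theorem IsSpinor.combination (hΩ : IsOpen Ω) (h : IsSpinor Ω σ y₁ y₂ w₁ w₂) {a b : Paracomplex}
    {D : ℝ} (hab : QuadraticAlgebra.norm a + QuadraticAlgebra.norm b = D) (hD : D ^ 2 = 1) :
    IsSpinor Ω (D * σ) (fun z => coord 1 (star a) * y₁ z + coord 1 (star b) * y₂ z)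
        (fun z => -coord 1 b * y₁ z + coord 1 a * y₂ z)
        (fun z => coord (-1) (star a) * w₁ z + coord (-1) (star b) * w₂ z)
        (fun z => -coord (-1) b * w₁ z + coord (-1) a * w₂ z) ∧
      ∀ z, |(coord 1 (star a) * y₁ z + coord 1 (star b) * y₂ z) *
          (coord (-1) (star a) * w₁ z + coord (-1) (star b) * w₂ z) +
        (-coord 1 b * y₁ z + coord 1 a * y₂ z) * (-coord (-1) b * w₁ z + coord (-1) a * w₂ z)| =
        |y₁ z * w₁ z + y₂ z * w₂ z| := by
  rw [norm_eq_coord_mul, norm_eq_coord_mul] at hab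
  simp only [coord_star, neg_neg]
  have hN : ∀ z, (coord (-1) a * y₁ z + coord (-1) b * y₂ z) * (coord 1 a * w₁ z + coord 1 b * w₂ z) +
      (-coord 1 b * y₁ z + coord 1 a * y₂ z) * (-coord (-1) b * w₁ z + coord (-1) a * w₂ z) =
      D * (y₁ z * w₁ z + y₂ z * w₂ z) := by
    intro z
    rw [← hab]
    ring
  have hD0 : D ≠ 0 := fun h0 => by
    rw [h0] at hD
    norm_num at hD
  refine ⟨⟨by rw [mul_pow, hD, h.sq_eq, one_mul], h.holo₁.combination hΩ h.holo₂ _ _,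
    h.holo₁.combination hΩ h.holo₂ _ _, h.conj₁.combination hΩ h.conj₂ _ _,
    h.conj₁.combination hΩ h.conj₂ _ _, fun z hz => ?_, fun z hz => ?_, fun z hz => ?_⟩,
    fun z => ?_⟩
  · rw [wronsk_combination (h.holo₁.differentiableAt hΩ hz) (h.holo₂.differentiableAt hΩ hz),
      h.wronsk_eq z hz, ← hab]
    ring
  · rw [wronsk_combination (h.conj₁.differentiableAt hΩ hz) (h.conj₂.differentiableAt hΩ hz),
      h.wronsk_conj_eq z hz, ← hab]
    ring
  · rw [hN]
    exact mul_ne_zero hD0 (h.ne_zero z hz)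
  · rw [hN, abs_mul, (pow_eq_one_iff_of_nonneg (abs_nonneg _) two_ne_zero).1 ((sq_abs _).trans hD),
      one_mul]

/-! ### Assembly of the paracomplex case. -/

theorem IsLift.re_dz_eq (hΩ : IsOpen Ω) (h : IsLift Ω g σ y₁ y₂ w₁ w₂) (hz : z ∈ Ω)
    (hg : HolomorphicAt g z) : (dz g z).re = σ * ((1 / y₁ z ^ 2 + 1 / w₁ z ^ 2) / 2) := by
  obtain ⟨h1, h2⟩ := h.coord_dz_eq hΩ hz hg
  rw [coord_apply] at h1 h2
  linear_combination (h1 + h2) / 2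

theorem IsLift.exists_solution (hΩ : IsOpen Ω) (hc : IsPreconnected Ω)
    (h : IsLift Ω g σ y₁ y₂ w₁ w₂) :
    ∃ lam, IsLiouvilleSolution (-1) frame Ω lam ∧ Represents Ω g lam := by
  have hexp : ∀ z ∈ Ω, Real.exp (Real.log (|y₁ z * w₁ z + y₂ z * w₂ z| / 2)) =
      |y₁ z * w₁ z + y₂ z * w₂ z| / 2 := fun z hz =>
    Real.exp_log (half_pos (abs_pos.2 (h.ne_zero z hz)))
  exact ⟨_, h.toIsSpinor.isLiouvilleSolution hΩ hc hexp,
    (h.represents_iff hΩ).2 fun z hz _ _ => hexp z hz⟩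

/-- The theorem for the paracomplex numbers. -/
theorem paracomplex_representation (hΩ : IsOpen Ω) (hsc : IsSimplyConnected Ω) :
      (∀ g : Paracomplex → Paracomplex, Paracomplex.IsDatum Ω g →
        (∃ lam : Paracomplex → ℝ, IsLiouvilleSolution (-1) Paracomplex.frame Ω lam ∧
          Paracomplex.Represents Ω g lam) ∧
        (∀ lam : Paracomplex → ℝ, ContinuousOn lam Ω → Paracomplex.Represents Ω g lam →
          IsLiouvilleSolution (-1) Paracomplex.frame Ω lam)) ∧
      (∀ lam : Paracomplex → ℝ, IsLiouvilleSolution (-1) Paracomplex.frame Ω lam →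
        (∃ g : Paracomplex → Paracomplex, Paracomplex.IsDatum Ω g ∧
          Paracomplex.Represents Ω g lam) ∧
        (∀ g : Paracomplex → Paracomplex, Paracomplex.IsDatum Ω g →
            Paracomplex.Represents Ω g lam →
          (∀ a b : Paracomplex, (QuadraticAlgebra.norm a + QuadraticAlgebra.norm b = 1 ∨
              QuadraticAlgebra.norm a + QuadraticAlgebra.norm b = -1) →
            ∃ g₂ : Paracomplex → Paracomplex, Paracomplex.IsDatum Ω g₂ ∧
              Paracomplex.Represents Ω g₂ lam ∧ Paracomplex.IsTransform Ω a b g g₂) ∧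
          (∀ g₂ : Paracomplex → Paracomplex, Paracomplex.IsDatum Ω g₂ →
              Paracomplex.Represents Ω g₂ lam →
            (∃ a b : Paracomplex, (QuadraticAlgebra.norm a + QuadraticAlgebra.norm b = 1 ∨
              QuadraticAlgebra.norm a + QuadraticAlgebra.norm b = -1) ∧
                Paracomplex.IsTransform Ω a b g g₂) ∧
            ((∃ z ∈ Ω, Paracomplex.HolomorphicAt g z ∧ Paracomplex.HolomorphicAt g₂ z ∧
                0 < (Paracomplex.dz g z).re * (Paracomplex.dz g₂ z).re) →
              ∃ a b : Paracomplex, QuadraticAlgebra.norm a + QuadraticAlgebra.norm b = 1 ∧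
                Paracomplex.IsTransform Ω a b g g₂)))) := by
  have hc : IsPreconnected Ω := hsc.isPathConnected.isConnected.isPreconnected
  refine ⟨fun g hg => ?_, fun lam hlam => ⟨?_, fun g hg hrep => ?_⟩⟩
  · obtain ⟨σ, y₁, y₂, w₁, w₂, h⟩ := hg.exists_lift hΩ hsc
    refine ⟨h.exists_solution hΩ hc, fun lam hlam hrep => ?_⟩
    exact h.toIsSpinor.isLiouvilleSolution hΩ hc
      ((h.represents_iff_of_continuousOn hΩ hlam).1 hrep)
  · obtain ⟨y₁, y₂, w₁, w₂, h, hexp⟩ := exists_spinor_of_isLiouvilleSolution hΩ hsc hlam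
    obtain ⟨hd, hl⟩ := h.isDatum hΩ
    exact ⟨_, hd, (hl.represents_iff hΩ).2 fun z hz _ _ => hexp z hz⟩
  · obtain ⟨σ, y₁, y₂, w₁, w₂, h⟩ := hg.exists_lift hΩ hsc
    have hexp := (h.represents_iff_of_continuousOn hΩ hlam.1.continuousOn).1 hrep
    constructor
    · intro a b hab
      obtain ⟨hs, hN⟩ := h.toIsSpinor.combination hΩ (a := a) (b := b) rfl
        (by rcases hab with hab | hab <;> rw [hab] <;> norm_num)
      obtain ⟨hd, hl⟩ := hs.isDatum hΩ
      refine ⟨_, hd, (hl.represents_iff hΩ).2 fun z hz _ _ => by rw [hN, hexp z hz],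
        h.isTransform hl one_ne_zero fun z _ => ⟨⟨rfl, ?_⟩, ?_, ?_⟩⟩ <;> ring
    · intro g₂ hg2 hrep2
      obtain ⟨σ', Y₁, Y₂, V₁, V₂, H⟩ := hg2.exists_lift hΩ hsc
      have Hexp := (H.represents_iff_of_continuousOn hΩ hlam.1.continuousOn).1 hrep2
      obtain ⟨a, b, c, hc0, hab, hY⟩ := h.toIsSpinor.exists_combination hΩ hc hsc.nonempty
        H.toIsSpinor fun z hz => by linarith [hexp z hz, Hexp z hz]
      have ht := h.isTransform H hc0 hY
      have hσσ : σ * σ' = 1 ∨ σ * σ' = -1 :=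
        sq_eq_one_iff.1 (by rw [mul_pow, h.sq_eq, H.sq_eq, one_mul])
      refine ⟨⟨a, b, by rwa [hab], ht⟩, ?_⟩
      rintro ⟨z, hz, h1, h2, hpos⟩
      -- The real part of the derivative is `σ` times a positive number, so equal signs of the real
      -- parts mean `σ σ' = 1`.
      refine ⟨a, b, hab.trans (hσσ.resolve_right fun hneg => ?_), ht⟩
      rw [h.re_dz_eq hΩ hz h1, H.re_dz_eq hΩ hz h2, mul_mul_mul_comm, hneg] at hpos
      have : 0 ≤ (1 / y₁ z ^ 2 + 1 / w₁ z ^ 2) / 2 * ((1 / Y₁ z ^ 2 + 1 / V₁ z ^ 2) / 2) := by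
        positivity
      linarith

end Paracomplex

end

theorem theorem3 :
    -- the complex case, `ε = 1`
    (∀ Ω : Set ℂ, IsOpen Ω → IsSimplyConnected Ω →
      (∀ g : ℂ → ℂ, IsComplexDatum Ω g →
        (∃ lam : ℂ → ℝ, IsLiouvilleSolution 1 complexFrame Ω lam ∧ ComplexRepresents Ω g lam) ∧
        (∀ lam : ℂ → ℝ, ContinuousOn lam Ω → ComplexRepresents Ω g lam →
          IsLiouvilleSolution 1 complexFrame Ω lam)) ∧
      (∀ lam : ℂ → ℝ, IsLiouvilleSolution 1 complexFrame Ω lam →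
        (∃ g : ℂ → ℂ, IsComplexDatum Ω g ∧ ComplexRepresents Ω g lam) ∧
        (∀ g : ℂ → ℂ, IsComplexDatum Ω g → ComplexRepresents Ω g lam →
          (∀ a b : ℂ, (Complex.normSq a - Complex.normSq b = 1 ∨
              Complex.normSq a - Complex.normSq b = -1) →
            ∃ g₂ : ℂ → ℂ, IsComplexDatum Ω g₂ ∧ ComplexRepresents Ω g₂ lam ∧
              IsComplexTransform Ω a b g g₂) ∧
          (∀ g₂ : ℂ → ℂ, IsComplexDatum Ω g₂ → ComplexRepresents Ω g₂ lam →
            (∃ a b : ℂ, (Complex.normSq a - Complex.normSq b = 1 ∨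
              Complex.normSq a - Complex.normSq b = -1) ∧ IsComplexTransform Ω a b g g₂) ∧
            ((∃ z ∈ Ω, AnalyticAt ℂ g z ∧ AnalyticAt ℂ g₂ z ∧
                0 < (1 - Complex.normSq (g z)) * (1 - Complex.normSq (g₂ z))) →
              ∃ a b : ℂ, Complex.normSq a - Complex.normSq b = 1 ∧
                IsComplexTransform Ω a b g g₂))))) ∧
    -- the paracomplex case, `ε = -1`
    (∀ Ω : Set Paracomplex, IsOpen Ω → IsSimplyConnected Ω →
      (∀ g : Paracomplex → Paracomplex, Paracomplex.IsDatum Ω g →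
        (∃ lam : Paracomplex → ℝ, IsLiouvilleSolution (-1) Paracomplex.frame Ω lam ∧
          Paracomplex.Represents Ω g lam) ∧
        (∀ lam : Paracomplex → ℝ, ContinuousOn lam Ω → Paracomplex.Represents Ω g lam →
          IsLiouvilleSolution (-1) Paracomplex.frame Ω lam)) ∧
      (∀ lam : Paracomplex → ℝ, IsLiouvilleSolution (-1) Paracomplex.frame Ω lam →
        (∃ g : Paracomplex → Paracomplex, Paracomplex.IsDatum Ω g ∧
          Paracomplex.Represents Ω g lam) ∧
        (∀ g : Paracomplex → Paracomplex, Paracomplex.IsDatum Ω g →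
            Paracomplex.Represents Ω g lam →
          (∀ a b : Paracomplex, (QuadraticAlgebra.norm a + QuadraticAlgebra.norm b = 1 ∨
              QuadraticAlgebra.norm a + QuadraticAlgebra.norm b = -1) →
            ∃ g₂ : Paracomplex → Paracomplex, Paracomplex.IsDatum Ω g₂ ∧
              Paracomplex.Represents Ω g₂ lam ∧ Paracomplex.IsTransform Ω a b g g₂) ∧
          (∀ g₂ : Paracomplex → Paracomplex, Paracomplex.IsDatum Ω g₂ →
              Paracomplex.Represents Ω g₂ lam →
            (∃ a b : Paracomplex, (QuadraticAlgebra.norm a + QuadraticAlgebra.norm b = 1 ∨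
              QuadraticAlgebra.norm a + QuadraticAlgebra.norm b = -1) ∧
                Paracomplex.IsTransform Ω a b g g₂) ∧
            ((∃ z ∈ Ω, Paracomplex.HolomorphicAt g z ∧ Paracomplex.HolomorphicAt g₂ z ∧
                0 < (Paracomplex.dz g z).re * (Paracomplex.dz g₂ z).re) →
              ∃ a b : Paracomplex, QuadraticAlgebra.norm a + QuadraticAlgebra.norm b = 1 ∧
                Paracomplex.IsTransform Ω a b g g₂))))) := by
  exact ⟨fun _ hΩ hsc => complex_representation hΩ hsc,
    fun _ hΩ hsc => Paracomplex.paracomplex_representation hΩ hsc⟩
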